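/- Let $f\in C^1([0,\infty))$ satisfy $f(s)>0$, $f'(s)>0$ and $F(s):=\int_s^\infty \frac{d\tau}{f(\tau)}<\infty$ for all $s>0$, and let $f\in C^2((s_0,\infty))$ for some $s_0>0$. For a nonlinearity $h$ with tail integral $H(s)=\int_s^\infty d\tau/h(\tau)$ put \[ \frac1{B_1[h]}=(-\log H)\,(1-h'H),\qquad \frac1{B_2[h]}=h'H\,(-\log H)^2\Big[\frac{h\,h''H}{h'}-1\Big]. \] Assume that $\lim_{s\to\infty}f'(s)F(s)=1$ and that $B:=\lim_{s\to\infty}B_2[f](s)$ exists and lies in $[1,\infty)$. For $0\neq x\in\mathbb R^2$ near $0$ define, if $B>1$ (with $B'=B/(B-1)$), \[ v(x)=\Big(\log\tfrac1{|x|^2}\Big)^{1/B'},\qquad g(s)=\frac{4}{BB'}\,s^{1-2B'}e^{s^{B'}}, \] and, if $B=1$, \[ v(x)=\log\log\tfrac1{|x|^2},\qquad g(s)=4\,\frac{e^{e^s}}{e^{2s}}. \] Let $G(s)=\int_s^\infty d\tau/g(\tau)$, $\tilde u(x)=F^{-1}[G(v(x))]$, and \[ R_i(x)=\Big|\frac1{B_i[f](\tilde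 u(x))}-\frac1{B_i[g](v(x))}\Big|,\qquad i=1,2. \] Assume moreover that $\lim_{x\to0}(-\log|x|)^{1/2}\,[R_1(x)+R_2(x)]=0$. Then there are $R>0$ and a positive radial function $u_\infty\in C^2(B_R\setminus\{0\})\cap C(\overline{B_R}\setminus\{0\})$, where $B_R\subset\mathbb R^2$ is the disc of radius $R$ about $0$, such that \[ -\Delta u_\infty=f(u_\infty)\ \text{ in } B_R\setminus\{0\},\qquad u_\infty=0\ \text{ on }\partial B_R, \] in the classical sense, $u_\infty(x)\to\infty$ as $x\to0$, and \[ u_\infty(x)=\tilde u(x)+O\Big(f(\tilde u(x))\,F(\tilde u(x))\sup_{0<|y|\le|x|}\big(R_1(y)+R_2(y)\big)\Big)\qquad\text{as } x\to0 . \] Furthermore $u_\infty$ and $f(u_\infty)$ belong to $L^1_{\mathrm{loc}}(B_R)$, and $-\Delta u_\infty=f(u_\infty)$ in $B_R$ in the sense of distributions. -/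

import Mathlib

open scoped Laplacian

noncomputable section

namespace SingularSol

/-- The plane `ℝ²` with its Euclidean norm. -/
abbrev Plane : Type := EuclideanSpace ℝ (Fin 2)

/-- `F(s) = ∫_s^∞ dτ / h(τ)`; applied to `f` it gives `F`, applied to `g` it gives `G`. -/
def tailInt (h : ℝ → ℝ) (s : ℝ) : ℝ := ∫ τ in Set.Ioi s, (h τ)⁻¹

/-- `1 / B₁[h](s) = (-log F(s)) (1 - h'(s) F(s))`. -/
def invB1 (h : ℝ → ℝ) (s : ℝ) : ℝ :=
  (-Real.log (tailInt h s)) * (1 - deriv h s * tailInt h s)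

/-- `1 / B₂[h](s) = h'(s) F(s) (-log F(s))² (h(s) h''(s) F(s) / h'(s) - 1)`. -/
def invB2 (h : ℝ → ℝ) (s : ℝ) : ℝ :=
  deriv h s * tailInt h s * (-Real.log (tailInt h s)) ^ 2 *
    (h s * deriv (deriv h) s * tailInt h s / deriv h s - 1)

/-- Condition (f1): beyond some `s₀ > 0`, `f` is `C²`, positive, with finite tail integral `F`
and positive derivative. -/
def CondF1 (f : ℝ → ℝ) : Prop :=
  ∃ s₀ : ℝ, 0 < s₀ ∧ ContDiffOn ℝ 2 f (Set.Ioi s₀) ∧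
    ∀ s, s₀ < s →
      0 < f s ∧ MeasureTheory.IntegrableOn (fun τ => (f τ)⁻¹) (Set.Ioi s) ∧ 0 < deriv f s

/-- Condition (f2), with `B` the limit of `B₂[f]`. -/
def CondF2 (f : ℝ → ℝ) (B : ℝ) : Prop :=
  Filter.Tendsto (fun s => deriv f s * tailInt f s) Filter.atTop (nhds 1) ∧
  Filter.Tendsto (fun s => 1 / invB2 f s) Filter.atTop (nhds B) ∧
  1 ≤ B

/-- The model nonlinearity `g`; `B.conjExponent = B / (B - 1)` is the Hölder conjugate `B'`. -/
def modelG (B : ℝ) (s : ℝ) : ℝ :=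
  if B = 1 then 4 * (Real.exp (Real.exp s) / Real.exp (2 * s))
  else 4 / (B * B.conjExponent) * s ^ (1 - 2 * B.conjExponent) * Real.exp (s ^ B.conjExponent)

/-- The explicit solution `v` of `-Δ v = g(v)`. -/
def modelV (B : ℝ) (x : Plane) : ℝ :=
  if B = 1 then Real.log (Real.log (1 / ‖x‖ ^ 2))
  else (Real.log (1 / ‖x‖ ^ 2)) ^ (1 / B.conjExponent)

/-- `ũ(x) = F⁻¹[G(v(x))]`, with `F⁻¹` the inverse of `F` on `(0, ∞)`. -/
def uTilde (f : ℝ → ℝ) (B : ℝ) (x : Plane) : ℝ :=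
  Function.invFunOn (tailInt f) (Set.Ioi 0) (tailInt (modelG B) (modelV B x))

/-- `R₁(x) = |1 / B₁[f](ũ(x)) - 1 / B₁[g](v(x))|`. -/
def R₁ (f : ℝ → ℝ) (B : ℝ) (x : Plane) : ℝ :=
  |invB1 f (uTilde f B x) - invB1 (modelG B) (modelV B x)|

/-- `R₂(x) = |1 / B₂[f](ũ(x)) - 1 / B₂[g](v(x))|`. -/
def R₂ (f : ℝ → ℝ) (B : ℝ) (x : Plane) : ℝ :=
  |invB2 f (uTilde f B x) - invB2 (modelG B) (modelV B x)|

/-- `(-log |x|)^{1/2} (R₁(x) + R₂(x)) → 0` as `x → 0`. -/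
def CondR (f : ℝ → ℝ) (B : ℝ) : Prop :=
  Filter.Tendsto (fun x : Plane => √(-Real.log ‖x‖) * (R₁ f B x + R₂ f B x))
    (nhdsWithin 0 {0}ᶜ) (nhds 0)

/-- `u = ũ + O(f(ũ) F(ũ) sup_{0 < |y| ≤ |x|} (R₁(y) + R₂(y)))` as `x → 0`. -/
def HasSingularAsymptotics (f : ℝ → ℝ) (B : ℝ) (u : Plane → ℝ) : Prop :=
  (fun x => u x - uTilde f B x) =O[nhdsWithin 0 {0}ᶜ]
    (fun x => f (uTilde f B x) * tailInt f (uTilde f B x) *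
      sSup ((fun y => R₁ f B y + R₂ f B y) '' {y : Plane | 0 < ‖y‖ ∧ ‖y‖ ≤ ‖x‖}))

/-- `u` is a positive radial classical solution of `-Δ u = f(u)` in the punctured ball
`B_R ∖ {0}`, continuous up to `∂B_R`, with `u = 0` on `∂B_R`. -/
structure IsClassicalRadialSolution (f : ℝ → ℝ) (R : ℝ) (u : Plane → ℝ) : Prop where
  contDiffOn : ContDiffOn ℝ 2 u (Metric.ball 0 R \ {0})
  continuousOn : ContinuousOn u (Metric.closedBall 0 R \ {0})
  radial : ∀ x y : Plane, x ∈ Metric.closedBall 0 R \ {0} → ‖x‖ = ‖y‖ → u x = u y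
  pos : ∀ x ∈ Metric.ball (0 : Plane) R \ {0}, 0 < u x
  equation : ∀ x ∈ Metric.ball (0 : Plane) R \ {0}, -(Δ u) x = f (u x)
  boundary : ∀ x ∈ Metric.sphere (0 : Plane) R, u x = 0

/-- `-Δ u = f(u)` in the sense of distributions in the open set `Ω`: both `u` and `f(u)` are
locally integrable in `Ω`, and the equation holds against every `φ ∈ C_c^∞(Ω)`. -/
structure IsDistributionalSolution (f : ℝ → ℝ) (Ω : Set Plane) (u : Plane → ℝ) : Prop where
  locInt : MeasureTheory.LocallyIntegrableOn u Ω
  locInt_comp : MeasureTheory.LocallyIntegrableOn (fun x => f (u x)) Ω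
  weak : ∀ φ : Plane → ℝ, ContDiff ℝ (⊤ : ℕ∞) φ → HasCompactSupport φ → tsupport φ ⊆ Ω →
    -(∫ x in Ω, u x * (Δ φ) x) = ∫ x in Ω, f (u x) * φ x

end SingularSol

end

/-!
Write `t = log (1 / |x|²)` and `y = -log F(u)`. For radial `u` the equation `-Δu = f(u)` becomes
`y'' + (f' F - 1) y'² + e^{y - t} / 4 = 0`, where `f' F` is a function of `y`. The same change of
variables turns `v`, `g` into an explicit solution of the model equation, and `R₁`, `R₂` measure
how far the two coefficients and their derivatives are apart along it.

The deviation `φ` from the model solution solves a perturbation of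
`φ'' = 2 φ' / (B t) - φ / (B t)`, whose nonzero solutions oscillate with phase asymptotic to
`2 √(t / B)` and amplitude growing like `t ^ (1 / 4 + 1 / B)`. Integrating from `t = ∞` therefore
gives a contraction on functions of size `sup (R₁ + R₂)`; `φ'` enters the oscillation multiplied by
`√t`, and the nonlinear terms are negligible because `√t sup (R₁ + R₂) → 0`.

In the variable `t` the solution `u` is increasing and concave, so it continues backwards until it
vanishes, which gives the radius `R`. Truncating `u` at `t = k` leaves an error of total mass
`O(u'(k))` in the equation, and `u'(k) → 0`: no point mass appears at the origin.
-/

open Filter Set MeasureTheory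
open scoped Topology

namespace SingularSol

theorem hasDerivAt_integral_Ioi {E : Type*} [NormedAddCommGroup E] [NormedSpace ℝ E]
    [CompleteSpace E] {k : ℝ → E} {a t : ℝ} (hk : IntegrableOn k (Ioi a)) (hat : a < t)
    (hc : ContinuousOn k (Ioi a)) :
    HasDerivAt (fun s => ∫ τ in Ioi s, k τ) (-k t) t := by
  have hint : IntervalIntegrable k volume a t :=
    (intervalIntegrable_iff_integrableOn_Ioc_of_le hat.le).2 (hk.mono_set Ioc_subset_Ioi_self)
  have hprim : HasDerivAt (fun s => ∫ τ in a..s, k τ) (k t) t :=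
    intervalIntegral.integral_hasDerivAt_right hint
      (hc.stronglyMeasurableAtFilter isOpen_Ioi t hat) (hc.continuousAt (Ioi_mem_nhds hat))
  refine (hprim.const_sub (∫ τ in Ioi a, k τ)).congr_of_eventuallyEq ?_
  filter_upwards [lt_mem_nhds hat] with s hs
  rw [← intervalIntegral.integral_Ioi_sub_Ioi hk hs.le]
  abel

section TailIntegral

variable {f : ℝ → ℝ}

/-- The standing assumptions on the nonlinearity: `f` is `C¹` on `[0, ∞)`, and on `(0, ∞)` it is
positive, has a positive derivative and a finite tail integral. -/
structure Admissible (f : ℝ → ℝ) : Prop where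
  contDiffOn : ContDiffOn ℝ 1 f (Ici 0)
  pos : ∀ s, 0 < s → 0 < f s
  integrableOn : ∀ s, 0 < s → IntegrableOn (fun τ => (f τ)⁻¹) (Ioi s)
  deriv_pos : ∀ s, 0 < s → 0 < deriv f s

theorem Admissible.hasDerivAt (hf : Admissible f) {s : ℝ} (hs : 0 < s) :
    HasDerivAt f (deriv f s) s :=
  ((hf.contDiffOn.contDiffAt (Ici_mem_nhds hs)).differentiableAt one_ne_zero).hasDerivAt

theorem Admissible.continuousAt (hf : Admissible f) {s : ℝ} (hs : 0 < s) : ContinuousAt f s :=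
  (hf.hasDerivAt hs).continuousAt

theorem Admissible.monotoneOn (hf : Admissible f) : MonotoneOn f (Ici 0) := by
  refine monotoneOn_of_deriv_nonneg (convex_Ici 0) hf.contDiffOn.continuousOn ?_ ?_ <;>
    rw [interior_Ici]
  · exact fun s hs => (hf.hasDerivAt hs).differentiableAt.differentiableWithinAt
  · exact fun s hs => (hf.deriv_pos s hs).le

theorem Admissible.zero_nonneg (hf : Admissible f) : 0 ≤ f 0 := by
  have hlim : Tendsto f (𝓝[>] 0) (𝓝 (f 0)) :=
    (hf.contDiffOn.continuousOn 0 self_mem_Ici).mono_left (nhdsWithin_mono _ Ioi_subset_Ici_self)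
  exact ge_of_tendsto hlim (eventually_nhdsWithin_of_forall fun s hs => (hf.pos s hs).le)

theorem Admissible.hasDerivAt_tailInt (hf : Admissible f) {s : ℝ} (hs : 0 < s) :
    HasDerivAt (tailInt f) (-(f s)⁻¹) s := by
  have hcont : ContinuousOn (fun τ => (f τ)⁻¹) (Ioi (s / 2)) := fun r hr => by
    have hr : 0 < r := (half_pos hs).trans hr
    exact ((hf.continuousAt hr).inv₀ (hf.pos r hr).ne').continuousWithinAt
  exact hasDerivAt_integral_Ioi (hf.integrableOn _ (half_pos hs)) (half_lt_self hs) hcont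

theorem Admissible.strictAntiOn_tailInt (hf : Admissible f) :
    StrictAntiOn (tailInt f) (Ioi 0) := by
  refine strictAntiOn_of_deriv_neg (convex_Ioi 0)
    (fun s hs => (hf.hasDerivAt_tailInt hs).continuousAt.continuousWithinAt) fun s hs => ?_
  rw [interior_Ioi] at hs
  rw [(hf.hasDerivAt_tailInt hs).deriv]
  exact neg_lt_zero.2 (inv_pos.2 (hf.pos s hs))

theorem tendsto_tailInt (f : ℝ → ℝ) : Tendsto (tailInt f) atTop (𝓝 0) :=
  tendsto_integral_Ioi_zero tendsto_id

theorem Admissible.tailInt_pos (hf : Admissible f) {s : ℝ} (hs : 0 < s) : 0 < tailInt f s := by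
  have hs' : 0 < s + 1 := by linarith
  calc 0 ≤ tailInt f (s + 1) := setIntegral_nonneg measurableSet_Ioi fun τ hτ =>
        (inv_pos.2 (hf.pos τ (hs'.trans hτ))).le
    _ < tailInt f s := hf.strictAntiOn_tailInt hs hs' (lt_add_one s)

/-- `y ↦ F⁻¹(e^{-y})`, with `F` the tail integral of `f`: the inverse of `s ↦ -log F(s)`. -/
noncomputable def logInv (f : ℝ → ℝ) (y : ℝ) : ℝ :=
  Function.invFunOn (tailInt f) (Ioi 0) (Real.exp (-y))

/-- The value of `-log F` at `1`. The map `logInv f` is only used above it, since smaller values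
need not be attained by `-log F`. -/
noncomputable def logInvBound (f : ℝ → ℝ) : ℝ := -Real.log (tailInt f 1)

theorem Admissible.exp_neg_lt_tailInt_one (hf : Admissible f) {y : ℝ} (hy : logInvBound f < y) :
    Real.exp (-y) < tailInt f 1 := by
  rw [← Real.lt_log_iff_exp_lt (hf.tailInt_pos one_pos)]
  exact neg_lt.1 hy

theorem Admissible.logInv_mem (hf : Admissible f) {y : ℝ} (hy : logInvBound f < y) :
    0 < logInv f y ∧ tailInt f (logInv f y) = Real.exp (-y) := by
  obtain ⟨b, hb1, hb⟩ := ((eventually_gt_atTop (1 : ℝ)).and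
    ((tendsto_tailInt f).eventually (gt_mem_nhds (Real.exp_pos (-y))))).exists
  have hcont : ContinuousOn (tailInt f) (Icc 1 b) := fun s hs =>
    (hf.hasDerivAt_tailInt (one_pos.trans_le hs.1)).continuousAt.continuousWithinAt
  obtain ⟨s, hs, hse⟩ :=
    intermediate_value_Icc' hb1.le hcont ⟨hb.le, (hf.exp_neg_lt_tailInt_one hy).le⟩
  have hex : ∃ a ∈ Ioi (0 : ℝ), tailInt f a = Real.exp (-y) := ⟨s, one_pos.trans_le hs.1, hse⟩
  exact ⟨Function.invFunOn_mem hex, Function.invFunOn_eq hex⟩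

theorem Admissible.logInv_pos (hf : Admissible f) {y : ℝ} (hy : logInvBound f < y) :
    0 < logInv f y :=
  (hf.logInv_mem hy).1

theorem Admissible.tailInt_logInv (hf : Admissible f) {y : ℝ} (hy : logInvBound f < y) :
    tailInt f (logInv f y) = Real.exp (-y) :=
  (hf.logInv_mem hy).2

theorem Admissible.one_lt_logInv (hf : Admissible f) {y : ℝ} (hy : logInvBound f < y) :
    1 < logInv f y := by
  rw [← hf.strictAntiOn_tailInt.lt_iff_gt (hf.logInv_pos hy) (mem_Ioi.2 one_pos),
    hf.tailInt_logInv hy]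
  exact hf.exp_neg_lt_tailInt_one hy

theorem Admissible.logInvBound_lt (hf : Admissible f) {s : ℝ} (hs : 1 < s) :
    logInvBound f < -Real.log (tailInt f s) := by
  have hs0 : 0 < s := one_pos.trans hs
  exact neg_lt_neg (Real.log_lt_log (hf.tailInt_pos hs0)
    (hf.strictAntiOn_tailInt (mem_Ioi.2 one_pos) hs0 hs))

theorem Admissible.logInv_neg_log_tailInt (hf : Admissible f) {s : ℝ} (hs : 1 < s) :
    logInv f (-Real.log (tailInt f s)) = s := by
  have hs0 : 0 < s := one_pos.trans hs
  refine hf.strictAntiOn_tailInt.injOn (hf.logInv_pos (hf.logInvBound_lt hs)) hs0 ?_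
  rw [hf.tailInt_logInv (hf.logInvBound_lt hs), neg_neg, Real.exp_log (hf.tailInt_pos hs0)]

theorem Admissible.strictMonoOn_logInv (hf : Admissible f) :
    StrictMonoOn (logInv f) (Ioi (logInvBound f)) := by
  intro a ha b hb hab
  rw [← hf.strictAntiOn_tailInt.lt_iff_gt (hf.logInv_pos hb) (hf.logInv_pos ha),
    hf.tailInt_logInv ha, hf.tailInt_logInv hb]
  exact Real.exp_lt_exp.2 (neg_lt_neg hab)

theorem Admissible.image_logInv (hf : Admissible f) :
    logInv f '' Ioi (logInvBound f) = Ioi 1 :=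
  Subset.antisymm (image_subset_iff.2 fun _ hy => hf.one_lt_logInv hy)
    fun _ hs => ⟨_, hf.logInvBound_lt hs, hf.logInv_neg_log_tailInt hs⟩

theorem Admissible.hasDerivAt_logInv (hf : Admissible f) {y : ℝ} (hy : logInvBound f < y) :
    HasDerivAt (logInv f) (f (logInv f y) * Real.exp (-y)) y := by
  have hpos := hf.logInv_pos hy
  have hfpos := hf.pos _ hpos
  have hcont : ContinuousAt (logInv f) y := by
    refine hf.strictMonoOn_logInv.continuousAt_of_image_mem_nhds (Ioi_mem_nhds hy) ?_
    rw [hf.image_logInv]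
    exact Ioi_mem_nhds (hf.one_lt_logInv hy)
  have hinv : HasDerivAt (fun s => -Real.log (tailInt f s))
      (f (logInv f y) * Real.exp (-y))⁻¹ (logInv f y) := by
    refine ((hf.hasDerivAt_tailInt hpos).log (hf.tailInt_pos hpos).ne').neg.congr_deriv ?_
    rw [hf.tailInt_logInv hy]
    field_simp
  have hleft : ∀ᶠ z in 𝓝 y, -Real.log (tailInt f (logInv f z)) = z := by
    filter_upwards [Ioi_mem_nhds hy] with z hz
    rw [hf.tailInt_logInv hz, Real.log_exp, neg_neg]
  exact inv_inv (f (logInv f y) * Real.exp (-y)) ▸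
    hinv.of_local_left_inverse hcont (by positivity) hleft

theorem Admissible.tendsto_logInv (hf : Admissible f) : Tendsto (logInv f) atTop atTop := by
  refine tendsto_atTop.2 fun b => ?_
  have hb : 1 < max b 2 := one_lt_two.trans_le (le_max_right b 2)
  filter_upwards [eventually_gt_atTop (-Real.log (tailInt f (max b 2)))] with y hy
  calc b ≤ max b 2 := le_max_left b 2
    _ = logInv f (-Real.log (tailInt f (max b 2))) := (hf.logInv_neg_log_tailInt hb).symm
    _ ≤ logInv f y := (hf.strictMonoOn_logInv (hf.logInvBound_lt hb)
        ((hf.logInvBound_lt hb).trans hy) hy).le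

theorem Admissible.hasDerivAt_comp_logInv (hf : Admissible f) {y : ℝ} (hy : logInvBound f < y) :
    HasDerivAt (fun y => f (logInv f y))
      (deriv f (logInv f y) * (f (logInv f y) * Real.exp (-y))) y :=
  (hf.hasDerivAt (hf.logInv_pos hy)).comp y (hf.hasDerivAt_logInv hy)

/-- The quantity `f' F` as a function of `y = -log F`. -/
noncomputable def growth (f : ℝ → ℝ) (y : ℝ) : ℝ := deriv f (logInv f y) * Real.exp (-y)

/-- The derivative of `growth f`. -/
noncomputable def growthDeriv (f : ℝ → ℝ) (y : ℝ) : ℝ :=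
  deriv (deriv f) (logInv f y) * (f (logInv f y) * Real.exp (-y)) * Real.exp (-y) - growth f y

theorem hasDerivAt_exp_neg (y : ℝ) : HasDerivAt (fun y => Real.exp (-y)) (-Real.exp (-y)) y :=
  (hasDerivAt_neg y).exp.congr_deriv (mul_neg_one _)

theorem Admissible.hasDerivAt_growth (hf : Admissible f) {s₀ : ℝ}
    (hc : ContDiffOn ℝ 2 f (Ioi s₀)) {y : ℝ} (hy : logInvBound f < y) (hys : s₀ < logInv f y) :
    HasDerivAt (growth f) (growthDeriv f y) y := by
  have hf' : ContDiffOn ℝ 1 (deriv f) (Ioi s₀) :=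
    hc.deriv_of_isOpen isOpen_Ioi one_add_one_eq_two.le
  have hderiv : HasDerivAt (deriv f) (deriv (deriv f) (logInv f y)) (logInv f y) :=
    ((hf'.contDiffAt (Ioi_mem_nhds hys)).differentiableAt one_ne_zero).hasDerivAt
  refine ((hderiv.comp y (hf.hasDerivAt_logInv hy)).mul (hasDerivAt_exp_neg y)).congr_deriv ?_
  simp only [growthDeriv, growth, Function.comp]
  ring

theorem Admissible.continuousAt_growthDeriv (hf : Admissible f) {s₀ : ℝ}
    (hc : ContDiffOn ℝ 2 f (Ioi s₀)) {y : ℝ} (hy : logInvBound f < y) (hys : s₀ < logInv f y) :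
    ContinuousAt (growthDeriv f) y := by
  have hf' : ContDiffOn ℝ 1 (deriv f) (Ioi s₀) :=
    hc.deriv_of_isOpen isOpen_Ioi one_add_one_eq_two.le
  have hf'' : ContinuousAt (deriv (deriv f)) (logInv f y) :=
    (hf'.continuousOn_deriv_of_isOpen isOpen_Ioi le_rfl).continuousAt (Ioi_mem_nhds hys)
  have hexp := (hasDerivAt_exp_neg y).continuousAt
  exact (((hf''.comp (hf.hasDerivAt_logInv hy).continuousAt).mul
    ((hf.hasDerivAt_comp_logInv hy).continuousAt.mul hexp)).mul hexp).sub
    (hf.hasDerivAt_growth hc hy hys).continuousAt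

theorem Admissible.invB1_logInv (hf : Admissible f) {y : ℝ} (hy : logInvBound f < y) :
    invB1 f (logInv f y) = y * (1 - growth f y) := by
  simp [invB1, growth, hf.tailInt_logInv hy]

theorem Admissible.invB2_logInv (hf : Admissible f) {y : ℝ} (hy : logInvBound f < y) :
    invB2 f (logInv f y) = y ^ 2 * growthDeriv f y := by
  have := hf.deriv_pos _ (hf.logInv_pos hy)
  simp only [invB2, growth, growthDeriv, hf.tailInt_logInv hy, Real.log_exp, neg_neg]
  field_simp

theorem Admissible.tendsto_growth (hf : Admissible f) {B : ℝ} (hf2 : CondF2 f B) :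
    Tendsto (growth f) atTop (𝓝 1) := by
  refine (hf2.1.comp hf.tendsto_logInv).congr' ?_
  filter_upwards [eventually_gt_atTop (logInvBound f)] with y hy
  simp [growth, hf.tailInt_logInv hy]

theorem Admissible.tendsto_sq_mul_growthDeriv (hf : Admissible f) {B : ℝ} (hf2 : CondF2 f B) :
    Tendsto (fun y => y ^ 2 * growthDeriv f y) atTop (𝓝 B⁻¹) := by
  have hB : B ≠ 0 := (one_pos.trans_le hf2.2.2).ne'
  refine ((hf2.2.1.inv₀ hB).comp hf.tendsto_logInv).congr' ?_
  filter_upwards [eventually_gt_atTop (logInvBound f)] with y hy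
  simp [hf.invB2_logInv hy]

end TailIntegral

section Model

/-- `-log G` along the model solution, as a function of `t = log (1 / |x|²)`. -/
noncomputable def modelY (B t : ℝ) : ℝ := t - Real.log (t + 1) - Real.log (B / 4)

/-- `g' G` along the model solution, as a function of `t = log (1 / |x|²)`. -/
noncomputable def modelP (B t : ℝ) : ℝ := (1 + 1 / t) * (1 - (1 + 1 / B) / t)

/-- The derivative of `modelP B`. -/
noncomputable def modelPDeriv (B t : ℝ) : ℝ :=
  -(1 / t ^ 2) * (1 - (1 + 1 / B) / t) + (1 + 1 / t) * ((1 + 1 / B) / t ^ 2)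

theorem hasDerivAt_modelP (B : ℝ) {t : ℝ} (ht : t ≠ 0) :
    HasDerivAt (modelP B) (modelPDeriv B t) t := by
  have hdiv : ∀ c : ℝ, HasDerivAt (fun t : ℝ => c / t) (-(c / t ^ 2)) t := fun c =>
    ((hasDerivAt_inv ht).const_mul c).congr_deriv (by ring)
  refine (((hdiv 1).const_add 1).mul ((hdiv (1 + 1 / B)).const_sub 1)).congr_deriv ?_
  simp only [modelPDeriv]
  ring

theorem hasDerivAt_modelY (B : ℝ) {t : ℝ} (ht : 0 < t) :
    HasDerivAt (modelY B) (t / (t + 1)) t := by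
  have ht1 : t + 1 ≠ 0 := by positivity
  refine (((hasDerivAt_id t).sub (((hasDerivAt_id t).add_const 1).log ht1)).sub_const
    (Real.log (B / 4))).congr_deriv ?_
  simp only [id_eq]
  field_simp
  ring

theorem exp_modelY {B t : ℝ} (hB : 0 < B) (ht : 0 < t) :
    Real.exp (modelY B t) = 4 / (B * (t + 1)) * Real.exp t := by
  rw [modelY, Real.exp_sub, Real.exp_sub, Real.exp_log (by positivity),
    Real.exp_log (by positivity)]
  field_simp

theorem tendsto_modelY_sub_half (B : ℝ) :
    Tendsto (fun t => modelY B t - t / 2) atTop atTop := by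
  have hlog : (fun t : ℝ => Real.log (t + 1)) =o[atTop] fun t : ℝ => t + 1 :=
    Real.isLittleO_log_id_atTop.comp_tendsto (tendsto_atTop_add_const_right _ _ tendsto_id)
  refine tendsto_atTop_mono' atTop ?_ (tendsto_atTop_add_const_right atTop
    (-1 / 4 - Real.log (B / 4)) (tendsto_id.atTop_div_const (zero_lt_four' ℝ)))
  filter_upwards [hlog.bound (show (0 : ℝ) < 1 / 4 by norm_num), eventually_gt_atTop 0]
    with t hbound ht
  have hlog_le := (le_abs_self _).trans hbound
  rw [Real.norm_eq_abs, abs_of_pos (by linarith)] at hlog_le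
  simp only [id_eq, modelY]
  linarith

theorem tendsto_modelY (B : ℝ) : Tendsto (modelY B) atTop atTop :=
  tendsto_atTop_mono' atTop
    ((eventually_ge_atTop 0).mono fun _ ht => sub_le_self _ (div_nonneg ht two_pos.le))
    (tendsto_modelY_sub_half B)

/-- A nonlinearity of the form `4 e^T / (B T T')`, with `T T'' = T'² / B`: both cases `B = 1` and
`B > 1` of `modelG B` are of this form, `T` being the inverse of the map `t ↦ v`. -/
structure IsModel (B a : ℝ) (g T T' : ℝ → ℝ) : Prop where
  hasDerivAt : ∀ s, a < s → HasDerivAt T (T' s) s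
  hasDerivAt' : ∀ s, a < s → HasDerivAt T' (1 / B * T' s ^ 2 / T s) s
  pos : ∀ s, a < s → 0 < T s
  pos' : ∀ s, a < s → 0 < T' s
  tendsto : Tendsto T atTop atTop
  eq : ∀ s, a < s → g s = 4 / (B * (T s * T' s)) * Real.exp (T s)

variable {B a : ℝ} {g T T' : ℝ → ℝ}

theorem IsModel.eq_exp_modelY (h : IsModel B a g T T') (hB : 0 < B) {s : ℝ} (hs : a < s) :
    g s = (T s + 1) / (T s * T' s) * Real.exp (modelY B (T s)) := by
  have hT := h.pos s hs
  have hT' := h.pos' s hs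
  rw [exp_modelY hB hT, h.eq s hs]
  field_simp

theorem IsModel.hasDerivAt_modelY (h : IsModel B a g T T') {s : ℝ} (hs : a < s) :
    HasDerivAt (fun s => modelY B (T s)) (T s / (T s + 1) * T' s) s :=
  (SingularSol.hasDerivAt_modelY B (h.pos s hs)).comp s (h.hasDerivAt s hs)

theorem IsModel.tailInt_eq (h : IsModel B a g T T') (hB : 0 < B) {s : ℝ} (hs : a < s) :
    tailInt g s = Real.exp (-modelY B (T s)) := by
  have hderiv : ∀ r ∈ Ici s, HasDerivAt (fun s => -Real.exp (-modelY B (T s))) ((g r)⁻¹) r := by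
    intro r hr
    have har := hs.trans_le hr
    have hT := h.pos r har
    have hT' := h.pos' r har
    refine (h.hasDerivAt_modelY har).fun_neg.exp.neg.congr_deriv ?_
    rw [h.eq_exp_modelY hB har, Real.exp_neg]
    field_simp
  have hlim : Tendsto (fun s => -Real.exp (-modelY B (T s))) atTop (𝓝 (-0)) :=
    (Real.tendsto_exp_neg_atTop_nhds_zero.comp ((tendsto_modelY B).comp h.tendsto)).neg
  have hnonneg : ∀ r ∈ Ioi s, 0 ≤ (g r)⁻¹ := fun r hr => by
    have har := hs.trans hr
    have hT := h.pos r har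
    have hT' := h.pos' r har
    rw [h.eq r har]
    positivity
  rw [tailInt, integral_Ioi_of_hasDerivAt_of_nonneg' hderiv hnonneg hlim]
  ring

theorem IsModel.deriv_eq (h : IsModel B a g T T') (hB : 0 < B) {s : ℝ} (hs : a < s) :
    deriv g s = modelP B (T s) * Real.exp (modelY B (T s)) := by
  have hT := h.pos s hs
  have hT' := h.pos' s hs
  have hprod := ((h.hasDerivAt s hs).mul (h.hasDerivAt' s hs)).const_mul B
  have hquot := (hprod.fun_inv (mul_pos hB (mul_pos hT hT')).ne').const_mul 4
  have hderiv : HasDerivAt (fun s => 4 / (B * (T s * T' s)) * Real.exp (T s))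
      (modelP B (T s) * Real.exp (modelY B (T s))) s := by
    refine (hquot.mul (h.hasDerivAt s hs).exp).congr_deriv ?_
    rw [exp_modelY hB hT]
    simp only [modelP, Pi.mul_apply]
    field_simp
    ring
  exact (hderiv.congr_of_eventuallyEq (eventually_of_mem (Ioi_mem_nhds hs) h.eq)).deriv

theorem IsModel.hasDerivAt_deriv (h : IsModel B a g T T') (hB : 0 < B) {s : ℝ} (hs : a < s) :
    HasDerivAt (deriv g) ((modelPDeriv B (T s) + modelP B (T s) * (T s / (T s + 1))) * T' s *
      Real.exp (modelY B (T s))) s := by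
  refine ((((hasDerivAt_modelP B (h.pos s hs).ne').comp s (h.hasDerivAt s hs)).mul
    (h.hasDerivAt_modelY hs).exp).congr_of_eventuallyEq
      (eventually_of_mem (Ioi_mem_nhds hs) fun r hr => h.deriv_eq hB hr)).congr_deriv ?_
  simp only [Function.comp]
  ring

theorem IsModel.invB1_eq (h : IsModel B a g T T') (hB : 0 < B) {s : ℝ} (hs : a < s) :
    invB1 g s = modelY B (T s) * (1 - modelP B (T s)) := by
  rw [invB1, h.tailInt_eq hB hs, h.deriv_eq hB hs, Real.log_exp, neg_neg, mul_assoc,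
    ← Real.exp_add, add_neg_cancel, Real.exp_zero, mul_one]

theorem IsModel.invB2_eq (h : IsModel B a g T T') (hB : 0 < B) {s : ℝ} (hs : a < s)
    (hP : modelP B (T s) ≠ 0) :
    invB2 g s = modelY B (T s) ^ 2 * (modelPDeriv B (T s) * ((T s + 1) / T s)) := by
  have hT := h.pos s hs
  have hT' := h.pos' s hs
  rw [invB2, (h.hasDerivAt_deriv hB hs).deriv, h.tailInt_eq hB hs, h.deriv_eq hB hs,
    h.eq_exp_modelY hB hs, Real.log_exp, Real.exp_neg]
  field_simp
  ring

theorem isModel_exp : IsModel 1 a (modelG 1) Real.exp Real.exp where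
  hasDerivAt s _ := Real.hasDerivAt_exp s
  hasDerivAt' s _ := (Real.hasDerivAt_exp s).congr_deriv (by field_simp)
  pos s _ := Real.exp_pos s
  pos' s _ := Real.exp_pos s
  tendsto := Real.tendsto_exp_atTop
  eq s _ := by
    simp only [modelG, if_true, two_mul, Real.exp_add]
    field_simp

theorem conjExponent_sub_one (hB : 1 < B) : B.conjExponent - 1 = B.conjExponent / B := by
  have hB1 : B - 1 ≠ 0 := sub_ne_zero.2 hB.ne'
  have hB0 : B ≠ 0 := (one_pos.trans hB).ne'
  rw [Real.conjExponent]
  field_simp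
  ring

theorem isModel_rpow (hB : 1 < B) :
    IsModel B 0 (modelG B) (fun s => s ^ B.conjExponent)
      (fun s => B.conjExponent * s ^ (B.conjExponent - 1)) := by
  have hB0 : 0 < B := one_pos.trans hB
  have hpos : 0 < B.conjExponent := div_pos hB0 (sub_pos.2 hB)
  refine ⟨fun s hs => Real.hasDerivAt_rpow_const (Or.inl hs.ne'), fun s hs => ?_,
    fun s hs => Real.rpow_pos_of_pos hs _, fun s hs => mul_pos hpos (Real.rpow_pos_of_pos hs _),
    tendsto_rpow_atTop hpos, fun s hs => ?_⟩
  · refine ((Real.hasDerivAt_rpow_const (Or.inl hs.ne')).const_mul _).congr_deriv ?_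
    rw [Real.rpow_sub_one hs.ne', Real.rpow_sub_one hs.ne', conjExponent_sub_one hB]
    field_simp
  · rw [modelG, if_neg hB.ne', Real.rpow_sub_one hs.ne', Real.rpow_sub hs, Real.rpow_one,
      mul_comm 2, Real.rpow_mul hs.le, Real.rpow_two]
    field_simp

theorem exists_isModel {t : ℝ} (hB : 1 ≤ B) (ht : 0 < t) :
    ∃ a v : ℝ, ∃ T T' : ℝ → ℝ, a < v ∧ T v = t ∧ IsModel B a (modelG B) T T' ∧
      ∀ x : Plane, Real.log (1 / ‖x‖ ^ 2) = t → modelV B x = v := by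
  rcases eq_or_lt_of_le hB with rfl | hB
  · exact ⟨Real.log t - 1, Real.log t, Real.exp, Real.exp, sub_one_lt _, Real.exp_log ht,
      isModel_exp, fun x hx => by rw [modelV, if_pos rfl, hx]⟩
  · have hpos : 0 < B.conjExponent := div_pos (one_pos.trans hB) (sub_pos.2 hB)
    refine ⟨0, t ^ (1 / B.conjExponent), _, _, Real.rpow_pos_of_pos ht _, ?_, isModel_rpow hB,
      fun x hx => by rw [modelV, if_neg hB.ne', hx]⟩
    rw [one_div, Real.rpow_inv_rpow ht.le hpos.ne']

end Model

section Radial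

variable {f : ℝ → ℝ} {B : ℝ}

/-- The logarithmic variable `t = log (1 / |x|²)`. -/
noncomputable def logRad (x : Plane) : ℝ := Real.log (1 / ‖x‖ ^ 2)

theorem logRad_eq (x : Plane) : logRad x = -2 * Real.log ‖x‖ := by
  rw [logRad, one_div, Real.log_inv, Real.log_pow]
  push_cast
  ring

theorem uTilde_eq (hB : 1 ≤ B) {x : Plane} (hx : 0 < logRad x) :
    uTilde f B x = logInv f (modelY B (logRad x)) := by
  obtain ⟨a, v, T, T', hav, hTv, hm, hv⟩ := exists_isModel hB hx
  rw [uTilde, hv x rfl, hm.tailInt_eq (one_pos.trans_le hB) hav, hTv, logInv]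

theorem Admissible.R₁_eq (hf : Admissible f) (hB : 1 ≤ B) {x : Plane} (hx : 0 < logRad x)
    (hy0 : 0 < modelY B (logRad x)) (hy : logInvBound f < modelY B (logRad x)) :
    R₁ f B x = modelY B (logRad x) *
      |growth f (modelY B (logRad x)) - modelP B (logRad x)| := by
  obtain ⟨a, v, T, T', hav, hTv, hm, hv⟩ := exists_isModel hB hx
  rw [R₁, uTilde_eq hB hx, hf.invB1_logInv hy, hv x rfl,
    hm.invB1_eq (one_pos.trans_le hB) hav, hTv, ← mul_sub, sub_sub_sub_cancel_left, abs_mul,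
    abs_of_pos hy0, abs_sub_comm]

theorem Admissible.R₂_eq (hf : Admissible f) (hB : 1 ≤ B) {x : Plane} (hx : 0 < logRad x)
    (hP : modelP B (logRad x) ≠ 0) (hy : logInvBound f < modelY B (logRad x)) :
    R₂ f B x = modelY B (logRad x) ^ 2 * ((logRad x + 1) / logRad x) *
      |growthDeriv f (modelY B (logRad x)) * (logRad x / (logRad x + 1)) -
        modelPDeriv B (logRad x)| := by
  obtain ⟨a, v, T, T', hav, hTv, hm, hv⟩ := exists_isModel hB hx
  have hweight : |modelY B (logRad x) ^ 2 * ((logRad x + 1) / logRad x)| =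
      modelY B (logRad x) ^ 2 * ((logRad x + 1) / logRad x) := abs_of_nonneg (by positivity)
  rw [R₂, uTilde_eq hB hx, hf.invB2_logInv hy, hv x rfl,
    hm.invB2_eq (one_pos.trans_le hB) hav (by rwa [hTv]), hTv,
    ← hweight, ← abs_mul]
  congr 1
  field_simp

end Radial

section Dichotomy

variable {E : Type*} [NormedAddCommGroup E]

section Duhamel

variable [NormedSpace ℂ E] {δ c t t₀ : ℝ} {θ : ℝ → ℝ} {k l : ℝ → E}

/-- The solution `t^δ e^{iθ(t)}` of `Z' = (iθ' + δ/t) Z`. -/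
noncomputable def growingMode (δ : ℝ) (θ : ℝ → ℝ) (t : ℝ) : ℂ :=
  (t ^ δ : ℝ) * Complex.exp (θ t * Complex.I)

theorem norm_growingMode (δ : ℝ) (θ : ℝ → ℝ) (ht : 0 < t) : ‖growingMode δ θ t‖ = t ^ δ := by
  rw [growingMode, norm_mul, Complex.norm_exp_ofReal_mul_I, mul_one, Complex.norm_real,
    Real.norm_of_nonneg (Real.rpow_nonneg ht.le δ)]

theorem growingMode_ne_zero (δ : ℝ) (θ : ℝ → ℝ) (ht : 0 < t) : growingMode δ θ t ≠ 0 := by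
  rw [← norm_pos_iff, norm_growingMode δ θ ht]
  exact Real.rpow_pos_of_pos ht δ

theorem hasDerivAt_growingMode (δ : ℝ) {θ' : ℝ} (ht : 0 < t) (hθ : HasDerivAt θ θ' t) :
    HasDerivAt (growingMode δ θ) ((Complex.I * θ' + δ / t) * growingMode δ θ t) t := by
  have hpow : HasDerivAt (fun t : ℝ => ((t ^ δ : ℝ) : ℂ)) ((δ * t ^ (δ - 1) : ℝ) : ℂ) t :=
    (Real.hasDerivAt_rpow_const (Or.inl ht.ne')).ofReal_comp
  refine (hpow.mul (hθ.ofReal_comp.mul_const Complex.I).cexp).congr_deriv ?_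
  have ht' : (t : ℂ) ≠ 0 := Complex.ofReal_ne_zero.2 ht.ne'
  rw [growingMode, Real.rpow_sub_one ht.ne']
  push_cast
  field_simp
  ring

theorem continuousOn_growingMode (δ : ℝ) (ht₀ : 0 < t₀) (hθ : ContinuousOn θ (Ici t₀)) :
    ContinuousOn (growingMode δ θ) (Ici t₀) := by
  have hpow : ContinuousOn (fun t : ℝ => t ^ δ) (Ici t₀) := fun t ht =>
    (Real.continuousAt_rpow_const t δ (Or.inl (ht₀.trans_le ht).ne')).continuousWithinAt
  exact (Complex.continuous_ofReal.comp_continuousOn hpow).mul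
    (((Complex.continuous_ofReal.comp_continuousOn hθ).mul continuousOn_const).cexp)

theorem norm_inv_growingMode_smul_le (ht : 0 < t) (hk : ‖k t‖ ≤ δ * c / t) :
    ‖(growingMode δ θ t)⁻¹ • k t‖ ≤ δ * c * t ^ (-1 - δ) := by
  calc ‖(growingMode δ θ t)⁻¹ • k t‖ = (t ^ δ)⁻¹ * ‖k t‖ := by
        rw [norm_smul, norm_inv, norm_growingMode δ θ ht]
    _ ≤ (t ^ δ)⁻¹ * (δ * c / t) := by gcongr
    _ = δ * c * t ^ (-1 - δ) := by
        rw [Real.rpow_sub ht, Real.rpow_neg_one]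
        field_simp

theorem integrableOn_inv_growingMode_smul (hδ : 0 < δ) (ht₀ : 0 < t₀)
    (hθ : ContinuousOn θ (Ici t₀)) (hk : ContinuousOn k (Ici t₀))
    (hbound : ∀ τ, t₀ < τ → ‖k τ‖ ≤ δ * c / τ) :
    IntegrableOn (fun τ => (growingMode δ θ τ)⁻¹ • k τ) (Ioi t₀) := by
  have hcont : ContinuousOn (fun τ => (growingMode δ θ τ)⁻¹ • k τ) (Ici t₀) :=
    ((continuousOn_growingMode δ ht₀ hθ).inv₀ fun τ hτ =>
      growingMode_ne_zero δ θ (ht₀.trans_le hτ)).smul hk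
  have hexp : -1 - δ < -1 := by linarith
  refine Integrable.mono' ((integrableOn_Ioi_rpow_of_lt hexp ht₀).const_mul (δ * c))
    ((hcont.mono Ioi_subset_Ici_self).aestronglyMeasurable measurableSet_Ioi) ?_
  exact ae_restrict_of_forall_mem measurableSet_Ioi fun τ hτ =>
    norm_inv_growingMode_smul_le (ht₀.trans hτ) (hbound τ hτ)

/-- The solution of `Z' = (iθ' + δ/t) Z + k` obtained by integrating from infinity: for `δ > 0`
this is the only one that is not of the size `t^δ`. -/
noncomputable def duhamel (δ : ℝ) (θ : ℝ → ℝ) (k : ℝ → E) (t : ℝ) : E :=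
  -(growingMode δ θ t • ∫ τ in Ioi t, (growingMode δ θ τ)⁻¹ • k τ)

theorem norm_duhamel_le (hδ : 0 < δ) (ht : 0 < t) (hk : ∀ τ, t < τ → ‖k τ‖ ≤ δ * c / τ) :
    ‖duhamel δ θ k t‖ ≤ c := by
  have hexp : -1 - δ < -1 := by linarith
  have hint : ‖∫ τ in Ioi t, (growingMode δ θ τ)⁻¹ • k τ‖ ≤ ∫ τ in Ioi t, δ * c * τ ^ (-1 - δ) :=
    norm_integral_le_of_norm_le ((integrableOn_Ioi_rpow_of_lt hexp ht).const_mul (δ * c))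
      (ae_restrict_of_forall_mem measurableSet_Ioi fun τ hτ =>
        norm_inv_growingMode_smul_le (ht.trans hτ) (hk τ hτ))
  rw [integral_const_mul, integral_Ioi_rpow_of_lt hexp ht] at hint
  rw [duhamel, norm_neg, norm_smul, norm_growingMode δ θ ht]
  calc t ^ δ * ‖∫ τ in Ioi t, (growingMode δ θ τ)⁻¹ • k τ‖
      ≤ t ^ δ * (δ * c * (-t ^ (-1 - δ + 1) / (-1 - δ + 1))) := by gcongr
    _ = c := by
        rw [show -1 - δ + 1 = -δ by ring, Real.rpow_neg ht.le]
        field_simp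

theorem duhamel_sub (hk : IntegrableOn (fun τ => (growingMode δ θ τ)⁻¹ • k τ) (Ioi t))
    (hl : IntegrableOn (fun τ => (growingMode δ θ τ)⁻¹ • l τ) (Ioi t)) :
    duhamel δ θ k t - duhamel δ θ l t = duhamel δ θ (fun τ => k τ - l τ) t := by
  simp only [duhamel, smul_sub]
  rw [integral_sub hk hl, smul_sub]
  abel

theorem continuousOn_duhamel (ht₀ : 0 < t₀) (hθ : ContinuousOn θ (Ici t₀))
    (hk : IntegrableOn (fun τ => (growingMode δ θ τ)⁻¹ • k τ) (Ioi t₀)) :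
    ContinuousOn (duhamel δ θ k) (Ici t₀) :=
  ((continuousOn_growingMode δ ht₀ hθ).smul hk.continuousOn_Ici_primitive_Ioi).neg

theorem hasDerivAt_duhamel [CompleteSpace E] {θ' : ℝ} (ht₀ : 0 < t₀) (ht : t₀ < t)
    (hθ : ContinuousOn θ (Ici t₀)) (hθ' : HasDerivAt θ θ' t) (hk : ContinuousOn k (Ici t₀))
    (hint : IntegrableOn (fun τ => (growingMode δ θ τ)⁻¹ • k τ) (Ioi t₀)) :
    HasDerivAt (duhamel δ θ k) ((Complex.I * θ' + δ / t) • duhamel δ θ k t + k t) t := by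
  have ht' : 0 < t := ht₀.trans ht
  have hcont : ContinuousOn (fun τ => (growingMode δ θ τ)⁻¹ • k τ) (Ioi t₀) :=
    (((continuousOn_growingMode δ ht₀ hθ).inv₀ fun τ hτ =>
      growingMode_ne_zero δ θ (ht₀.trans_le hτ)).smul hk).mono Ioi_subset_Ici_self
  refine ((hasDerivAt_growingMode δ ht' hθ').smul
    (hasDerivAt_integral_Ioi hint ht hcont)).neg.congr_deriv ?_
  rw [smul_neg, smul_inv_smul₀ (growingMode_ne_zero δ θ ht'), duhamel, smul_neg, smul_smul]
  abel

end Duhamel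

section FixedPoint

variable {t₀ : ℝ} {r : ℝ → ℝ}

/-- The continuous functions whose norm is at most `r` on `[t₀, ∞)`. -/
def normBounded (E : Type*) [NormedAddCommGroup E] (t₀ : ℝ) (r : ℝ → ℝ) : Set (ℝ → E) :=
  {Z | Continuous Z ∧ ∀ t, t₀ ≤ t → ‖Z t‖ ≤ r t}

theorem isClosed_preimage_normBounded :
    IsClosed {Z : BoundedContinuousFunction ℝ E | ⇑Z ∈ normBounded E t₀ r} := by
  have hinter : {Z : BoundedContinuousFunction ℝ E | ⇑Z ∈ normBounded E t₀ r} =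
      ⋂ t ∈ Ici t₀, {Z : BoundedContinuousFunction ℝ E | ‖Z t‖ ≤ r t} := by
    ext Z
    simp [normBounded, Z.continuous]
  rw [hinter]
  exact isClosed_biInter fun t _ =>
    isClosed_le (continuous_eval_const t).norm continuous_const

theorem exists_fixedPoint_normBounded [CompleteSpace E] {κ : NNReal} {Φ : (ℝ → E) → ℝ → E}
    (hκ : κ < 1) (hr : AntitoneOn r (Ici t₀)) (hr0 : ∀ t, t₀ ≤ t → 0 ≤ r t)
    (hcont : ∀ Z ∈ normBounded E t₀ r, ContinuousOn (Φ Z) (Ici t₀))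
    (hbound : ∀ Z ∈ normBounded E t₀ r, ∀ t, t₀ ≤ t → ‖Φ Z t‖ ≤ r t)
    (hlip : ∀ Z ∈ normBounded E t₀ r, ∀ W ∈ normBounded E t₀ r, ∀ d : ℝ,
      (∀ t, t₀ ≤ t → ‖Z t - W t‖ ≤ d) → ∀ t, t₀ ≤ t → ‖Φ Z t - Φ W t‖ ≤ κ * d) :
    ∃ Z ∈ normBounded E t₀ r, ∀ t, t₀ ≤ t → Z t = Φ Z t := by
  have hmax : ∀ t : ℝ, t₀ ≤ max t t₀ := fun t => le_max_right t t₀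
  let S := {Z : BoundedContinuousFunction ℝ E | ⇑Z ∈ normBounded E t₀ r}
  have : CompleteSpace S := isClosed_preimage_normBounded.completeSpace_coe
  have : Nonempty S := ⟨0, continuous_zero, fun t ht => by simpa using hr0 t ht⟩
  let Ψ : S → S := fun Z =>
    ⟨BoundedContinuousFunction.ofNormedAddCommGroup (fun t => Φ Z.1 (max t t₀))
      ((hcont Z.1 Z.2).comp_continuous (by fun_prop) hmax) (r t₀)
      (fun t => (hbound Z.1 Z.2 _ (hmax t)).trans (hr self_mem_Ici (hmax t) (hmax t))),
    (BoundedContinuousFunction.continuous _), fun t ht => by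
      simpa [max_eq_left ht] using hbound Z.1 Z.2 t ht⟩
  have hcontr : ContractingWith κ Ψ := by
    refine ⟨hκ, LipschitzWith.of_dist_le_mul fun Z W => ?_⟩
    rw [Subtype.dist_eq, BoundedContinuousFunction.dist_le (by positivity)]
    intro t
    rw [dist_eq_norm]
    exact hlip Z.1 Z.2 W.1 W.2 (dist Z W)
      (fun s _ => dist_eq_norm (Z.1 s) (W.1 s) ▸ BoundedContinuousFunction.dist_coe_le_dist s)
      _ (hmax t)
  obtain ⟨Z, hZ⟩ : ∃ Z, Ψ Z = Z := ⟨_, hcontr.fixedPoint_isFixedPt⟩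
  refine ⟨Z.1, Z.2, fun t ht => ?_⟩
  calc Z.1 t = (Ψ Z).1 t := by rw [hZ]
    _ = Φ Z.1 (max t t₀) := rfl
    _ = Φ Z.1 t := by rw [max_eq_left ht]

end FixedPoint

theorem exists_decaying_solution [NormedSpace ℂ E] [CompleteSpace E] {δ t₀ : ℝ}
    {θ θ' r : ℝ → ℝ} {e : ℝ → E → E} (hδ : 0 < δ) (ht₀ : 0 < t₀)
    (hθ : ∀ t, t₀ ≤ t → HasDerivAt θ (θ' t) t) (hr : AntitoneOn r (Ici t₀))
    (hr0 : ∀ t, t₀ ≤ t → 0 ≤ r t)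
    (he : ∀ Z ∈ normBounded E t₀ r, ContinuousOn (fun t => e t (Z t)) (Ici t₀))
    (hlip : ∀ t, t₀ ≤ t → ∀ z w : E, ‖z‖ ≤ r t → ‖w‖ ≤ r t →
      ‖e t z - e t w‖ ≤ δ / 2 / t * ‖z - w‖)
    (hzero : ∀ t, t₀ ≤ t → ‖e t 0‖ ≤ δ / 2 * r t / t) :
    ∃ Z ∈ normBounded E t₀ r,
      ∀ t, t₀ < t → HasDerivAt Z ((Complex.I * θ' t + δ / t) • Z t + e t (Z t)) t := by
  have hθc : ContinuousOn θ (Ici t₀) := fun t ht => (hθ t ht).continuousAt.continuousWithinAt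
  have hbound : ∀ Z ∈ normBounded E t₀ r, ∀ t, t₀ ≤ t → ∀ τ, t < τ →
      ‖e τ (Z τ)‖ ≤ δ * r t / τ := by
    intro Z hZ t ht τ hτ
    have hτ₀ := ht.trans hτ.le
    have hτ0 := ht₀.trans_le hτ₀
    calc ‖e τ (Z τ)‖ ≤ ‖e τ (Z τ) - e τ 0‖ + ‖e τ 0‖ := norm_le_norm_sub_add _ _
      _ ≤ δ / 2 / τ * ‖Z τ - 0‖ + δ / 2 * r τ / τ :=
          add_le_add (hlip τ hτ₀ _ _ (hZ.2 τ hτ₀) (norm_zero.trans_le (hr0 τ hτ₀))) (hzero τ hτ₀)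
      _ ≤ δ / 2 / τ * r t + δ / 2 * r t / τ := by
          rw [sub_zero]
          gcongr
          exacts [(hZ.2 τ hτ₀).trans (hr ht hτ₀ hτ.le), hr ht hτ₀ hτ.le]
      _ = δ * r t / τ := by ring
  have hint : ∀ Z ∈ normBounded E t₀ r,
      IntegrableOn (fun τ => (growingMode δ θ τ)⁻¹ • e τ (Z τ)) (Ioi t₀) := fun Z hZ =>
    integrableOn_inv_growingMode_smul hδ ht₀ hθc (he Z hZ) (hbound Z hZ t₀ le_rfl)
  obtain ⟨Z, hZ, hfix⟩ := exists_fixedPoint_normBounded (κ := 1 / 2)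
    (Φ := fun Z => duhamel δ θ fun τ => e τ (Z τ)) (by norm_num) hr hr0
    (fun Z hZ => continuousOn_duhamel ht₀ hθc (hint Z hZ))
    (fun Z hZ t ht => norm_duhamel_le hδ (ht₀.trans_le ht) (hbound Z hZ t ht))
    (fun Z hZ W hW d hd t ht => by
      rw [duhamel_sub ((hint Z hZ).mono_set (Ioi_subset_Ioi ht))
        ((hint W hW).mono_set (Ioi_subset_Ioi ht))]
      refine norm_duhamel_le hδ (ht₀.trans_le ht) fun τ hτ => ?_
      have hτ₀ := ht.trans hτ.le
      have hτ0 := ht₀.trans_le hτ₀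
      calc ‖e τ (Z τ) - e τ (W τ)‖ ≤ δ / 2 / τ * ‖Z τ - W τ‖ :=
            hlip τ hτ₀ _ _ (hZ.2 τ hτ₀) (hW.2 τ hτ₀)
        _ ≤ δ / 2 / τ * d := by gcongr; exact hd τ hτ₀
        _ = δ * (((1 / 2 : NNReal) : ℝ) * d) / τ := by push_cast; ring)
  refine ⟨Z, hZ, fun t ht => ?_⟩
  have hderiv := hasDerivAt_duhamel ht₀ ht hθc (hθ t ht.le) (he Z hZ) (hint Z hZ)
  rw [← hfix t ht.le] at hderiv
  exact hderiv.congr_of_eventuallyEq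
    (eventually_of_mem (Ioi_mem_nhds ht) fun s hs => hfix s (le_of_lt hs))

end Dichotomy

section Perturbation

variable {p q ρ : ℝ → ℝ} {B Y Q t₀ t : ℝ}

/-- The second derivative of the deviation `φ = y - modelY B` for a solution `y` of
`y'' + (p(y) - 1) y'² + e^{y-t} / 4 = 0`, in terms of `φ` and `ψ = φ'`. -/
noncomputable def accel (p : ℝ → ℝ) (B t φ ψ : ℝ) : ℝ :=
  -(p (modelY B t + φ) - 1) * (t / (t + 1) + ψ) ^ 2 + (modelP B t - 1) * (t / (t + 1)) ^ 2 -
    1 / (B * (t + 1)) * (Real.exp φ - 1)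

/-- The deviation of `f' F` from the model value. -/
noncomputable def defect (p : ℝ → ℝ) (B t : ℝ) : ℝ := p (modelY B t) - modelP B t

/-- The derivative of `defect p B`, where `q` is the derivative of `p`. -/
noncomputable def defectDeriv (q : ℝ → ℝ) (B t : ℝ) : ℝ :=
  q (modelY B t) * (t / (t + 1)) - modelPDeriv B t

/-- The part of `accel` left after removing the terms `-φ / (B t)`, `2 ψ / (B t)` and
`-defect p B t` of its linearisation. -/
noncomputable def accelRem (p : ℝ → ℝ) (B t φ ψ : ℝ) : ℝ :=
  accel p B t φ ψ + 1 / B / t * φ + defect p B t - 2 * (1 / B) / t * ψ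

theorem abs_exp_sub_sub_le {η x y : ℝ} (hη : η ≤ 1) (hx : |x| ≤ η) (hy : |y| ≤ η) :
    |(Real.exp x - x) - (Real.exp y - y)| ≤ 2 * η * |x - y| := by
  refine (convex_Icc (-η) η).norm_image_sub_le_of_norm_hasDerivWithin_le
    (f := fun z => Real.exp z - z) (f' := fun z => Real.exp z - 1)
    (fun z _ => ((Real.hasDerivAt_exp z).sub (hasDerivAt_id z)).hasDerivWithinAt)
    (fun z hz => ?_) (abs_le.1 hy) (abs_le.1 hx)
  have hz' : |z| ≤ η := abs_le.2 hz
  exact (Real.abs_exp_sub_one_le (hz'.trans hη)).trans (by linarith)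

theorem accelRem_sub (p : ℝ → ℝ) (hB : 0 < B) (ht : 0 < t) (φ₁ φ₂ ψ₁ ψ₂ : ℝ) :
    accelRem p B t φ₁ ψ₁ - accelRem p B t φ₂ ψ₂ =
      -((p (modelY B t + φ₁) - p (modelY B t + φ₂)) * (t / (t + 1) + ψ₁) ^ 2)
      - (p (modelY B t + φ₂) - (1 - 1 / B / t)) * (2 * (t / (t + 1)) + ψ₁ + ψ₂) * (ψ₁ - ψ₂)
      + 1 / B / t * (ψ₁ + ψ₂ - 2 / (t + 1)) * (ψ₁ - ψ₂)
      - 1 / B / (t + 1) * ((Real.exp φ₁ - φ₁) - (Real.exp φ₂ - φ₂))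
      + 1 / B / (t * (t + 1)) * (φ₁ - φ₂) := by
  simp only [accelRem, accel]
  field_simp
  ring

/-- The hypotheses under which `y'' + (p(y) - 1) y'² + e^{y-t} / 4 = 0` is treated as a
perturbation of the equation solved by `modelY B`: on `[t₀, ∞)` the deviation of `p` from the model
and its derivative are controlled by `ρ`, and the derivative `q` of `p` is `O(t⁻²)` near the model
solution. -/
structure IsNearModel (p q ρ : ℝ → ℝ) (B Y Q t₀ : ℝ) : Prop where
  one_le_B : 1 ≤ B
  one_le_left : 1 ≤ t₀
  hasDerivAt : ∀ y, Y < y → HasDerivAt p (q y) y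
  continuousAt : ∀ y, Y < y → ContinuousAt q y
  lt_modelY : ∀ t, t₀ ≤ t → Y < modelY B t - 1
  abs_deriv_le : ∀ t, t₀ ≤ t → ∀ y, modelY B t - 1 ≤ y → |q y| ≤ Q / t ^ 2
  antitoneOn : AntitoneOn ρ (Ici t₀)
  abs_defect_le : ∀ t, t₀ ≤ t → |defect p B t| ≤ ρ t / t
  abs_defectDeriv_le : ∀ t, t₀ ≤ t → |defectDeriv q B t| ≤ ρ t / t ^ 2

namespace IsNearModel

theorem pos_B (h : IsNearModel p q ρ B Y Q t₀) : 0 < B := one_pos.trans_le h.one_le_B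

theorem one_le (h : IsNearModel p q ρ B Y Q t₀) (ht : t₀ ≤ t) : 1 ≤ t := h.one_le_left.trans ht

theorem pos (h : IsNearModel p q ρ B Y Q t₀) (ht : t₀ ≤ t) : 0 < t := one_pos.trans_le (h.one_le ht)

theorem nonneg (h : IsNearModel p q ρ B Y Q t₀) (ht : t₀ ≤ t) : 0 ≤ ρ t := by
  have := (abs_nonneg _).trans (h.abs_defect_le t ht)
  rwa [le_div_iff₀ (h.pos ht), zero_mul] at this

theorem Q_nonneg (h : IsNearModel p q ρ B Y Q t₀) : 0 ≤ Q := by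
  have := (abs_nonneg _).trans (h.abs_deriv_le t₀ le_rfl (modelY B t₀) (sub_one_lt _).le)
  rwa [le_div_iff₀ (pow_pos (h.pos le_rfl) 2), zero_mul] at this

theorem abs_sub_le (h : IsNearModel p q ρ B Y Q t₀) (ht : t₀ ≤ t) {φ₁ φ₂ : ℝ} (hφ₁ : |φ₁| ≤ 1)
    (hφ₂ : |φ₂| ≤ 1) :
    |p (modelY B t + φ₁) - p (modelY B t + φ₂)| ≤ Q / t ^ 2 * |φ₁ - φ₂| := by
  have hmem : ∀ φ, |φ| ≤ 1 → modelY B t + φ ∈ Ici (modelY B t - 1) := fun φ hφ => by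
    rw [mem_Ici, sub_eq_add_neg]
    exact add_le_add_right (abs_le.1 hφ).1 _
  have := (convex_Ici (modelY B t - 1)).norm_image_sub_le_of_norm_hasDerivWithin_le
    (fun y hy => (h.hasDerivAt y ((h.lt_modelY t ht).trans_le hy)).hasDerivWithinAt)
    (fun y hy => h.abs_deriv_le t ht y hy) (hmem φ₂ hφ₂) (hmem φ₁ hφ₁)
  rwa [add_sub_add_left_eq_sub] at this

theorem abs_sub_one_sub_le (h : IsNearModel p q ρ B Y Q t₀) (ht : t₀ ≤ t) {η φ : ℝ}
    (hρ : ρ t ≤ η) (hφ : |φ| ≤ 1) :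
    |p (modelY B t + φ) - (1 - 1 / B / t)| ≤ (Q + 2) / t ^ 2 + η / t := by
  have ht0 := h.pos ht
  have hB := h.pos_B
  have hQ := h.Q_nonneg
  have hb : 1 / B ≤ 1 := by rw [div_le_one hB]; exact h.one_le_B
  have hp := h.abs_sub_le ht hφ (abs_zero.trans_le zero_le_one)
  rw [add_zero, sub_zero] at hp
  calc |p (modelY B t + φ) - (1 - 1 / B / t)|
      = |p (modelY B t + φ) - p (modelY B t) + defect p B t - (1 + 1 / B) / t ^ 2| := by
        congr 1
        rw [defect, modelP]
        field_simp
        ring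
    _ ≤ Q / t ^ 2 * 1 + η / t + (1 + 1) / t ^ 2 := by
        refine (abs_sub _ _).trans (add_le_add ((abs_add_le _ _).trans (add_le_add ?_ ?_)) ?_)
        · exact hp.trans (by gcongr)
        · exact (h.abs_defect_le t ht).trans (by gcongr)
        · rw [abs_of_pos (by positivity)]
          gcongr
    _ = (Q + 2) / t ^ 2 + η / t := by ring

theorem abs_accelRem_sub_le (h : IsNearModel p q ρ B Y Q t₀) (ht : t₀ ≤ t) {η : ℝ} (hη : η ≤ 1)
    (hρ : ρ t ≤ η) {φ₁ φ₂ ψ₁ ψ₂ : ℝ} (hφ₁ : |φ₁| ≤ η) (hφ₂ : |φ₂| ≤ η) (hψ₁ : |ψ₁| ≤ η)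
    (hψ₂ : |ψ₂| ≤ η) :
    |accelRem p B t φ₁ ψ₁ - accelRem p B t φ₂ ψ₂| ≤
      (4 * Q + 10) * (1 / t ^ 2 + η / t) * (|φ₁ - φ₂| + |ψ₁ - ψ₂|) := by
  have ht0 := h.pos ht
  have hB := h.pos_B
  have hQ := h.Q_nonneg
  have hη0 := (h.nonneg ht).trans hρ
  have hb : 1 / B ≤ 1 := by rw [div_le_one hB]; exact h.one_le_B
  have ha : t / (t + 1) ≤ 1 := by rw [div_le_one (by linarith)]; linarith
  have ha0 : 0 ≤ t / (t + 1) := by positivity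
  have hsq : |(t / (t + 1) + ψ₁) ^ 2| ≤ 4 := by
    rw [abs_of_nonneg (sq_nonneg _)]
    nlinarith [abs_le.1 hψ₁]
  have hsum : |2 * (t / (t + 1)) + ψ₁ + ψ₂| ≤ 4 := by
    rw [abs_le]
    constructor <;> linarith [abs_le.1 hψ₁, abs_le.1 hψ₂]
  have hψ : |ψ₁ + ψ₂ - 2 / (t + 1)| ≤ η + η + 2 / t := by
    refine (abs_sub _ _).trans (add_le_add ((abs_add_le _ _).trans (add_le_add hψ₁ hψ₂)) ?_)
    rw [abs_of_pos (by positivity)]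
    gcongr
    linarith
  rw [accelRem_sub p hB ht0]
  calc _ ≤ Q / t ^ 2 * |φ₁ - φ₂| * 4
        + ((Q + 2) / t ^ 2 + η / t) * 4 * |ψ₁ - ψ₂| + 1 / t * (η + η + 2 / t) * |ψ₁ - ψ₂|
        + 1 / t * (2 * η * |φ₁ - φ₂|) + 1 / (t * t) * |φ₁ - φ₂| := by
        refine (abs_add_le _ _).trans (add_le_add ((abs_sub _ _).trans (add_le_add
          ((abs_add_le _ _).trans (add_le_add ((abs_sub _ _).trans (add_le_add ?_ ?_)) ?_)) ?_)) ?_)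
        · rw [abs_neg, abs_mul]
          gcongr
          exact h.abs_sub_le ht (hφ₁.trans hη) (hφ₂.trans hη)
        · rw [abs_mul, abs_mul]
          gcongr
          exact h.abs_sub_one_sub_le ht hρ (hφ₂.trans hη)
        all_goals simp only [abs_mul, abs_of_pos (show 0 < 1 / B / t by positivity),
          abs_of_pos (show 0 < 1 / B / (t + 1) by positivity),
          abs_of_pos (show 0 < 1 / B / (t * (t + 1)) by positivity)]
        · gcongr
        · gcongr
          exacts [by linarith, abs_exp_sub_sub_le hη hφ₁ hφ₂]
        · gcongr
          linarith
    _ = ((4 * Q + 1) * (1 / t ^ 2) + 2 * (η / t)) * |φ₁ - φ₂|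
        + ((4 * Q + 10) * (1 / t ^ 2) + 6 * (η / t)) * |ψ₁ - ψ₂| := by ring
    _ ≤ ((4 * Q + 10) * (1 / t ^ 2) + (4 * Q + 10) * (η / t)) * |φ₁ - φ₂|
        + ((4 * Q + 10) * (1 / t ^ 2) + (4 * Q + 10) * (η / t)) * |ψ₁ - ψ₂| := by
        gcongr <;> linarith
    _ = _ := by ring

theorem abs_accelRem_zero_le (h : IsNearModel p q ρ B Y Q t₀) (ht : t₀ ≤ t) :
    |accelRem p B t 0 0| ≤ 2 * ρ t / t ^ 2 := by
  have ht0 := h.pos ht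
  have hρ := h.nonneg ht
  have hfac : |1 - (t / (t + 1)) ^ 2| ≤ 2 / t := by
    have : 1 - (t / (t + 1)) ^ 2 = (2 * t + 1) / (t + 1) ^ 2 := by field_simp; ring
    rw [this, abs_of_nonneg (by positivity), div_le_div_iff₀ (by positivity) ht0]
    linarith [show 2 * (t + 1) ^ 2 - (2 * t + 1) * t = 3 * t + 2 by ring]
  calc |accelRem p B t 0 0| = |defect p B t * (1 - (t / (t + 1)) ^ 2)| := by
        congr 1
        simp only [accelRem, accel, defect, add_zero, Real.exp_zero]
        ring
    _ ≤ ρ t / t * (2 / t) := by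
        rw [abs_mul]
        gcongr
        exact h.abs_defect_le t ht
    _ = 2 * ρ t / t ^ 2 := by ring

end IsNearModel

end Perturbation

section WKB

variable {p q ρ : ℝ → ℝ} {B Y Q t₀ t : ℝ}

/-- The solutions of the linearised equation `φ'' = 2 / (B t) φ' - φ / (B t)` oscillate with phase
`2 √t` times this frequency. -/
noncomputable def wkbFreq (B : ℝ) : ℝ := √(1 / B)

/-- The amplitude of the oscillations of the linearised equation is `t` to this power. -/
noncomputable def wkbRate (B : ℝ) : ℝ := 1 / 4 + 1 / B

/-- The coefficient that corrects `φ'` for the growth of the amplitude of the oscillations. -/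
noncomputable def wkbShear (B : ℝ) : ℝ := wkbRate B / wkbFreq B

/-- The non-oscillating response `φ = -forced` to the defect: it cancels `-φ / (B t) - defect`. -/
noncomputable def forced (p : ℝ → ℝ) (B t : ℝ) : ℝ := B * (t * defect p B t)

/-- The derivative of `forced p B`, where `q` is the derivative of `p`. -/
noncomputable def forcedDeriv (p q : ℝ → ℝ) (B t : ℝ) : ℝ :=
  B * (defect p B t + t * defectDeriv q B t)

/-- The deviation `φ` with WKB coordinate `z`. -/
noncomputable def wkbDev (p : ℝ → ℝ) (B t : ℝ) (z : ℂ) : ℝ := z.re / wkbFreq B - forced p B t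

/-- The derivative `ψ = φ'` of the deviation with WKB coordinate `z`. -/
noncomputable def wkbDevDeriv (B t : ℝ) (z : ℂ) : ℝ := z.im / √t + wkbShear B * z.re / t

/-- The right hand side of the equation
`z' - (wkbRate B / t - i wkbFreq B / √t) z = wkbError p q B t z` satisfied by the WKB coordinate of
a solution of `φ'' = accel p B t φ φ'`. -/
noncomputable def wkbError (p q : ℝ → ℝ) (B t : ℝ) (z : ℂ) : ℂ :=
  (wkbFreq B * forcedDeriv p q B t : ℝ) +
    ((wkbRate B * wkbShear B + wkbShear B / 2) * z.re / (t * √t) +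
      √t * accelRem p B t (wkbDev p B t z) (wkbDevDeriv B t z) -
        wkbRate B / √t * forcedDeriv p q B t : ℝ) * Complex.I

/-- The Lipschitz constant of `wkbError`, up to a factor tending to `0`. -/
noncomputable def wkbLip (B Q : ℝ) : ℝ :=
  wkbRate B * wkbShear B + wkbShear B / 2 + (4 * Q + 10) * (1 / wkbFreq B + (1 + wkbShear B))

/-- The size of `wkbError` at `z = 0` in units of `ρ t / t`. -/
noncomputable def wkbSource (B Q : ℝ) : ℝ :=
  2 * B * wkbFreq B + (2 * (4 * Q + 10) * B + 2) + 2 * B * wkbRate B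

theorem wkbFreq_pos (hB : 0 < B) : 0 < wkbFreq B := Real.sqrt_pos.2 (by positivity)

theorem wkbFreq_mul_self (hB : 0 < B) : wkbFreq B * wkbFreq B = 1 / B :=
  Real.mul_self_sqrt (by positivity)

theorem wkbRate_pos (hB : 0 < B) : 0 < wkbRate B := by unfold wkbRate; positivity

theorem wkbShear_pos (hB : 0 < B) : 0 < wkbShear B := div_pos (wkbRate_pos hB) (wkbFreq_pos hB)

theorem wkbSource_nonneg (hB : 0 < B) (hQ : 0 ≤ Q) : 0 ≤ wkbSource B Q := by
  have := wkbFreq_pos hB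
  have := wkbRate_pos hB
  unfold wkbSource
  positivity

theorem wkbError_re (p q : ℝ → ℝ) (B t : ℝ) (z : ℂ) :
    (wkbError p q B t z).re = wkbFreq B * forcedDeriv p q B t := by
  rw [wkbError, Complex.add_re, Complex.re_ofReal_mul, Complex.I_re, mul_zero, add_zero,
    Complex.ofReal_re]

theorem wkbError_im (p q : ℝ → ℝ) (B t : ℝ) (z : ℂ) :
    (wkbError p q B t z).im = (wkbRate B * wkbShear B + wkbShear B / 2) * z.re / (t * √t) +
      √t * accelRem p B t (wkbDev p B t z) (wkbDevDeriv B t z) -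
        wkbRate B / √t * forcedDeriv p q B t := by
  rw [wkbError, Complex.add_im, Complex.im_ofReal_mul, Complex.I_im, mul_one, Complex.ofReal_im,
    zero_add]

theorem wkbDev_zero (p : ℝ → ℝ) (B t : ℝ) : wkbDev p B t 0 = -forced p B t := by
  rw [wkbDev, Complex.zero_re, zero_div, zero_sub]

theorem wkbDevDeriv_zero (B t : ℝ) : wkbDevDeriv B t 0 = 0 := by
  simp only [wkbDevDeriv, Complex.zero_re, Complex.zero_im, mul_zero, zero_div, add_zero]

theorem abs_wkbDev_sub_le (p : ℝ → ℝ) (hB : 0 < B) (t : ℝ) (z w : ℂ) :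
    |wkbDev p B t z - wkbDev p B t w| ≤ 1 / wkbFreq B * ‖z - w‖ := by
  have hω := wkbFreq_pos hB
  have hsub : wkbDev p B t z - wkbDev p B t w = 1 / wkbFreq B * (z - w).re := by
    simp only [wkbDev, Complex.sub_re]
    ring
  rw [hsub, abs_mul, abs_of_pos (by positivity)]
  gcongr
  exact Complex.abs_re_le_norm _

theorem abs_wkbDevDeriv_le (hB : 0 < B) (ht : 1 ≤ t) (z : ℂ) :
    |wkbDevDeriv B t z| ≤ (1 + wkbShear B) * ‖z‖ := by
  have hk := wkbShear_pos hB
  have him : |z.im / √t| ≤ ‖z‖ := by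
    rw [abs_div, abs_of_nonneg (Real.sqrt_nonneg t)]
    exact (div_le_self (abs_nonneg _) (Real.one_le_sqrt.2 ht)).trans (Complex.abs_im_le_norm z)
  have hre : |wkbShear B * z.re / t| ≤ wkbShear B * ‖z‖ := by
    rw [abs_div, abs_mul, abs_of_pos hk, abs_of_pos (one_pos.trans_le ht)]
    refine (div_le_self (by positivity) ht).trans ?_
    gcongr
    exact Complex.abs_re_le_norm z
  rw [wkbDevDeriv, add_mul, one_mul]
  exact (abs_add_le _ _).trans (add_le_add him hre)

theorem abs_wkbDevDeriv_sub_le (hB : 0 < B) (ht : 1 ≤ t) (z w : ℂ) :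
    |wkbDevDeriv B t z - wkbDevDeriv B t w| ≤ (1 + wkbShear B) * ‖z - w‖ := by
  have hsub : wkbDevDeriv B t z - wkbDevDeriv B t w = wkbDevDeriv B t (z - w) := by
    simp only [wkbDevDeriv, Complex.sub_re, Complex.sub_im]
    ring
  rw [hsub]
  exact abs_wkbDevDeriv_le hB ht _

theorem sqrt_mul_inv_sq_add (ht : 0 < t) (η : ℝ) :
    √t * (1 / t ^ 2 + η / t) = (1 / √t + √t * η) / t := by
  have := Real.sqrt_pos.2 ht
  field_simp
  rw [Real.sq_sqrt ht.le]

namespace IsNearModel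

theorem abs_forced_le (h : IsNearModel p q ρ B Y Q t₀) (ht : t₀ ≤ t) :
    |forced p B t| ≤ B * ρ t := by
  have hB := h.pos_B
  have ht0 := h.pos ht
  calc |forced p B t| = B * (t * |defect p B t|) := by
        rw [forced, abs_mul, abs_mul, abs_of_pos hB, abs_of_pos ht0]
    _ ≤ B * (t * (ρ t / t)) := by gcongr; exact h.abs_defect_le t ht
    _ = B * ρ t := by field_simp

theorem abs_forcedDeriv_le (h : IsNearModel p q ρ B Y Q t₀) (ht : t₀ ≤ t) :
    |forcedDeriv p q B t| ≤ 2 * B * ρ t / t := by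
  have hB := h.pos_B
  have ht0 := h.pos ht
  calc |forcedDeriv p q B t| ≤ B * (|defect p B t| + t * |defectDeriv q B t|) := by
        rw [forcedDeriv, abs_mul, abs_of_pos hB]
        gcongr
        exact (abs_add_le _ _).trans_eq (by rw [abs_mul, abs_of_pos ht0])
    _ ≤ B * (ρ t / t + t * (ρ t / t ^ 2)) := by
        gcongr
        exacts [h.abs_defect_le t ht, h.abs_defectDeriv_le t ht]
    _ = 2 * B * ρ t / t := by field_simp; ring

theorem abs_wkbDev_le (h : IsNearModel p q ρ B Y Q t₀) (ht : t₀ ≤ t) (z : ℂ) :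
    |wkbDev p B t z| ≤ 1 / wkbFreq B * ‖z‖ + B * ρ t := by
  have hz := abs_wkbDev_sub_le p h.pos_B t z 0
  rw [wkbDev_zero, sub_neg_eq_add, sub_zero] at hz
  have := abs_sub (wkbDev p B t z + forced p B t) (forced p B t)
  rw [add_sub_cancel_right] at this
  linarith [h.abs_forced_le ht]

theorem hasDerivAt_defect (h : IsNearModel p q ρ B Y Q t₀) (ht : t₀ ≤ t) :
    HasDerivAt (defect p B) (defectDeriv q B t) t :=
  ((h.hasDerivAt _ ((h.lt_modelY t ht).trans (sub_one_lt _))).comp t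
    (hasDerivAt_modelY B (h.pos ht))).sub (hasDerivAt_modelP B (h.pos ht).ne')

theorem hasDerivAt_forced (h : IsNearModel p q ρ B Y Q t₀) (ht : t₀ ≤ t) :
    HasDerivAt (forced p B) (forcedDeriv p q B t) t := by
  refine (((hasDerivAt_id t).mul (h.hasDerivAt_defect ht)).const_mul B).congr_deriv ?_
  rw [forcedDeriv, one_mul, id]

theorem continuousAt_forcedDeriv (h : IsNearModel p q ρ B Y Q t₀) (ht : t₀ ≤ t) :
    ContinuousAt (forcedDeriv p q B) t := by
  have ht0 := (h.pos ht).ne'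
  have ht1 : t + 1 ≠ 0 := (add_pos (h.pos ht) one_pos).ne'
  have hq : ContinuousAt (fun t => q (modelY B t)) t :=
    ContinuousAt.comp (h.continuousAt _ ((h.lt_modelY t ht).trans (sub_one_lt _)))
      (hasDerivAt_modelY B (h.pos ht)).continuousAt
  have hP : ContinuousAt (modelPDeriv B) t := by
    unfold modelPDeriv
    fun_prop (disch := positivity)
  have hdefect := (h.hasDerivAt_defect ht).continuousAt
  have hfrac : ContinuousAt (fun t : ℝ => t / (t + 1)) t := by fun_prop (disch := assumption)
  exact continuousAt_const.mul (hdefect.add (continuousAt_id.mul ((hq.mul hfrac).sub hP)))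

theorem norm_wkbError_sub_le (h : IsNearModel p q ρ B Y Q t₀) (ht : t₀ ≤ t) {η : ℝ} (hη : η ≤ 1)
    (hρ : ρ t ≤ η) {z w : ℂ} (hz : |wkbDev p B t z| ≤ η) (hw : |wkbDev p B t w| ≤ η)
    (hz' : |wkbDevDeriv B t z| ≤ η) (hw' : |wkbDevDeriv B t w| ≤ η) :
    ‖wkbError p q B t z - wkbError p q B t w‖ ≤
      wkbLip B Q * (1 / √t + √t * η) / t * ‖z - w‖ := by
  have hB := h.pos_B
  have hQ := h.Q_nonneg
  have ht0 := h.pos ht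
  have hst := Real.sqrt_pos.2 ht0
  have hη0 := (h.nonneg ht).trans hρ
  have := wkbFreq_pos hB
  have := wkbRate_pos hB
  have := wkbShear_pos hB
  set A := accelRem p B t (wkbDev p B t z) (wkbDevDeriv B t z) -
    accelRem p B t (wkbDev p B t w) (wkbDevDeriv B t w) with hAdef
  set c := wkbRate B * wkbShear B + wkbShear B / 2 with hc
  have hre : (wkbError p q B t z - wkbError p q B t w).re = 0 := by
    rw [Complex.sub_re, wkbError_re, wkbError_re, sub_self]
  have him : (wkbError p q B t z - wkbError p q B t w).im =
      c * (1 / √t) / t * (z - w).re + √t * A := by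
    rw [Complex.sub_im, wkbError_im, wkbError_im, Complex.sub_re, hAdef, ← hc]
    field_simp
    ring
  have hA : |A| ≤ (4 * Q + 10) * (1 / t ^ 2 + η / t) *
      ((1 / wkbFreq B + (1 + wkbShear B)) * ‖z - w‖) := by
    refine (h.abs_accelRem_sub_le ht hη hρ hz hw hz' hw').trans ?_
    gcongr
    linarith [abs_wkbDev_sub_le p hB t z w, abs_wkbDevDeriv_sub_le hB (h.one_le ht) z w]
  calc ‖wkbError p q B t z - wkbError p q B t w‖
      ≤ |c * (1 / √t) / t * (z - w).re + √t * A| := by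
        refine (Complex.norm_le_abs_re_add_abs_im _).trans_eq ?_
        rw [hre, him, abs_zero, zero_add]
    _ ≤ c * (1 / √t) / t * |(z - w).re| + √t * |A| := by
        refine (abs_add_le _ _).trans_eq ?_
        rw [abs_mul, abs_mul, abs_of_pos hst, abs_of_nonneg (by positivity)]
    _ ≤ c * (1 / √t + √t * η) / t * ‖z - w‖ + √t * ((4 * Q + 10) * (1 / t ^ 2 + η / t) *
          ((1 / wkbFreq B + (1 + wkbShear B)) * ‖z - w‖)) := by
        gcongr
        · exact le_add_of_nonneg_right (by positivity)
        · exact Complex.abs_re_le_norm _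
    _ = wkbLip B Q * (1 / √t + √t * η) / t * ‖z - w‖ := by
        rw [wkbLip, ← hc]
        linear_combination (4 * Q + 10) * ((1 / wkbFreq B + (1 + wkbShear B)) * ‖z - w‖) *
          sqrt_mul_inv_sq_add ht0 η

theorem sqrt_mul_abs_accelRem_forced_le (h : IsNearModel p q ρ B Y Q t₀) (ht : t₀ ≤ t) {η : ℝ}
    (hη : η ≤ 1) (hsη : √t * η ≤ 1) (hρ : B * ρ t ≤ η) :
    √t * |accelRem p B t (-forced p B t) 0| ≤ (2 * (4 * Q + 10) * B + 2) * ρ t / t := by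
  have hB := h.pos_B
  have hQ := h.Q_nonneg
  have ht0 := h.pos ht
  have hρ0 := h.nonneg ht
  have hs1 : 1 / √t ≤ 1 := by
    rw [div_le_one (Real.sqrt_pos.2 ht0)]
    exact Real.one_le_sqrt.2 (h.one_le ht)
  have hη0 : 0 ≤ η := (by positivity : 0 ≤ B * ρ t).trans hρ
  have hforced : |-forced p B t| ≤ B * ρ t := (abs_neg _).trans_le (h.abs_forced_le ht)
  have hA : |accelRem p B t (-forced p B t) 0| ≤
      (4 * Q + 10) * (1 / t ^ 2 + η / t) * (B * ρ t) + 2 * ρ t / t ^ 2 := by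
    have hsub := h.abs_accelRem_sub_le ht hη ((le_mul_of_one_le_left hρ0 h.one_le_B).trans hρ)
      (hforced.trans hρ) (abs_zero.trans_le hη0) (abs_zero.trans_le hη0) (abs_zero.trans_le hη0)
    rw [sub_zero, sub_self, abs_zero, add_zero] at hsub
    have hmul : (4 * Q + 10) * (1 / t ^ 2 + η / t) * |-forced p B t| ≤
      (4 * Q + 10) * (1 / t ^ 2 + η / t) * (B * ρ t) := by gcongr
    have htri := abs_add_le (accelRem p B t (-forced p B t) 0 - accelRem p B t 0 0)
      (accelRem p B t 0 0)
    rw [sub_add_cancel] at htri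
    linarith [h.abs_accelRem_zero_le ht]
  calc √t * |accelRem p B t (-forced p B t) 0|
      ≤ √t * ((4 * Q + 10) * (1 / t ^ 2 + η / t) * (B * ρ t) + 2 * ρ t / t ^ 2) := by gcongr
    _ = (4 * Q + 10) * ((1 / √t + √t * η) / t) * (B * ρ t) +
          2 * ρ t * ((1 / √t + √t * 0) / t) := by
        linear_combination (4 * Q + 10) * (B * ρ t) * sqrt_mul_inv_sq_add ht0 η +
          2 * ρ t * sqrt_mul_inv_sq_add ht0 0
    _ ≤ (4 * Q + 10) * ((1 + 1) / t) * (B * ρ t) + 2 * ρ t * ((1 + 0) / t) := by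
        gcongr
        exact (mul_zero _).le
    _ = (2 * (4 * Q + 10) * B + 2) * ρ t / t := by ring

theorem norm_wkbError_zero_le (h : IsNearModel p q ρ B Y Q t₀) (ht : t₀ ≤ t) {η : ℝ} (hη : η ≤ 1)
    (hsη : √t * η ≤ 1) (hρ : B * ρ t ≤ η) :
    ‖wkbError p q B t 0‖ ≤ wkbSource B Q * ρ t / t := by
  have hω := wkbFreq_pos h.pos_B
  have hδ := wkbRate_pos h.pos_B
  have ht0 := h.pos ht
  have hforced := h.abs_forcedDeriv_le ht
  have hre : |(wkbError p q B t 0).re| ≤ 2 * B * wkbFreq B * ρ t / t := by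
    rw [wkbError_re, abs_mul, abs_of_pos hω]
    calc wkbFreq B * |forcedDeriv p q B t| ≤ wkbFreq B * (2 * B * ρ t / t) := by gcongr
      _ = 2 * B * wkbFreq B * ρ t / t := by ring
  have him : |(wkbError p q B t 0).im| ≤
      (2 * (4 * Q + 10) * B + 2) * ρ t / t + 2 * B * wkbRate B * ρ t / t := by
    rw [wkbError_im, wkbDev_zero, wkbDevDeriv_zero, Complex.zero_re, mul_zero, zero_div, zero_add]
    refine (abs_sub _ _).trans (add_le_add ?_ ?_)
    · rw [abs_mul, abs_of_nonneg (Real.sqrt_nonneg t)]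
      exact h.sqrt_mul_abs_accelRem_forced_le ht hη hsη hρ
    · rw [abs_mul, abs_of_nonneg (by positivity)]
      calc wkbRate B / √t * |forcedDeriv p q B t| ≤ wkbRate B * (2 * B * ρ t / t) := by
            gcongr
            exact div_le_self hδ.le (Real.one_le_sqrt.2 (h.one_le ht))
        _ = 2 * B * wkbRate B * ρ t / t := by ring
  calc ‖wkbError p q B t 0‖ ≤ |(wkbError p q B t 0).re| + |(wkbError p q B t 0).im| :=
        Complex.norm_le_abs_re_add_abs_im _
    _ ≤ wkbSource B Q * ρ t / t := by
        rw [wkbSource]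
        linear_combination hre + him

theorem continuousAt_accelRem (h : IsNearModel p q ρ B Y Q t₀) (ht : t₀ ≤ t) {φ ψ : ℝ → ℝ}
    (hφ : ContinuousAt φ t) (hψ : ContinuousAt ψ t) (hφ1 : |φ t| ≤ 1) :
    ContinuousAt (fun t => accelRem p B t (φ t) (ψ t)) t := by
  have ht0 := (h.pos ht).ne'
  have ht1 : t + 1 ≠ 0 := (add_pos (h.pos ht) one_pos).ne'
  have hY := (hasDerivAt_modelY B (h.pos ht)).continuousAt
  have hP := (hasDerivAt_modelP B ht0).continuousAt
  have hdefect := (h.hasDerivAt_defect ht).continuousAt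
  have hYφ : Y < modelY B t + φ t := by linarith [h.lt_modelY t ht, (abs_le.1 hφ1).1]
  have hp : ContinuousAt (fun t => p (modelY B t + φ t)) t :=
    ContinuousAt.comp (g := p) (h.hasDerivAt _ hYφ).continuousAt (hY.add hφ)
  have hfrac : ContinuousAt (fun t : ℝ => t / (t + 1)) t := by fun_prop (disch := assumption)
  have hdiv : ∀ c : ℝ, ContinuousAt (fun t : ℝ => c / t) t := fun c => by
    fun_prop (disch := assumption)
  have hcoeff : ContinuousAt (fun t : ℝ => 1 / (B * (t + 1))) t :=
    continuousAt_const.div (by fun_prop) (mul_ne_zero h.pos_B.ne' ht1)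
  have haccel : ContinuousAt (fun t => accel p B t (φ t) (ψ t)) t :=
    (((hp.sub continuousAt_const).neg.mul ((hfrac.add hψ).pow 2)).add
      ((hP.sub continuousAt_const).mul (hfrac.pow 2))).sub
      (hcoeff.mul (hφ.rexp.sub continuousAt_const))
  exact ((haccel.add ((hdiv _).mul hφ)).add hdefect).sub ((hdiv _).mul hψ)

theorem continuousAt_wkbError (h : IsNearModel p q ρ B Y Q t₀) (ht : t₀ ≤ t) {Z : ℝ → ℂ}
    (hZ : Continuous Z) (hdev : |wkbDev p B t (Z t)| ≤ 1) :
    ContinuousAt (fun t => wkbError p q B t (Z t)) t := by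
  have ht0 := (h.pos ht).ne'
  have hst : √t ≠ 0 := (Real.sqrt_pos.2 (h.pos ht)).ne'
  have htst : t * √t ≠ 0 := mul_ne_zero ht0 hst
  have hforced := (h.hasDerivAt_forced ht).continuousAt
  have hφ : ContinuousAt (fun t => wkbDev p B t (Z t)) t := by
    exact (by fun_prop : ContinuousAt (fun t => (Z t).re / wkbFreq B) t).sub hforced
  have hψ : ContinuousAt (fun t => wkbDevDeriv B t (Z t)) t := by
    unfold wkbDevDeriv
    fun_prop (disch := assumption)
  have hrem := h.continuousAt_accelRem ht hφ hψ hdev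
  have hforced' := h.continuousAt_forcedDeriv ht
  unfold wkbError
  fun_prop (disch := assumption)

end IsNearModel

end WKB

section PerturbedSolution

variable {p q ρ : ℝ → ℝ} {B Y Q t₀ t : ℝ}

/-- The decaying solution in WKB coordinates is at most this multiple of `ρ`. -/
noncomputable def wkbRadius (B Q : ℝ) : ℝ := 2 * wkbSource B Q / wkbRate B

/-- The corresponding multiple of `ρ` for the deviation and its derivative. -/
noncomputable def wkbBound (B Q : ℝ) : ℝ :=
  1 / wkbFreq B * wkbRadius B Q + B + (1 + wkbShear B) * wkbRadius B Q

theorem wkbRadius_nonneg (hB : 0 < B) (hQ : 0 ≤ Q) : 0 ≤ wkbRadius B Q :=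
  div_nonneg (mul_nonneg zero_le_two (wkbSource_nonneg hB hQ)) (wkbRate_pos hB).le

theorem le_wkbBound (hB : 0 < B) (hQ : 0 ≤ Q) : B ≤ wkbBound B Q := by
  have := wkbFreq_pos hB
  have := wkbShear_pos hB
  have := wkbRadius_nonneg hB hQ
  rw [wkbBound, add_right_comm]
  exact le_add_of_nonneg_left (by positivity)

section OscillatorDerivative

variable {Z : ℝ → ℂ} {α β : ℝ} {e : ℂ}

theorem hasDerivAt_re_of_oscillator (hZ : HasDerivAt Z ((Complex.I * α + β) • Z t + e) t) :
    HasDerivAt (fun t => (Z t).re) (-α * (Z t).im + β * (Z t).re + e.re) t := by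
  refine (Complex.reCLM.hasFDerivAt.comp_hasDerivAt t hZ).congr_deriv ?_
  simp [Complex.mul_re]
  ring

theorem hasDerivAt_im_of_oscillator (hZ : HasDerivAt Z ((Complex.I * α + β) • Z t + e) t) :
    HasDerivAt (fun t => (Z t).im) (α * (Z t).re + β * (Z t).im + e.im) t := by
  refine (Complex.imCLM.hasFDerivAt.comp_hasDerivAt t hZ).congr_deriv ?_
  simp [Complex.mul_im]
  ring

end OscillatorDerivative

theorem hasDerivAt_wkbPhase (B : ℝ) (ht : 0 < t) :
    HasDerivAt (fun t => -2 * wkbFreq B * √t) (-(wkbFreq B / √t)) t := by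
  refine ((Real.hasDerivAt_sqrt ht.ne').const_mul (-2 * wkbFreq B)).congr_deriv ?_
  have := Real.sqrt_pos.2 ht
  field_simp

namespace IsNearModel

theorem hasDerivAt_wkbDev (h : IsNearModel p q ρ B Y Q t₀) (ht : t₀ ≤ t) {Z : ℝ → ℂ}
    (hZ : HasDerivAt Z ((Complex.I * (-(wkbFreq B / √t) : ℝ) + (wkbRate B / t : ℝ)) • Z t +
      wkbError p q B t (Z t)) t) :
    HasDerivAt (fun t => wkbDev p B t (Z t)) (wkbDevDeriv B t (Z t)) t := by
  refine (((hasDerivAt_re_of_oscillator hZ).div_const (wkbFreq B)).sub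
    (h.hasDerivAt_forced ht)).congr_deriv ?_
  have hω := (wkbFreq_pos h.pos_B).ne'
  rw [wkbError_re, wkbDevDeriv, wkbShear]
  field_simp
  ring

theorem hasDerivAt_wkbDevDeriv (h : IsNearModel p q ρ B Y Q t₀) (ht : t₀ ≤ t) {Z : ℝ → ℂ}
    (hZ : HasDerivAt Z ((Complex.I * (-(wkbFreq B / √t) : ℝ) + (wkbRate B / t : ℝ)) • Z t +
      wkbError p q B t (Z t)) t) :
    HasDerivAt (fun t => wkbDevDeriv B t (Z t))
      (accel p B t (wkbDev p B t (Z t)) (wkbDevDeriv B t (Z t))) t := by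
  have ht0 := h.pos ht
  have hs := (Real.sqrt_pos.2 ht0).ne'
  have hω := (wkbFreq_pos h.pos_B).ne'
  have hquot := ((hasDerivAt_im_of_oscillator hZ).div (Real.hasDerivAt_sqrt ht0.ne') hs).add
    (((hasDerivAt_re_of_oscillator hZ).const_mul (wkbShear B)).div (hasDerivAt_id t) ht0.ne')
  refine hquot.congr_deriv ?_
  have haccel : accel p B t (wkbDev p B t (Z t)) (wkbDevDeriv B t (Z t)) =
      accelRem p B t (wkbDev p B t (Z t)) (wkbDevDeriv B t (Z t)) -
        1 / B / t * wkbDev p B t (Z t) - defect p B t +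
          2 * (1 / B) / t * wkbDevDeriv B t (Z t) := by
    rw [accelRem]
    ring
  rw [haccel, wkbError_re, wkbError_im]
  generalize accelRem p B t (wkbDev p B t (Z t)) (wkbDevDeriv B t (Z t)) = r
  have hBω : B = 1 / (wkbFreq B * wkbFreq B) := by rw [wkbFreq_mul_self h.pos_B, one_div_one_div]
  simp only [wkbDev, wkbDevDeriv, forced, wkbShear, wkbRate, ← wkbFreq_mul_self h.pos_B, id]
  generalize forcedDeriv p q B t = d', defect p B t = d
  generalize wkbFreq B = ω at *
  subst hBω
  obtain ⟨s, hst⟩ : ∃ s, √t = s := ⟨_, rfl⟩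
  have hts : t = s * s := by rw [← hst, Real.mul_self_sqrt ht0.le]
  rw [hst] at hs ⊢
  rw [hts]
  field_simp
  ring

theorem abs_wkbDev_le_wkbBound (h : IsNearModel p q ρ B Y Q t₀) (ht : t₀ ≤ t) {z : ℂ}
    (hz : ‖z‖ ≤ wkbRadius B Q * ρ t) : |wkbDev p B t z| ≤ wkbBound B Q * ρ t := by
  have := wkbFreq_pos h.pos_B
  have := wkbShear_pos h.pos_B
  have := wkbRadius_nonneg h.pos_B h.Q_nonneg
  have := h.nonneg ht
  calc |wkbDev p B t z| ≤ 1 / wkbFreq B * (wkbRadius B Q * ρ t) + B * ρ t :=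
        (h.abs_wkbDev_le ht z).trans (by gcongr)
    _ ≤ 1 / wkbFreq B * (wkbRadius B Q * ρ t) + B * ρ t +
          (1 + wkbShear B) * (wkbRadius B Q * ρ t) := le_add_of_nonneg_right (by positivity)
    _ = wkbBound B Q * ρ t := by rw [wkbBound]; ring

theorem abs_wkbDevDeriv_le_wkbBound (h : IsNearModel p q ρ B Y Q t₀) (ht : t₀ ≤ t) {z : ℂ}
    (hz : ‖z‖ ≤ wkbRadius B Q * ρ t) : |wkbDevDeriv B t z| ≤ wkbBound B Q * ρ t := by
  have hB := h.pos_B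
  have := wkbFreq_pos hB
  have := wkbShear_pos hB
  have := wkbRadius_nonneg hB h.Q_nonneg
  have := h.nonneg ht
  calc |wkbDevDeriv B t z| ≤ (1 + wkbShear B) * (wkbRadius B Q * ρ t) :=
        (abs_wkbDevDeriv_le hB (h.one_le ht) z).trans (by gcongr)
    _ ≤ (1 + wkbShear B) * (wkbRadius B Q * ρ t) +
          (1 / wkbFreq B * (wkbRadius B Q * ρ t) + B * ρ t) :=
        le_add_of_nonneg_right (by positivity)
    _ = wkbBound B Q * ρ t := by rw [wkbBound]; ring

theorem eventually_wkb_small (h : IsNearModel p q ρ B Y Q t₀)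
    (hlim : Tendsto (fun t => √t * ρ t) atTop (𝓝 0)) :
    ∃ t₁, t₀ ≤ t₁ ∧ ∀ t, t₁ ≤ t → √t * (wkbBound B Q * ρ t) ≤ 1 ∧
      wkbLip B Q * (1 / √t + √t * (wkbBound B Q * ρ t)) ≤ wkbRate B / 2 := by
  have hsmall : Tendsto (fun t => √t * (wkbBound B Q * ρ t)) atTop (𝓝 0) := by
    simpa only [mul_zero, mul_left_comm] using hlim.const_mul (wkbBound B Q)
  have hsqrt : Tendsto (fun t : ℝ => 1 / √t) atTop (𝓝 0) := by
    simpa only [one_div] using! Real.tendsto_sqrt_atTop.inv_tendsto_atTop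
  have hlip := (hsqrt.add hsmall).const_mul (wkbLip B Q)
  rw [add_zero, mul_zero] at hlip
  obtain ⟨t₁, ht₁⟩ := eventually_atTop.1 ((eventually_ge_atTop t₀).and
    ((hsmall.eventually (ge_mem_nhds one_pos)).and
      (hlip.eventually (ge_mem_nhds (half_pos (wkbRate_pos h.pos_B))))))
  exact ⟨t₁, (ht₁ t₁ le_rfl).1, fun t ht => (ht₁ t ht).2⟩

/-- The linearised equation oscillates with amplitude growing like `t ^ wkbRate B`, so exactly one
solution decays; this is the fixed point supplied by `exists_decaying_solution`. -/
theorem exists_perturbed_solution (h : IsNearModel p q ρ B Y Q t₀)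
    (hlim : Tendsto (fun t => √t * ρ t) atTop (𝓝 0)) :
    ∃ (M t₁ : ℝ) (φ ψ : ℝ → ℝ), t₀ ≤ t₁ ∧ 0 ≤ M ∧ ∀ t, t₁ < t →
      HasDerivAt φ (ψ t) t ∧ HasDerivAt ψ (accel p B t (φ t) (ψ t)) t ∧
        |φ t| ≤ M * ρ t ∧ |ψ t| ≤ M * ρ t ∧ M * ρ t ≤ 1 := by
  have hB := h.pos_B
  have hδ := wkbRate_pos hB
  have hK := wkbRadius_nonneg hB h.Q_nonneg
  have hBM := le_wkbBound hB h.Q_nonneg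
  obtain ⟨t₁, ht₀₁, hsmall⟩ := h.eventually_wkb_small hlim
  have hge : ∀ {t}, t₁ ≤ t → t₀ ≤ t := fun ht => ht₀₁.trans ht
  have hBρ : ∀ {t}, t₁ ≤ t → B * ρ t ≤ wkbBound B Q * ρ t := fun ht =>
    mul_le_mul_of_nonneg_right hBM (h.nonneg (hge ht))
  have hη : ∀ {t}, t₁ ≤ t → wkbBound B Q * ρ t ≤ 1 := fun ht =>
    (le_mul_of_one_le_left (mul_nonneg (hB.le.trans hBM) (h.nonneg (hge ht)))
      (Real.one_le_sqrt.2 (h.one_le (hge ht)))).trans (hsmall _ ht).1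
  obtain ⟨Z, hZ, hZ'⟩ := exists_decaying_solution (r := fun t => wkbRadius B Q * ρ t)
    (e := wkbError p q B) hδ (h.pos ht₀₁)
    (fun t ht => hasDerivAt_wkbPhase B (h.pos (hge ht)))
    (fun s hs t ht hst => mul_le_mul_of_nonneg_left
      (h.antitoneOn (hge hs) (hge ht) hst) hK)
    (fun t ht => mul_nonneg hK (h.nonneg (hge ht)))
    (fun Z hZ t ht => (h.continuousAt_wkbError (hge ht) hZ.1
      ((h.abs_wkbDev_le_wkbBound (hge ht) (hZ.2 t ht)).trans (hη ht))).continuousWithinAt)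
    (fun t ht z w hz hw => by
      refine (h.norm_wkbError_sub_le (hge ht) (hη ht)
        ((le_mul_of_one_le_left (h.nonneg (hge ht)) h.one_le_B).trans (hBρ ht))
        (h.abs_wkbDev_le_wkbBound (hge ht) hz) (h.abs_wkbDev_le_wkbBound (hge ht) hw)
        (h.abs_wkbDevDeriv_le_wkbBound (hge ht) hz)
        (h.abs_wkbDevDeriv_le_wkbBound (hge ht) hw)).trans ?_
      have := h.pos (hge ht)
      gcongr
      exact (hsmall t ht).2)
    (fun t ht => (h.norm_wkbError_zero_le (hge ht) (hη ht) (hsmall t ht).1 (hBρ ht)).trans_eq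
      (by rw [wkbRadius]; field_simp))
  have hosc : ∀ t, t₁ < t → HasDerivAt Z ((Complex.I * (-(wkbFreq B / √t) : ℝ) +
      (wkbRate B / t : ℝ)) • Z t + wkbError p q B t (Z t)) t := fun t ht => by
    simpa only [Complex.ofReal_div] using hZ' t ht
  exact ⟨wkbBound B Q, t₁, fun t => wkbDev p B t (Z t), fun t => wkbDevDeriv B t (Z t), ht₀₁,
    hB.le.trans hBM, fun t ht => ⟨h.hasDerivAt_wkbDev (hge ht.le) (hosc t ht),
      h.hasDerivAt_wkbDevDeriv (hge ht.le) (hosc t ht),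
      h.abs_wkbDev_le_wkbBound (hge ht.le) (hZ.2 t ht.le),
      h.abs_wkbDevDeriv_le_wkbBound (hge ht.le) (hZ.2 t ht.le), hη ht.le⟩⟩

end IsNearModel

end PerturbedSolution

section Amplitude

theorem antitoneOn_Ici_of_hasDerivAt_nonpos {g g' : ℝ → ℝ} {a : ℝ}
    (hg : ∀ x, a ≤ x → HasDerivAt g (g' x) x) (hg' : ∀ x, a ≤ x → g' x ≤ 0) :
    AntitoneOn g (Ici a) :=
  antitoneOn_of_hasDerivWithinAt_nonpos (convex_Ici a)
    (fun x hx => (hg x hx).continuousAt.continuousWithinAt)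
    (fun x hx => (hg x (interior_subset hx)).hasDerivWithinAt)
    (fun x hx => hg' x (interior_subset hx))

variable {f : ℝ → ℝ} {B : ℝ}

/-- The product `f F` as a function of `y = -log F`. -/
noncomputable def amplitude (f : ℝ → ℝ) (y : ℝ) : ℝ := f (logInv f y) * Real.exp (-y)

theorem Admissible.amplitude_pos (hf : Admissible f) {y : ℝ} (hy : logInvBound f < y) :
    0 < amplitude f y :=
  mul_pos (hf.pos _ (hf.logInv_pos hy)) (Real.exp_pos _)

theorem Admissible.hasDerivAt_amplitude (hf : Admissible f) {y : ℝ} (hy : logInvBound f < y) :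
    HasDerivAt (amplitude f) ((growth f y - 1) * amplitude f y) y := by
  refine ((hf.hasDerivAt_comp_logInv hy).mul (hasDerivAt_exp_neg y)).congr_deriv ?_
  rw [growth, amplitude]
  ring

theorem Admissible.eventually_growth_le (hf : Admissible f) (hf1 : CondF1 f) (hf2 : CondF2 f B) :
    ∀ᶠ y in atTop, growth f y ≤ 1 - B⁻¹ / 2 / y := by
  obtain ⟨s₀, -, hs₀, -⟩ := hf1
  have hB : 0 < B⁻¹ := inv_pos.2 (one_pos.trans_le hf2.2.2)
  obtain ⟨y₁, hy₁⟩ := eventually_atTop.1 ((eventually_gt_atTop (0 : ℝ)).and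
    ((eventually_gt_atTop (logInvBound f)).and ((hf.tendsto_logInv.eventually_gt_atTop s₀).and
      ((hf.tendsto_sq_mul_growthDeriv hf2).eventually (lt_mem_nhds (half_lt_self hB))))))
  have hanti : AntitoneOn (fun y => -(growth f y + B⁻¹ / 2 * y⁻¹)) (Ici y₁) := by
    refine antitoneOn_Ici_of_hasDerivAt_nonpos
      (g' := fun y => -(growthDeriv f y + B⁻¹ / 2 * -(y ^ 2)⁻¹)) (fun y hy => ?_) fun y hy => ?_
    all_goals obtain ⟨hy0, hyb, hys, hgrow⟩ := hy₁ y hy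
    · exact ((hf.hasDerivAt_growth hs₀ hyb hys).add
        ((hasDerivAt_inv hy0.ne').const_mul (B⁻¹ / 2))).neg
    · rw [neg_nonpos, mul_neg, ← sub_eq_add_neg, sub_nonneg, ← div_eq_mul_inv,
        div_le_iff₀ (by positivity), mul_comm]
      exact hgrow.le
  have hlim : Tendsto (fun y => -(growth f y + B⁻¹ / 2 * y⁻¹)) atTop (𝓝 (-1)) := by
    simpa only [mul_zero, add_zero] using
      ((hf.tendsto_growth hf2).add (tendsto_inv_atTop_zero.const_mul (B⁻¹ / 2))).neg
  filter_upwards [eventually_ge_atTop y₁] with y hy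
  have hle : -1 ≤ -(growth f y + B⁻¹ / 2 * y⁻¹) := le_of_tendsto hlim <| by
    filter_upwards [eventually_ge_atTop y] with z hz using hanti hy (hy.trans hz) hz
  rw [div_eq_mul_inv _ y]
  linarith

theorem Admissible.antitoneOn_amplitude_mul_rpow (hf : Admissible f) {c a : ℝ} (ha : 0 < a)
    (hab : logInvBound f < a) (hg : ∀ y, a ≤ y → growth f y ≤ 1 - c / y) :
    AntitoneOn (fun y => amplitude f y * y ^ c) (Ici a) := by
  refine antitoneOn_Ici_of_hasDerivAt_nonpos
    (g' := fun y => (growth f y - 1 + c / y) * (amplitude f y * y ^ c)) (fun y hy => ?_)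
    fun y hy => ?_
  · have hy0 := ha.trans_le hy
    refine ((hf.hasDerivAt_amplitude (hab.trans_le hy)).mul
      (Real.hasDerivAt_rpow_const (p := c) (Or.inl hy0.ne'))).congr_deriv ?_
    rw [Real.rpow_sub_one hy0.ne']
    ring
  · exact mul_nonpos_of_nonpos_of_nonneg (by linarith [hg y hy])
      (mul_nonneg (hf.amplitude_pos (hab.trans_le hy)).le
        (Real.rpow_nonneg (ha.le.trans hy) c))

theorem Admissible.tendsto_amplitude (hf : Admissible f) (hf1 : CondF1 f) (hf2 : CondF2 f B) :
    Tendsto (amplitude f) atTop (𝓝 0) := by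
  have hc : 0 < B⁻¹ / 2 := half_pos (inv_pos.2 (one_pos.trans_le hf2.2.2))
  obtain ⟨a, ha⟩ := eventually_atTop.1 ((eventually_gt_atTop (0 : ℝ)).and
    ((eventually_gt_atTop (logInvBound f)).and (hf.eventually_growth_le hf1 hf2)))
  have hanti := hf.antitoneOn_amplitude_mul_rpow (ha a le_rfl).1 (ha a le_rfl).2.1
    fun y hy => (ha y hy).2.2
  have hlim := (tendsto_rpow_neg_atTop hc).const_mul (amplitude f a * a ^ (B⁻¹ / 2))
  rw [mul_zero] at hlim
  refine squeeze_zero' ?_ ?_ hlim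
  · filter_upwards [eventually_ge_atTop a] with y hy using (hf.amplitude_pos (ha y hy).2.1).le
  · filter_upwards [eventually_ge_atTop a] with y hy
    have hy0 := (ha y hy).1
    rw [Real.rpow_neg hy0.le, ← div_eq_mul_inv, le_div_iff₀ (Real.rpow_pos_of_pos hy0 _)]
    exact hanti self_mem_Ici hy hy

theorem Admissible.amplitude_le_exp_mul (hf : Admissible f) {a y z : ℝ} (ha : logInvBound f < a)
    (hg : ∀ y, a ≤ y → growth f y ≤ 2) (hy : a ≤ y) (hz : a ≤ z) :
    amplitude f z ≤ Real.exp |z - y| * amplitude f y := by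
  rcases le_total z y with hzy | hyz
  · have hmono : f (logInv f z) ≤ f (logInv f y) :=
      hf.monotoneOn (hf.logInv_pos (ha.trans_le hz)).le (hf.logInv_pos (ha.trans_le hy)).le
        (hf.strictMonoOn_logInv.monotoneOn (ha.trans_le hz) (ha.trans_le hy) hzy)
    rw [abs_of_nonpos (sub_nonpos.2 hzy), neg_sub, amplitude, amplitude, mul_left_comm,
      ← Real.exp_add, sub_add_eq_add_sub, add_neg_cancel, zero_sub]
    gcongr
  · have hanti : AntitoneOn (fun z => amplitude f z * Real.exp (-z)) (Ici a) := by
      refine antitoneOn_Ici_of_hasDerivAt_nonpos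
        (g' := fun z => (growth f z - 2) * (amplitude f z * Real.exp (-z))) (fun z hz => ?_)
        fun z hz => mul_nonpos_of_nonpos_of_nonneg (sub_nonpos.2 (hg z hz))
          (mul_pos (hf.amplitude_pos (ha.trans_le hz)) (Real.exp_pos _)).le
      refine ((hf.hasDerivAt_amplitude (ha.trans_le hz)).mul (hasDerivAt_exp_neg z)).congr_deriv ?_
      ring
    have := hanti hy hz hyz
    calc amplitude f z = amplitude f z * Real.exp (-z) * Real.exp z := by
          rw [mul_assoc, ← Real.exp_add, neg_add_cancel, Real.exp_zero, mul_one]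
      _ ≤ amplitude f y * Real.exp (-y) * Real.exp z := by gcongr
      _ = Real.exp |z - y| * amplitude f y := by
          rw [abs_of_nonneg (sub_nonneg.2 hyz), mul_assoc, ← Real.exp_add, mul_comm,
            neg_add_eq_sub]

theorem Admissible.abs_logInv_sub_le (hf : Admissible f) {a y : ℝ} (ha : logInvBound f < a)
    (hg : ∀ z, a ≤ z → growth f z ≤ 2) (hy : a + 1 ≤ y) {φ : ℝ} (hφ : |φ| ≤ 1) :
    |logInv f (y + φ) - logInv f y| ≤ Real.exp 1 * amplitude f y * |φ| := by
  have hay : a ≤ y := by linarith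
  have hmem : ∀ z ∈ Icc (y - 1) (y + 1), a ≤ z := fun z hz => by linarith [hz.1]
  have hbound : ∀ z ∈ Icc (y - 1) (y + 1), ‖amplitude f z‖ ≤ Real.exp 1 * amplitude f y := by
    intro z hz
    have hzy : |z - y| ≤ 1 := abs_sub_le_iff.2 ⟨by linarith [hz.2], by linarith [hz.1]⟩
    rw [Real.norm_of_nonneg (hf.amplitude_pos (ha.trans_le (hmem z hz))).le]
    refine (hf.amplitude_le_exp_mul ha hg hay (hmem z hz)).trans ?_
    gcongr
    exact (hf.amplitude_pos (ha.trans_le hay)).le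
  have hφ' := abs_le.1 hφ
  have hsub := (convex_Icc (y - 1) (y + 1)).norm_image_sub_le_of_norm_hasDerivWithin_le
    (fun z hz => (hf.hasDerivAt_logInv (ha.trans_le (hmem z hz))).hasDerivWithinAt) hbound
    (show y ∈ Icc (y - 1) (y + 1) by constructor <;> linarith)
    (show y + φ ∈ Icc (y - 1) (y + 1) by constructor <;> linarith)
  rwa [add_sub_cancel_left] at hsub

end Amplitude

section Remainder

variable {f : ℝ → ℝ} {B : ℝ}

/-- The values of `R₁ + R₂` on the punctured disc of radius `e^{-t/2}`. -/
def remValues (f : ℝ → ℝ) (B t : ℝ) : Set ℝ :=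
  (fun y => R₁ f B y + R₂ f B y) '' {y : Plane | 0 < ‖y‖ ∧ ‖y‖ ≤ Real.exp (-t / 2)}

/-- The supremum of `R₁ + R₂` over the punctured disc of radius `e^{-t/2}`, with the junk value `0`
if it is infinite. -/
noncomputable def supRem (f : ℝ → ℝ) (B t : ℝ) : ℝ := sSup (remValues f B t)

theorem exists_norm_eq_exp (t : ℝ) : ∃ x : Plane, ‖x‖ = Real.exp (-t / 2) :=
  ⟨EuclideanSpace.single 0 (Real.exp (-t / 2)), by
    rw [PiLp.norm_single, Real.norm_of_nonneg (Real.exp_pos _).le]⟩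

theorem R₁_add_R₂_nonneg (f : ℝ → ℝ) (B : ℝ) (x : Plane) : 0 ≤ R₁ f B x + R₂ f B x :=
  add_nonneg (abs_nonneg _) (abs_nonneg _)

theorem supRem_nonneg (f : ℝ → ℝ) (B t : ℝ) : 0 ≤ supRem f B t := by
  refine Real.sSup_nonneg ?_
  rintro _ ⟨x, -, rfl⟩
  exact R₁_add_R₂_nonneg f B x

theorem logRad_of_norm_eq {x : Plane} {t : ℝ} (hx : ‖x‖ = Real.exp (-t / 2)) :
    logRad x = t := by
  rw [logRad_eq, hx, Real.log_exp]
  ring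

theorem norm_eq_exp_logRad {x : Plane} (hx : 0 < ‖x‖) : ‖x‖ = Real.exp (-logRad x / 2) := by
  rw [logRad_eq, neg_mul, neg_neg, mul_div_cancel_left₀ _ two_ne_zero, Real.exp_log hx]

theorem le_logRad {x : Plane} {t : ℝ} (hx : 0 < ‖x‖) (hxt : ‖x‖ ≤ Real.exp (-t / 2)) :
    t ≤ logRad x := by
  have := Real.log_le_log hx hxt
  rw [Real.log_exp] at this
  rw [logRad_eq]
  linarith

theorem remValues_nonempty (f : ℝ → ℝ) (B t : ℝ) : (remValues f B t).Nonempty := by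
  obtain ⟨x, hx⟩ := exists_norm_eq_exp t
  exact ⟨_, x, ⟨hx ▸ Real.exp_pos _, hx.le⟩, rfl⟩

theorem CondR.exists_bound (hR : CondR f B) {ε : ℝ} (hε : 0 < ε) :
    ∃ T : ℝ, 0 < T ∧ ∀ t, T ≤ t → ∀ c ∈ remValues f B t, c ≤ ε / √t := by
  have hev := hR.eventually (gt_mem_nhds (half_pos hε))
  rw [eventually_nhdsWithin_iff, Metric.eventually_nhds_iff] at hev
  obtain ⟨r, hr, hsmall⟩ := hev
  refine ⟨max 1 (-2 * Real.log r + 1), by positivity, ?_⟩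
  rintro t hT _ ⟨x, ⟨hx, hxt⟩, rfl⟩
  have ht1 : 1 ≤ t := (le_max_left _ _).trans hT
  have htx := le_logRad hx hxt
  have hxr : ‖x‖ < r := by
    have := (le_max_right _ _).trans (hT.trans htx)
    rw [logRad_eq] at this
    exact (Real.log_lt_log_iff hx hr).1 (by linarith)
  have hsqrt : √t / 2 ≤ √(-Real.log ‖x‖) := by
    rw [← Real.sqrt_sq (zero_le_two (α := ℝ)), ← Real.sqrt_div (by linarith)]
    refine Real.sqrt_le_sqrt ?_
    rw [logRad_eq] at htx
    linarith
  have hx' := hsmall (y := x) (by simpa only [dist_zero_right] using hxr) (norm_pos_iff.1 hx)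
  have hmul := mul_le_mul_of_nonneg_right hsqrt (R₁_add_R₂_nonneg f B x)
  rw [le_div_iff₀ (Real.sqrt_pos.2 (by linarith))]
  linarith

theorem CondR.exists_bddAbove (hR : CondR f B) :
    ∃ T : ℝ, ∀ t, T ≤ t → BddAbove (remValues f B t) := by
  obtain ⟨T, -, hbound⟩ := hR.exists_bound one_pos
  exact ⟨T, fun t ht => ⟨_, hbound t ht⟩⟩

theorem CondR.tendsto_supRem (hR : CondR f B) :
    Tendsto (fun t => √t * supRem f B t) atTop (𝓝 0) := by
  rw [Metric.tendsto_atTop]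
  intro ε hε
  obtain ⟨T, hT, hbound⟩ := hR.exists_bound (half_pos hε)
  refine ⟨T, fun t ht => ?_⟩
  have hst := Real.sqrt_pos.2 (hT.trans_le ht)
  rw [Real.dist_eq, sub_zero, abs_of_nonneg (mul_nonneg hst.le (supRem_nonneg f B t))]
  calc √t * supRem f B t ≤ √t * (ε / 2 / √t) := by
        gcongr
        exact csSup_le (remValues_nonempty f B t) (hbound t ht)
    _ = ε / 2 := by field_simp
    _ < ε := half_lt_self hε

theorem CondR.exists_antitoneOn (hR : CondR f B) : ∃ T : ℝ,
    AntitoneOn (supRem f B) (Ici T) ∧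
      ∀ x : Plane, 0 < ‖x‖ → T ≤ logRad x → R₁ f B x + R₂ f B x ≤ supRem f B (logRad x) := by
  obtain ⟨T, hT⟩ := hR.exists_bddAbove
  refine ⟨T, fun s hs t _ hst => ?_, fun x hx hxT =>
    le_csSup (hT _ hxT) ⟨x, ⟨hx, (norm_eq_exp_logRad hx).le⟩, rfl⟩⟩
  refine csSup_le_csSup (hT s hs) (remValues_nonempty f B t) (image_mono fun x hx => ?_)
  exact ⟨hx.1, hx.2.trans (Real.exp_le_exp.2 (by linarith))⟩

end Remainder

section NearOrigin

variable {f : ℝ → ℝ} {B : ℝ}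

theorem modelP_ne_zero (hB : 1 ≤ B) {t : ℝ} (ht : 2 < t) : modelP B t ≠ 0 := by
  have hB' : 1 / B ≤ 1 := (div_le_one (one_pos.trans_le hB)).2 hB
  have hlt : (1 + 1 / B) / t < 1 := (div_lt_one (by linarith)).2 (by linarith)
  have hpos : 0 < 1 + 1 / t := by positivity
  exact (mul_pos hpos (by linarith)).ne'

theorem Admissible.hasDerivAt_logInv_add (hf : Admissible f) {φ ψ : ℝ → ℝ} {t : ℝ} (ht : 0 < t)
    (hφ : HasDerivAt φ (ψ t) t) (hy : logInvBound f < modelY B t + φ t) :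
    HasDerivAt (fun t => logInv f (modelY B t + φ t))
      (amplitude f (modelY B t + φ t) * (t / (t + 1) + ψ t)) t :=
  HasDerivAt.comp (h₂ := logInv f) (h := fun t => modelY B t + φ t) t (hf.hasDerivAt_logInv hy)
    ((hasDerivAt_modelY B ht).add hφ)

theorem exp_neg_div_four_eq (hB : 0 < B) {t : ℝ} (ht : 0 < t) (φ : ℝ) :
    Real.exp (-t) / 4 =
      Real.exp (-(modelY B t + φ)) * (1 / (B * (t + 1)) * Real.exp φ) := by
  rw [Real.exp_neg (modelY B t + φ), Real.exp_add, exp_modelY hB ht, Real.exp_neg]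
  field_simp

theorem modelY_equation (hB : 0 < B) {t : ℝ} (ht : 0 < t) :
    1 / (t + 1) ^ 2 + (modelP B t - 1) * (t / (t + 1)) ^ 2 + 1 / (B * (t + 1)) = 0 := by
  simp only [modelP]
  field_simp
  ring

theorem Admissible.hasDerivAt_amplitude_mul (hf : Admissible f) (hB : 0 < B) {φ ψ : ℝ → ℝ}
    {t : ℝ} (ht : 0 < t) (hφ : HasDerivAt φ (ψ t) t)
    (hψ : HasDerivAt ψ (accel (growth f) B t (φ t) (ψ t)) t)
    (hy : logInvBound f < modelY B t + φ t) :
    HasDerivAt (fun t => amplitude f (modelY B t + φ t) * (t / (t + 1) + ψ t))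
      (-(Real.exp (-t) / 4 * f (logInv f (modelY B t + φ t)))) t := by
  have hquot : HasDerivAt (fun t : ℝ => t / (t + 1)) (1 / (t + 1) ^ 2) t :=
    ((hasDerivAt_id t).div ((hasDerivAt_id t).add_const 1)
      (add_pos ht one_pos).ne').congr_deriv (by simp)
  refine (((hf.hasDerivAt_amplitude hy).comp t ((hasDerivAt_modelY B ht).add hφ)).mul
    (hquot.add hψ)).congr_deriv ?_
  rw [exp_neg_div_four_eq hB ht (φ t)]
  simp only [accel, amplitude, Function.comp, Pi.add_apply]
  linear_combination f (logInv f (modelY B t + φ t)) * Real.exp (-(modelY B t + φ t)) *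
    modelY_equation hB ht

theorem Admissible.half_mul_abs_defect_le (hf : Admissible f) (hB : 1 ≤ B) {x : Plane}
    (hx : 0 < logRad x) (hhalf : logRad x / 2 ≤ modelY B (logRad x))
    (hy : logInvBound f < modelY B (logRad x)) :
    logRad x / 2 * |defect (growth f) B (logRad x)| ≤ R₁ f B x := by
  rw [hf.R₁_eq hB hx ((half_pos hx).trans_le hhalf) hy, defect]
  gcongr

theorem Admissible.half_sq_mul_abs_defectDeriv_le (hf : Admissible f) (hB : 1 ≤ B) {x : Plane}
    (hx : 2 < logRad x) (hhalf : logRad x / 2 ≤ modelY B (logRad x))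
    (hy : logInvBound f < modelY B (logRad x)) :
    (logRad x / 2) ^ 2 * |defectDeriv (growthDeriv f) B (logRad x)| ≤ R₂ f B x := by
  have hx0 : 0 < logRad x := two_pos.trans hx
  rw [hf.R₂_eq hB hx0 (modelP_ne_zero hB hx) hy, defectDeriv, ← mul_one ((logRad x / 2) ^ 2)]
  gcongr
  exact (one_le_div hx0).2 (le_add_of_nonneg_right zero_le_one)

theorem Admissible.abs_defect_and_defectDeriv_le (hf : Admissible f) (hB : 1 ≤ B) {x : Plane}
    (hx : 2 < logRad x) (hhalf : logRad x / 2 ≤ modelY B (logRad x))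
    (hy : logInvBound f < modelY B (logRad x))
    (hsup : R₁ f B x + R₂ f B x ≤ supRem f B (logRad x)) :
    |defect (growth f) B (logRad x)| ≤ 4 * supRem f B (logRad x) / logRad x ∧
      |defectDeriv (growthDeriv f) B (logRad x)| ≤
        4 * supRem f B (logRad x) / logRad x ^ 2 := by
  have hx0 : 0 < logRad x := two_pos.trans hx
  have hdef := hf.half_mul_abs_defect_le hB hx0 hhalf hy
  have hder := hf.half_sq_mul_abs_defectDeriv_le hB hx hhalf hy
  have : 0 ≤ R₁ f B x := abs_nonneg _
  have : 0 ≤ R₂ f B x := abs_nonneg _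
  rw [le_div_iff₀ hx0, le_div_iff₀ (pow_pos hx0 2)]
  constructor <;> linarith

theorem Admissible.eventually_abs_growthDeriv_le (hf : Admissible f) (hf2 : CondF2 f B) :
    ∀ᶠ y in atTop, |growthDeriv f y| ≤ 2 / y ^ 2 := by
  have hB : 0 < B⁻¹ := inv_pos.2 (one_pos.trans_le hf2.2.2)
  have hB2 : |B⁻¹| < 2 := by
    rw [abs_of_pos hB]
    exact (inv_le_one_of_one_le₀ hf2.2.2).trans_lt one_lt_two
  filter_upwards [(hf.tendsto_sq_mul_growthDeriv hf2).abs.eventually (gt_mem_nhds hB2),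
    eventually_gt_atTop 0] with y hy hy0
  rw [abs_mul, abs_of_pos (pow_pos hy0 2)] at hy
  rw [le_div_iff₀ (pow_pos hy0 2), mul_comm]
  exact hy.le

theorem exists_forall_modelY_sub_one_gt (B a : ℝ) :
    ∃ t₀, ∀ t, t₀ ≤ t → a < modelY B t - 1 ∧ t / 2 < modelY B t - 1 := by
  obtain ⟨T, hT⟩ := eventually_atTop.1
    ((tendsto_modelY_sub_half B).eventually_gt_atTop (max a 0 + 1))
  refine ⟨max T 0, fun t ht => ?_⟩
  have := hT t ((le_max_left _ _).trans ht)
  have := (le_max_right T 0).trans ht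
  constructor <;> linarith [le_max_left a 0, le_max_right a 0]

theorem Admissible.exists_isNearModel (hf : Admissible f) (hf1 : CondF1 f) (hf2 : CondF2 f B)
    (hR : CondR f B) :
    ∃ Y t₀ : ℝ, logInvBound f < Y ∧ (∀ y, Y ≤ y → growth f y ≤ 2) ∧
      IsNearModel (growth f) (growthDeriv f) (fun t => 4 * supRem f B t) B Y 8 t₀ := by
  obtain ⟨s₀, -, hs₀, -⟩ := hf1
  obtain ⟨T, hTanti, hTle⟩ := hR.exists_antitoneOn
  obtain ⟨Y, hY⟩ := eventually_atTop.1 ((eventually_gt_atTop (logInvBound f)).and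
    ((hf.tendsto_logInv.eventually_gt_atTop s₀).and
      ((hf.eventually_abs_growthDeriv_le hf2).and
        ((hf.tendsto_growth hf2).eventually (gt_mem_nhds one_lt_two)))))
  choose hYb hYs hYd hYg using hY
  obtain ⟨t₂, ht₂⟩ := exists_forall_modelY_sub_one_gt B Y
  obtain ⟨t₀, ht₀⟩ := eventually_atTop.1
    ((eventually_ge_atTop T).and ((eventually_ge_atTop t₂).and (eventually_ge_atTop 3)))
  choose htT htt₂ ht3 using ht₀
  have hdefect : ∀ t, t₀ ≤ t → |defect (growth f) B t| ≤ 4 * supRem f B t / t ∧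
      |defectDeriv (growthDeriv f) B t| ≤ 4 * supRem f B t / t ^ 2 := fun t ht => by
    obtain ⟨hYt, hty⟩ := ht₂ t (htt₂ t ht)
    have := ht3 t ht
    obtain ⟨x, hx⟩ := exists_norm_eq_exp t
    obtain rfl := logRad_of_norm_eq hx
    exact hf.abs_defect_and_defectDeriv_le hf2.2.2 (by linarith) (by linarith)
      (hYb _ (by linarith)) (hTle x (hx ▸ Real.exp_pos _) (htT _ ht))
  refine ⟨Y, t₀, hYb Y le_rfl, fun y hy => (hYg y hy).le, hf2.2.2, by linarith [ht3 _ le_rfl],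
    fun y hy => hf.hasDerivAt_growth hs₀ (hYb y hy.le) (hYs y hy.le),
    fun y hy => hf.continuousAt_growthDeriv hs₀ (hYb y hy.le) (hYs y hy.le),
    fun t ht => (ht₂ t (htt₂ t ht)).1, fun t ht y hy => ?_, fun s hs t ht hst =>
      mul_le_mul_of_nonneg_left (hTanti (htT s hs) (htT t ht) hst) four_pos.le,
    fun t ht => (hdefect t ht).1, fun t ht => (hdefect t ht).2⟩
  obtain ⟨hYt, hty⟩ := ht₂ t (htt₂ t ht)
  have := ht3 t ht
  calc |growthDeriv f y| ≤ 2 / y ^ 2 := hYd y (by linarith)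
    _ ≤ 2 / (t / 2) ^ 2 := by gcongr; linarith
    _ = 8 / t ^ 2 := by field_simp; norm_num

/-- A positive solution, singular at the origin, in the variable `t = log (1 / |x|²)`, where `Δ`
becomes `4 eᵗ ∂ₜ²`; it lives on `t > τ`, that is, on `0 < |x| < e^(-τ/2)`. -/
structure IsProfile (f : ℝ → ℝ) (τ : ℝ) (V V' : ℝ → ℝ) : Prop where
  hasDerivAt : ∀ t, τ < t → HasDerivAt V (V' t) t
  hasDerivAt' : ∀ t, τ < t → HasDerivAt V' (-(Real.exp (-t) / 4 * f (V t))) t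
  pos : ∀ t, τ < t → 0 < V t
  tendsto : Tendsto V atTop atTop
  tendsto' : Tendsto V' atTop (𝓝 0)

theorem Admissible.exists_isProfile_near_uTilde (hf : Admissible f) (hf1 : CondF1 f)
    (hf2 : CondF2 f B) (hR : CondR f B) :
    ∃ (C t₁ : ℝ) (U U' : ℝ → ℝ), IsProfile f t₁ U U' ∧
      ∀ x : Plane, 0 < ‖x‖ → t₁ < logRad x → |U (logRad x) - uTilde f B x| ≤
        C * (f (uTilde f B x) * tailInt f (uTilde f B x) * supRem f B (logRad x)) := by
  obtain ⟨Y, t₀, hYb, hYg, hnear⟩ := hf.exists_isNearModel hf1 hf2 hR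
  have hlim : Tendsto (fun t => √t * (4 * supRem f B t)) atTop (𝓝 0) := by
    simpa only [mul_left_comm, mul_zero] using hR.tendsto_supRem.const_mul 4
  obtain ⟨M, t₁, φ, ψ, ht₀₁, _, hsol⟩ := hnear.exists_perturbed_solution hlim
  choose hφ hψ hφM hψM hM1 using hsol
  have hφ1 : ∀ t, t₁ < t → |φ t| ≤ 1 := fun t ht => (hφM t ht).trans (hM1 t ht)
  have ht0 : ∀ t, t₁ < t → 0 < t := fun t ht => hnear.pos (ht₀₁.trans ht.le)
  have hYt : ∀ t, t₁ < t → Y < modelY B t - 1 := fun t ht => hnear.lt_modelY t (ht₀₁.trans ht.le)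
  have hyb : ∀ t, t₁ < t → logInvBound f < modelY B t + φ t := fun t ht => by
    linarith [hYt t ht, (abs_le.1 (hφ1 t ht)).1]
  have hytop : Tendsto (fun t => modelY B t + φ t) atTop atTop := by
    refine tendsto_atTop_mono' atTop (f₁ := fun t => modelY B t + -1) ?_
      (tendsto_atTop_add_const_right _ _ (tendsto_modelY B))
    filter_upwards [eventually_gt_atTop t₁] with t ht
    linarith [(abs_le.1 (hφ1 t ht)).1]
  refine ⟨Real.exp 1 * M * 4, t₁, fun t => logInv f (modelY B t + φ t),
    fun t => amplitude f (modelY B t + φ t) * (t / (t + 1) + ψ t),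
    ⟨fun t ht => hf.hasDerivAt_logInv_add (ht0 t ht) (hφ t ht) (hyb t ht),
    fun t ht => hf.hasDerivAt_amplitude_mul hnear.pos_B (ht0 t ht) (hφ t ht) (hψ t ht) (hyb t ht),
    fun t ht => hf.logInv_pos (hyb t ht), hf.tendsto_logInv.comp hytop,
    ((hf.tendsto_amplitude hf1 hf2).comp hytop).zero_mul_isBoundedUnder_le
      (isBoundedUnder_of_eventually_le (a := 2) ?_)⟩, fun x _ hxt => ?_⟩
  · filter_upwards [eventually_gt_atTop t₁] with t ht
    have := ht0 t ht
    have hle : |t / (t + 1)| ≤ 1 := by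
      rw [abs_of_nonneg (by positivity), div_le_one (by positivity)]
      linarith
    calc ‖t / (t + 1) + ψ t‖ ≤ |t / (t + 1)| + |ψ t| := abs_add_le _ _
      _ ≤ 2 := by linarith [hψM t ht, hM1 t ht]
  · have hyx := hYt _ hxt
    have hyb' : logInvBound f < modelY B (logRad x) := by linarith
    rw [uTilde_eq hf2.2.2 (ht0 _ hxt), hf.tailInt_logInv hyb']
    refine (hf.abs_logInv_sub_le hYb hYg (by linarith) (hφ1 _ hxt)).trans ?_
    have := hf.amplitude_pos hyb'
    calc _ ≤ Real.exp 1 * amplitude f (modelY B (logRad x)) *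
          (M * (4 * supRem f B (logRad x))) := by gcongr; exact hφM _ hxt
      _ = _ := by rw [amplitude]; ring

end NearOrigin

section Continuation

open scoped NNReal

theorem exists_forall_hasDerivWithinAt_of_norm_le {E : Type*} [NormedAddCommGroup E]
    [NormedSpace ℝ E] [CompleteSpace E] {v : ℝ → E → E} {a b : ℝ} (hab : a ≤ b) {K L : ℝ≥0}
    (hlip : ∀ t ∈ Icc a b, LipschitzWith K (v t))
    (hcont : ∀ z, ContinuousOn (fun t => v t z) (Icc a b))
    (hnorm : ∀ t ∈ Icc a b, ∀ z, ‖v t z‖ ≤ L) (z₀ : E) :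
    ∃ α : ℝ → E, α b = z₀ ∧ ∀ t ∈ Icc a b, HasDerivWithinAt α (v t (α t)) (Icc a b) t := by
  have hv : IsPicardLindelof v ⟨b, right_mem_Icc.2 hab⟩ z₀ (L * (b - a).toNNReal) 0 L K :=
    ⟨fun t ht => (hlip t ht).lipschitzOnWith, fun z _ => hcont z, fun t ht z _ => hnorm t ht z,
      by simp [hab]⟩
  exact hv.exists_eq_forall_mem_Icc_hasDerivWithinAt₀

theorem mul_sub_le_sub_of_hasDerivWithinAt {x y : ℝ → ℝ} {a b w : ℝ}
    (hx : ∀ t ∈ Icc a b, HasDerivWithinAt x (y t) (Icc a b) t) (hw : ∀ t ∈ Icc a b, w ≤ y t)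
    {s t : ℝ} (hs : s ∈ Icc a b) (ht : t ∈ Icc a b) (hst : s ≤ t) :
    w * (t - s) ≤ x t - x s := by
  have hsub : ∀ t ∈ Icc a b, HasDerivWithinAt (fun t => x t - w * t) (y t - w) (Icc a b) t :=
    fun t ht => ((hx t ht).sub ((hasDerivWithinAt_id t _).const_mul w)).congr_deriv (by simp)
  have hmono : MonotoneOn (fun t => x t - w * t) (Icc a b) :=
    monotoneOn_of_hasDerivWithinAt_nonneg (convex_Icc a b)
      (fun t ht => (hsub t ht).continuousWithinAt)
      (fun t ht => (hsub t (interior_subset ht)).mono interior_subset)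
      fun t ht => sub_nonneg.2 (hw t (interior_subset ht))
  linarith [hmono hs ht hst]

section SecondOrder

variable {c h : ℝ → ℝ} {a b c₀ m : ℝ} {K : ℝ≥0}

theorem exists_clamped_solution (hab : a ≤ b) (hc : ContinuousOn c (Icc a b))
    (hc₀ : ∀ t ∈ Icc a b, c t ∈ Icc 0 c₀) (hh : LipschitzWith K h) (hm : ∀ s, h s ∈ Icc 0 m)
    (u : ℝ) {w W : ℝ} (hW : w ≤ W) :
    ∃ x y : ℝ → ℝ, x b = u ∧ y b = w ∧ ∀ t ∈ Icc a b,
      HasDerivWithinAt x (projIcc w W hW (y t)) (Icc a b) t ∧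
      HasDerivWithinAt y (-(c t * h (x t))) (Icc a b) t := by
  let v : ℝ → ℝ × ℝ → ℝ × ℝ := fun t z => (projIcc w W hW z.2, -(c t * h z.1))
  have hlip : ∀ t ∈ Icc a b, LipschitzWith (max (1 * (1 * 1)) (c₀.toNNReal * (K * 1))) (v t) :=
    fun t ht => ((LipschitzWith.subtype_val _).comp
      ((LipschitzWith.projIcc hW).comp LipschitzWith.prod_snd)).prodMk
        (((lipschitzWith_smul (c t)).weaken (by
          rw [← NNReal.coe_le_coe, coe_nnnorm, Real.norm_of_nonneg (hc₀ t ht).1]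
          exact (hc₀ t ht).2.trans (Real.le_coe_toNNReal c₀))).comp
            (hh.comp LipschitzWith.prod_fst)).neg
  have hnorm : ∀ t ∈ Icc a b, ∀ z, ‖v t z‖ ≤ (max (max |w| |W|) (c₀ * m)).toNNReal :=
    fun t ht z => by
      refine le_trans (max_le_max ?_ ?_) (Real.le_coe_toNNReal _)
      · exact abs_le_max_abs_abs (projIcc w W hW z.2).2.1 (projIcc w W hW z.2).2.2
      · rw [norm_neg, Real.norm_of_nonneg (mul_nonneg (hc₀ t ht).1 (hm _).1)]
        exact mul_le_mul (hc₀ t ht).2 (hm _).2 (hm _).1 ((hc₀ t ht).1.trans (hc₀ t ht).2)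
  obtain ⟨α, hα₀, hα⟩ := exists_forall_hasDerivWithinAt_of_norm_le hab hlip
    (fun z => continuousOn_const.prodMk (hc.mul continuousOn_const).neg) hnorm (u, w)
  exact ⟨fun t => (α t).1, fun t => (α t).2, congrArg Prod.fst hα₀, congrArg Prod.snd hα₀,
    fun t ht => ⟨(ContinuousLinearMap.fst ℝ ℝ ℝ).hasFDerivAt.comp_hasDerivWithinAt t (hα t ht),
      (ContinuousLinearMap.snd ℝ ℝ ℝ).hasFDerivAt.comp_hasDerivWithinAt t (hα t ht)⟩⟩

theorem exists_concave_solution (hab : a ≤ b) (hc : ContinuousOn c (Icc a b))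
    (hc₀ : ∀ t ∈ Icc a b, c t ∈ Icc 0 c₀) (hh : LipschitzWith K h) (hm : ∀ s, h s ∈ Icc 0 m)
    (u w : ℝ) :
    ∃ x y : ℝ → ℝ, x b = u ∧ y b = w ∧ ∀ t ∈ Icc a b, w ≤ y t ∧
      HasDerivWithinAt x (y t) (Icc a b) t ∧
      HasDerivWithinAt y (-(c t * h (x t))) (Icc a b) t := by
  have hb : b ∈ Icc a b := right_mem_Icc.2 hab
  have hc₀0 : 0 ≤ c₀ := (hc₀ b hb).1.trans (hc₀ b hb).2
  have hcm : 0 ≤ c₀ * m := mul_nonneg hc₀0 ((hm 0).1.trans (hm 0).2)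
  have hW : w ≤ w + c₀ * m * (b - a) :=
    le_add_of_nonneg_right (mul_nonneg hcm (sub_nonneg.2 hab))
  -- The equation itself keeps `y` in `[w, w + c₀ m (b - a)]`, so clamping it there is harmless.
  obtain ⟨x, y, hx₀, rfl, hxy⟩ := exists_clamped_solution hab hc hc₀ hh hm u hW
  have hrange : ∀ t ∈ Icc a b, y t ∈ Icc (y b) (y b + c₀ * m * (b - a)) := fun t ht => by
    have hlow := mul_sub_le_sub_of_hasDerivWithinAt (x := -y) (w := 0)
      (fun t ht => (hxy t ht).2.neg)
      (fun t ht => by simpa only [neg_neg] using mul_nonneg (hc₀ t ht).1 (hm (x t)).1) ht hb ht.2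
    have hupp := mul_sub_le_sub_of_hasDerivWithinAt (w := -(c₀ * m)) (fun t ht => (hxy t ht).2)
      (fun t ht => neg_le_neg (mul_le_mul (hc₀ t ht).2 (hm _).2 (hm _).1 hc₀0)) ht hb ht.2
    have := mul_le_mul_of_nonneg_left ht.1 hcm
    simp only [Pi.neg_apply] at hlow
    constructor <;> linarith
  refine ⟨x, y, hx₀, rfl, fun t ht => ⟨(hrange t ht).1, ?_, (hxy t ht).2⟩⟩
  simpa only [projIcc_of_mem hW (hrange t ht)] using (hxy t ht).1

end SecondOrder

theorem hasDerivAt_ite_le {x y x' y' : ℝ → ℝ} {a c : ℝ}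
    (hx : ∀ t ∈ Ioc a c, HasDerivWithinAt x (x' t) (Iic c) t)
    (hy : ∀ t, c ≤ t → HasDerivAt y (y' t) t) (hxy : x c = y c) (hxy' : x' c = y' c) {t : ℝ}
    (ht : a < t) :
    HasDerivAt (fun t => if t ≤ c then x t else y t) (if t ≤ c then x' t else y' t) t := by
  rcases lt_trichotomy t c with htc | rfl | htc
  · rw [if_pos htc.le]
    refine ((hx t ⟨ht, htc.le⟩).hasDerivAt (Iic_mem_nhds htc)).congr_of_eventuallyEq ?_
    filter_upwards [gt_mem_nhds htc] with s hs using if_pos (le_of_lt hs)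
  · rw [if_pos le_rfl, ← hasDerivWithinAt_univ, ← Iic_union_Ici (a := t)]
    refine ((hx t ⟨ht, le_rfl⟩).congr (fun s hs => if_pos (mem_Iic.1 hs)) ?_).union
      (hxy' ▸ (hy t le_rfl).hasDerivWithinAt.congr (fun s hs => ?_) ?_)
    · rw [if_pos le_rfl]
    · rcases eq_or_lt_of_le (mem_Ici.1 hs) with rfl | hs
      · rw [if_pos le_rfl, hxy]
      · rw [if_neg (not_le.2 hs)]
    · rw [if_pos le_rfl, hxy]
  · rw [if_neg (not_le.2 htc)]
    refine (hy t htc.le).congr_of_eventuallyEq ?_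
    filter_upwards [lt_mem_nhds htc] with s hs using if_neg (not_le.2 hs)

variable {f U U' : ℝ → ℝ} {t₁ : ℝ}

theorem IsProfile.antitoneOn_deriv (h : IsProfile f t₁ U U') (hf : Admissible f) {t : ℝ}
    (ht : t₁ < t) : AntitoneOn U' (Ici t) :=
  antitoneOn_Ici_of_hasDerivAt_nonpos (fun s hs => h.hasDerivAt' s (ht.trans_le hs)) fun s hs =>
    neg_nonpos.2 (mul_pos (by positivity) (hf.pos _ (h.pos s (ht.trans_le hs)))).le

theorem IsProfile.deriv_pos (h : IsProfile f t₁ U U') (hf : Admissible f) {t : ℝ} (ht : t₁ < t) :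
    0 < U' t := by
  by_contra! hneg
  have hanti : AntitoneOn U (Ici t) :=
    antitoneOn_Ici_of_hasDerivAt_nonpos (fun s hs => h.hasDerivAt s (ht.trans_le hs)) fun s hs =>
      (h.antitoneOn_deriv hf ht self_mem_Ici hs hs).trans hneg
  obtain ⟨s, hUs, hts⟩ :=
    ((h.tendsto.eventually_gt_atTop (U t)).and (eventually_ge_atTop t)).exists
  exact (hanti self_mem_Ici hts hts).not_gt hUs

theorem Admissible.exists_backward_zero (hf : Admissible f) {u w : ℝ} (hu : 0 < u) (hw : 0 < w)
    (b : ℝ) :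
    ∃ (τ : ℝ) (x y : ℝ → ℝ), τ < b ∧ x τ = 0 ∧ x b = u ∧ y b = w ∧ ContinuousOn x (Icc τ b) ∧
      ∀ t ∈ Ioc τ b, 0 < x t ∧ HasDerivWithinAt x (y t) (Iic b) t ∧
        HasDerivWithinAt y (-(Real.exp (-t) / 4 * f (x t))) (Iic b) t := by
  set a := b - u / w with ha
  have hab : a < b := sub_lt_self b (div_pos hu hw)
  obtain ⟨K, hK⟩ := (hf.contDiffOn.mono
    (Icc_subset_Ici_self : Icc 0 u ⊆ Ici 0)).exists_lipschitzOnWith one_ne_zero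
      (convex_Icc 0 u) isCompact_Icc
  have hrange : ∀ s ∈ Icc 0 u, f s ∈ Icc 0 (f u) := fun s hs =>
    ⟨hf.zero_nonneg.trans (hf.monotoneOn self_mem_Ici hs.1 hs.1), hf.monotoneOn hs.1 hu.le hs.2⟩
  obtain ⟨x, y, hxb, hyb, hxy⟩ := exists_concave_solution (c := fun t => Real.exp (-t) / 4)
    (h := IccExtend hu.le ((Icc 0 u).domRestrict f)) (c₀ := Real.exp (-a) / 4) hab.le
    (by fun_prop) (fun t ht => ⟨by positivity, by gcongr; exact ht.1⟩)
    (hK.to_restrict.comp (LipschitzWith.projIcc hu.le)) (fun s => hrange _ (projIcc _ _ _ s).2) u w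
  have hxc : ContinuousOn x (Icc a b) := fun t ht => (hxy t ht).2.1.continuousWithinAt
  have hslope := fun {s t} => mul_sub_le_sub_of_hasDerivWithinAt (s := s) (t := t)
    (fun t ht => (hxy t ht).2.1) (fun t ht => (hxy t ht).1)
  have hxmono : StrictMonoOn x (Icc a b) := fun s hs t ht hst =>
    sub_pos.1 ((mul_pos hw (sub_pos.2 hst)).trans_le (hslope hs ht hst.le))
  have hxa : x a ≤ 0 := by
    have := hslope (left_mem_Icc.2 hab.le) (right_mem_Icc.2 hab.le) hab.le
    rw [ha, sub_sub_cancel, mul_div_cancel₀ u hw.ne', hxb] at this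
    linarith
  obtain ⟨τ, hτ, hxτ⟩ := intermediate_value_Icc hab.le hxc ⟨hxa, hxb ▸ hu.le⟩
  have hτb : τ < b := hτ.2.lt_of_ne fun h => hu.ne' (by rw [← hxb, ← h, hxτ])
  refine ⟨τ, x, y, hτb, hxτ, hxb, hyb, hxc.mono (Icc_subset_Icc_left hτ.1), fun t ht => ?_⟩
  have hta : a < t := hτ.1.trans_lt ht.1
  have hmem : t ∈ Icc a b := ⟨hta.le, ht.2⟩
  have hnhds : Icc a b ∈ 𝓝[Iic b] t := by
    rw [← Ici_inter_Iic, inter_comm]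
    exact inter_mem_nhdsWithin _ (Ici_mem_nhds hta)
  have hxt : 0 < x t := hxτ ▸ hxmono hτ hmem ht.1
  have hxu : x t ≤ u := hxb ▸ hxmono.monotoneOn hmem (right_mem_Icc.2 hab.le) ht.2
  obtain ⟨-, hx, hy⟩ := hxy t hmem
  rw [IccExtend_of_mem hu.le _ ⟨hxt.le, hxu⟩] at hy
  exact ⟨hxt, hx.mono_of_mem_nhdsWithin hnhds, hy.mono_of_mem_nhdsWithin hnhds⟩

theorem IsProfile.exists_extension (hU : IsProfile f t₁ U U') (hf : Admissible f) :
    ∃ (τ t₂ : ℝ) (V V' : ℝ → ℝ), IsProfile f τ V V' ∧ (∀ t, t₂ < t → V t = U t) ∧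
      ContinuousOn V (Ici τ) ∧ V τ = 0 := by
  obtain ⟨t₂, ht₂⟩ := exists_gt t₁
  obtain ⟨τ, x, y, hτ, hxτ, hxt₂, hyt₂, hxc, hxy⟩ :=
    hf.exists_backward_zero (hU.pos t₂ ht₂) (hU.deriv_pos hf ht₂) t₂
  have hglue : ∀ {φ φ' : ℝ → ℝ}, (fun t => if t ≤ t₂ then φ t else φ' t) =ᶠ[atTop] φ' :=
    (eventually_gt_atTop t₂).mono fun t ht => if_neg (not_le.2 ht)
  have hderiv : ∀ t, τ < t → HasDerivAt (fun t => if t ≤ t₂ then x t else U t)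
      (if t ≤ t₂ then y t else U' t) t := fun t ht =>
    hasDerivAt_ite_le (fun t ht => (hxy t ht).2.1) (fun t ht => hU.hasDerivAt t (ht₂.trans_le ht))
      hxt₂ hyt₂ ht
  refine ⟨τ, t₂, fun t => if t ≤ t₂ then x t else U t, fun t => if t ≤ t₂ then y t else U' t,
    ⟨hderiv, fun t ht => ?_, fun t ht => ?_, hU.tendsto.congr' hglue.symm,
      hU.tendsto'.congr' hglue.symm⟩, fun t ht => if_neg (not_le.2 ht), fun t ht => ?_,
    (if_pos hτ.le).trans hxτ⟩
  · refine (hasDerivAt_ite_le (fun t ht => (hxy t ht).2.2)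
      (fun t ht => hU.hasDerivAt' t (ht₂.trans_le ht)) hyt₂ (by rw [hxt₂]) ht).congr_deriv ?_
    split_ifs <;> rfl
  · split_ifs with h
    · exact (hxy t ⟨ht, h⟩).1
    · exact hU.pos t (ht₂.trans (not_le.1 h))
  · rcases eq_or_lt_of_le (mem_Ici.1 ht) with rfl | ht
    · refine ((hxc τ (left_mem_Icc.2 hτ.le)).mono_of_mem_nhdsWithin
        (Icc_mem_nhdsGE hτ)).congr_of_eventuallyEq ?_ (if_pos hτ.le)
      filter_upwards [Icc_mem_nhdsGE hτ] with s hs using if_pos hs.2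
    · exact (hderiv t ht).continuousAt.continuousWithinAt

end Continuation

section RadialLaplacian

variable {E : Type*} [NormedAddCommGroup E] [InnerProductSpace ℝ E]

theorem hasFDerivAt_comp_norm_sq {w : ℝ → ℝ} {w' : ℝ} {x : E} (hw : HasDerivAt w w' (‖x‖ ^ 2)) :
    HasFDerivAt (fun y : E => w (‖y‖ ^ 2)) (w' • 2 • innerSL ℝ x) x :=
  hw.comp_hasFDerivAt x (hasStrictFDerivAt_norm_sq x).hasFDerivAt

theorem fderiv_fderiv_comp_norm_sq {w : ℝ → ℝ} {x : E} (hw : ContDiffAt ℝ 2 w (‖x‖ ^ 2)) (e : E) :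
    fderiv ℝ (fun y => fderiv ℝ (fun z : E => w (‖z‖ ^ 2)) y e) x e =
      4 * deriv (deriv w) (‖x‖ ^ 2) * inner ℝ x e ^ 2 + 2 * deriv w (‖x‖ ^ 2) * ‖e‖ ^ 2 := by
  have hfirst : (fun y : E => fderiv ℝ (fun z : E => w (‖z‖ ^ 2)) y e) =ᶠ[𝓝 x]
      fun y => deriv w (‖y‖ ^ 2) * (2 * innerSL ℝ e y) := by
    filter_upwards [(contDiff_norm_sq ℝ (n := 0)).continuous.continuousAt.eventually
      (hw.eventually (by simp))] with y hy
    rw [(hasFDerivAt_comp_norm_sq (hy.differentiableAt two_ne_zero).hasDerivAt).fderiv]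
    simp [real_inner_comm e y]
  have hw' : HasDerivAt (deriv w) (deriv (deriv w) (‖x‖ ^ 2)) (‖x‖ ^ 2) :=
    (((hw.fderiv_right (m := 1) le_rfl).clm_apply contDiffAt_const).differentiableAt
      one_ne_zero).hasDerivAt
  have hsecond : HasFDerivAt (fun y : E => deriv w (‖y‖ ^ 2) * (2 * innerSL ℝ e y)) _ x :=
    (hasFDerivAt_comp_norm_sq hw').mul ((innerSL ℝ e).hasFDerivAt.const_mul 2)
  rw [hfirst.fderiv_eq, hsecond.fderiv]
  simp [real_inner_comm e x]
  ring

variable [FiniteDimensional ℝ E]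

theorem laplacian_eq_sum_fderiv {ι : Type*} [Fintype ι] (b : OrthonormalBasis ι ℝ E)
    {g : E → ℝ} {x : E} (hg : ContDiffAt ℝ 2 g x) :
    (Δ g) x = ∑ i, fderiv ℝ (fun y => fderiv ℝ g y (b i)) x (b i) := by
  have hg' : DifferentiableAt ℝ (fderiv ℝ g) x :=
    (hg.fderiv_right (m := 1) le_rfl).differentiableAt one_ne_zero
  simp [InnerProductSpace.laplacian_eq_iteratedFDeriv_orthonormalBasis g b,
    iteratedFDeriv_two_apply, fderiv_clm_apply hg' (differentiableAt_const _)]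

theorem continuousOn_laplacian {g : E → ℝ} {Ω : Set E} (hΩ : IsOpen Ω) (hg : ContDiffOn ℝ 2 g Ω) :
    ContinuousOn (Δ g) Ω := by
  have hsum : ContinuousOn (fun x => ∑ i, fderiv ℝ (fun y => fderiv ℝ g y
      (stdOrthonormalBasis ℝ E i)) x (stdOrthonormalBasis ℝ E i)) Ω :=
    continuousOn_finsetSum _ fun i _ =>
      ((((hg.fderiv_of_isOpen hΩ le_rfl).clm_apply contDiffOn_const).continuousOn_fderiv_of_isOpen
        (n := 1) hΩ le_rfl).clm_apply continuousOn_const)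
  exact hsum.congr fun x hx => laplacian_eq_sum_fderiv _ (hg.contDiffAt (hΩ.mem_nhds hx))

theorem tsupport_laplacian_subset (φ : E → ℝ) : tsupport (Δ φ) ⊆ tsupport φ := by
  refine closure_minimal (fun x hx => ?_) (isClosed_tsupport φ)
  contrapose! hx
  have hzero : φ =ᶠ[𝓝 x] fun _ => 0 := by
    filter_upwards [(isClosed_tsupport φ).isOpen_compl.mem_nhds hx] with y hy
    exact image_eq_zero_of_notMem_tsupport hy
  simp [(InnerProductSpace.laplacian_congr_nhds hzero).eq_of_nhds]

theorem laplacian_comp_norm_sq {w : ℝ → ℝ} {x : E} (hw : ContDiffAt ℝ 2 w (‖x‖ ^ 2)) :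
    (Δ fun y : E => w (‖y‖ ^ 2)) x = 4 * ‖x‖ ^ 2 * deriv (deriv w) (‖x‖ ^ 2) +
      2 * Module.finrank ℝ E * deriv w (‖x‖ ^ 2) := by
  let b := stdOrthonormalBasis ℝ E
  have hg : ContDiffAt ℝ 2 (fun y : E => w (‖y‖ ^ 2)) x :=
    hw.comp x (contDiff_norm_sq ℝ).contDiffAt
  rw [laplacian_eq_sum_fderiv b hg]
  simp only [fderiv_fderiv_comp_norm_sq hw, b.norm_eq_one, Finset.sum_add_distrib,
    ← Finset.mul_sum, ← b.sum_sq_inner_left x, Finset.sum_const, Finset.card_univ, Fintype.card_fin]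
  simp
  ring

end RadialLaplacian

theorem integrable_mul_of_tsupport_subset {X : Type*} [TopologicalSpace X] [T2Space X]
    [MeasurableSpace X] [OpensMeasurableSpace X] {μ : Measure X} {Ω : Set X} {g ψ : X → ℝ}
    (hg : LocallyIntegrableOn g Ω μ) (hψ : Continuous ψ) (hc : HasCompactSupport ψ)
    (hs : tsupport ψ ⊆ Ω) : Integrable (fun x => g x * ψ x) μ :=
  (integrableOn_iff_integrable_of_support_subset
    ((Function.support_mul_subset_right g ψ).trans (subset_tsupport ψ))).1
      ((hg.integrableOn_compact_subset hs hc.isCompact).mul_continuousOn hψ.continuousOn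
        hc.isCompact)

section GreenIdentity

variable {E : Type*} [NormedAddCommGroup E] [InnerProductSpace ℝ E] [FiniteDimensional ℝ E]
  [MeasurableSpace E] [BorelSpace E] {μ : Measure E} [μ.IsAddHaarMeasure] {Ω : Set E}

theorem integral_mul_fderiv_apply {g φ : E → ℝ} (hΩ : IsOpen Ω) (hg : ContDiffOn ℝ 1 g Ω)
    (hφ : ContDiff ℝ 1 φ) (hc : HasCompactSupport φ) (hs : tsupport φ ⊆ Ω) (e : E) :
    ∫ x, g x * fderiv ℝ φ x e ∂μ = -∫ x, fderiv ℝ g x e * φ x ∂μ := by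
  have hg' : ContinuousOn (fun x => fderiv ℝ g x e) Ω :=
    (hg.continuousOn_fderiv_of_isOpen hΩ le_rfl).clm_apply continuousOn_const
  have hφ' : Continuous fun x => fderiv ℝ φ x e :=
    (hφ.continuous_fderiv one_ne_zero).clm_apply continuous_const
  have hgloc : LocallyIntegrableOn g Ω μ := hg.continuousOn.locallyIntegrableOn hΩ.measurableSet
  exact integral_mul_fderiv_eq_neg_fderiv_mul_of_integrable
    (integrable_mul_of_tsupport_subset (hg'.locallyIntegrableOn hΩ.measurableSet) hφ.continuous
      hc hs)
    (integrable_mul_of_tsupport_subset hgloc hφ' (hc.fderiv_apply ℝ e)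
      ((tsupport_fderiv_apply_subset ℝ e).trans hs))
    (integrable_mul_of_tsupport_subset hgloc hφ.continuous hc hs)
    (fun x hx => (hg.contDiffAt (hΩ.mem_nhds (hs hx))).differentiableAt one_ne_zero)
    (fun x _ => hφ.differentiable one_ne_zero x)

theorem integral_mul_laplacian {g φ : E → ℝ} (hΩ : IsOpen Ω) (hg : ContDiffOn ℝ 2 g Ω)
    (hφ : ContDiff ℝ 2 φ) (hc : HasCompactSupport φ) (hs : tsupport φ ⊆ Ω) :
    ∫ x, g x * (Δ φ) x ∂μ = ∫ x, (Δ g) x * φ x ∂μ := by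
  let b := stdOrthonormalBasis ℝ E
  have hφe : ∀ e, ContDiff ℝ 1 (fun x => fderiv ℝ φ x e) := fun e =>
    (hφ.fderiv_right le_rfl).clm_apply contDiff_const
  have hge : ∀ e, ContDiffOn ℝ 1 (fun x => fderiv ℝ g x e) Ω := fun e =>
    (hg.fderiv_of_isOpen hΩ le_rfl).clm_apply contDiffOn_const
  have hse : ∀ e, tsupport (fun x => fderiv ℝ φ x e) ⊆ Ω := fun e =>
    (tsupport_fderiv_apply_subset ℝ e).trans hs
  have hparts : ∀ e, ∫ x, g x * fderiv ℝ (fun y => fderiv ℝ φ y e) x e ∂μ =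
      ∫ x, fderiv ℝ (fun y => fderiv ℝ g y e) x e * φ x ∂μ := fun e => by
    rw [integral_mul_fderiv_apply hΩ (hg.of_le one_le_two) (hφe e) (hc.fderiv_apply ℝ e) (hse e),
      integral_mul_fderiv_apply hΩ (hge e) (hφ.of_le one_le_two) hc hs, neg_neg]
  have hΔφ : ∀ x, g x * (Δ φ) x =
      ∑ i, g x * fderiv ℝ (fun y => fderiv ℝ φ y (b i)) x (b i) := fun x => by
    rw [laplacian_eq_sum_fderiv b hφ.contDiffAt, Finset.mul_sum]
  have hΔg : ∀ x, (Δ g) x * φ x =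
      ∑ i, fderiv ℝ (fun y => fderiv ℝ g y (b i)) x (b i) * φ x := fun x => by
    by_cases hx : x ∈ tsupport φ
    · rw [laplacian_eq_sum_fderiv b (hg.contDiffAt (hΩ.mem_nhds (hs hx))), Finset.sum_mul]
    · simp [image_eq_zero_of_notMem_tsupport hx]
  simp_rw [hΔφ, hΔg]
  rw [integral_finsetSum, integral_finsetSum]
  · exact Finset.sum_congr rfl fun i _ => hparts (b i)
  · exact fun i _ => integrable_mul_of_tsupport_subset
      ((((hge (b i)).continuousOn_fderiv_of_isOpen hΩ le_rfl).clm_apply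
        continuousOn_const).locallyIntegrableOn hΩ.measurableSet)
      hφ.continuous hc hs
  · exact fun i _ => integrable_mul_of_tsupport_subset
      (hg.continuousOn.locallyIntegrableOn hΩ.measurableSet)
      (((hφe (b i)).continuous_fderiv one_ne_zero).clm_apply continuous_const)
      ((hc.fderiv_apply ℝ (b i)).fderiv_apply ℝ (b i))
      ((tsupport_fderiv_apply_subset ℝ _).trans (hse (b i)))

end GreenIdentity

section LogRadial

variable {V V' V'' : ℝ → ℝ} {s : Set ℝ}

theorem contDiffOn_two_of_hasDerivAt (hs : IsOpen s) (hV : ∀ t ∈ s, HasDerivAt V (V' t) t)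
    (hV' : ∀ t ∈ s, HasDerivAt V' (V'' t) t) (hc : ContinuousOn V'' s) : ContDiffOn ℝ 2 V s := by
  have hVC1' : ContDiffOn ℝ 1 V' s := (contDiffOn_succ_iff_deriv_of_isOpen (n := 0) hs).2
    ⟨fun t ht => (hV' t ht).differentiableAt.differentiableWithinAt, by simp,
      contDiffOn_zero.2 (hc.congr fun t ht => (hV' t ht).deriv)⟩
  have hVC2 : ContDiffOn ℝ (1 + 1) V s := (contDiffOn_succ_iff_deriv_of_isOpen (n := 1) hs).2
    ⟨fun t ht => (hV t ht).differentiableAt.differentiableWithinAt, by simp,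
      hVC1'.congr fun t ht => (hV t ht).deriv⟩
  simpa only [one_add_one_eq_two] using hVC2

theorem deriv_deriv_eq_of_hasDerivAt {t v : ℝ} (hs : IsOpen s) (ht : t ∈ s)
    (hV : ∀ t ∈ s, HasDerivAt V (V' t) t) (hV' : HasDerivAt V' v t) : deriv (deriv V) t = v :=
  (hV'.congr_of_eventuallyEq
    ((hs.eventually_mem ht).mono fun r hr => (hV r hr).deriv)).deriv

theorem logRad_eq_neg_log_sq (x : Plane) : logRad x = -Real.log (‖x‖ ^ 2) := by
  rw [logRad, one_div, Real.log_inv]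

variable {x : Plane}

theorem contDiffAt_logRad (hx : x ≠ 0) : ContDiffAt ℝ 2 logRad x := by
  have hx' : ‖x‖ ^ 2 ≠ 0 := by positivity
  simpa only [← logRad_eq_neg_log_sq] using
    ((contDiff_norm_sq ℝ (E := Plane)).contDiffAt.log hx').neg

theorem laplacian_comp_logRad (hx : x ≠ 0) (hV : ContDiffAt ℝ 2 V (logRad x)) :
    (Δ fun y => V (logRad y)) x = 4 / ‖x‖ ^ 2 * deriv (deriv V) (logRad x) := by
  have hq : 0 < ‖x‖ ^ 2 := by positivity
  rw [logRad_eq_neg_log_sq] at hV ⊢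
  have hlog : HasDerivAt (fun q => -Real.log q) (-(‖x‖ ^ 2)⁻¹) (‖x‖ ^ 2) :=
    (Real.hasDerivAt_log hq.ne').neg
  have hderiv : deriv (fun q => V (-Real.log q)) =ᶠ[𝓝 (‖x‖ ^ 2)]
      fun q => deriv V (-Real.log q) * -q⁻¹ := by
    filter_upwards [lt_mem_nhds hq, hlog.continuousAt.eventually (hV.eventually (by simp))]
      with q hq hVq
    exact ((hVq.differentiableAt two_ne_zero).hasDerivAt.comp q
      (Real.hasDerivAt_log hq.ne').neg).deriv
  have hV' : HasDerivAt (deriv V) (deriv (deriv V) (-Real.log (‖x‖ ^ 2))) (-Real.log (‖x‖ ^ 2)) :=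
    (((hV.fderiv_right (m := 1) le_rfl).clm_apply contDiffAt_const).differentiableAt
      one_ne_zero).hasDerivAt
  have hcomp : HasDerivAt (fun q => deriv V (-Real.log q))
      (deriv (deriv V) (-Real.log (‖x‖ ^ 2)) * -(‖x‖ ^ 2)⁻¹) (‖x‖ ^ 2) :=
    HasDerivAt.comp (h₂ := deriv V) (‖x‖ ^ 2) hV' hlog
  have hsecond : HasDerivAt (fun q => deriv V (-Real.log q) * -q⁻¹) _ (‖x‖ ^ 2) :=
    hcomp.mul (hasDerivAt_inv hq.ne').neg
  have hw : ContDiffAt ℝ 2 (fun q => V (-Real.log q)) (‖x‖ ^ 2) :=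
    hV.comp (‖x‖ ^ 2) (contDiffAt_id.log hq.ne').neg
  simp only [logRad_eq_neg_log_sq]
  rw [laplacian_comp_norm_sq hw, hderiv.deriv_eq, hsecond.deriv, hderiv.eq_of_nhds,
    finrank_euclideanSpace_fin]
  push_cast
  field_simp
  ring

end LogRadial

section LogRadialIntegral

variable {φ V : ℝ → ℝ} {a b τ : ℝ} {x : Plane}

theorem lt_logRad_iff_mem_ball (hx : x ≠ 0) :
    τ < logRad x ↔ x ∈ Metric.ball (0 : Plane) (Real.exp (-τ / 2)) := by
  rw [mem_ball_zero_iff, ← Real.log_lt_iff_lt_exp (norm_pos_iff.2 hx), logRad_eq]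
  constructor <;> intro h <;> linarith

theorem le_logRad_iff_mem_closedBall (hx : x ≠ 0) :
    τ ≤ logRad x ↔ x ∈ Metric.closedBall (0 : Plane) (Real.exp (-τ / 2)) := by
  rw [mem_closedBall_zero_iff, ← Real.log_le_iff_le_exp (norm_pos_iff.2 hx), logRad_eq]
  constructor <;> intro h <;> linarith

theorem exp_neg_logRad (hx : x ≠ 0) : Real.exp (-logRad x) = ‖x‖ ^ 2 := by
  rw [logRad_eq_neg_log_sq, neg_neg, Real.exp_log (by positivity)]

theorem tendsto_logRad : Tendsto logRad (𝓝[≠] 0) atTop :=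
  ((Real.tendsto_log_nhdsGT_zero.const_mul_atBot_of_neg (neg_lt_zero.2 two_pos)).comp
    (tendsto_norm_nhdsNE_zero (E := Plane))).congr fun x => (logRad_eq x).symm

theorem image_exp_neg_half_Ioi :
    (fun t => Real.exp (-t / 2)) '' Ioi a = Ioo 0 (Real.exp (-a / 2)) := by
  ext y
  refine ⟨?_, fun hy => ⟨-2 * Real.log y, ?_, ?_⟩⟩
  · rintro ⟨t, ht, rfl⟩
    exact ⟨Real.exp_pos _, Real.exp_lt_exp.2 (by linarith [show a < t from ht])⟩
  · have := (Real.log_lt_iff_lt_exp hy.1).2 hy.2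
    exact show a < _ by linarith
  · simp only
    rw [show -(-2 * Real.log y) / 2 = Real.log y by ring, Real.exp_log hy.1]

/-- In the plane the area element is `e ^ (-t) dt` up to a constant. -/
theorem integrableOn_comp_logRad_iff :
    IntegrableOn (fun x => φ (logRad x)) (Metric.ball (0 : Plane) (Real.exp (-a / 2))) ↔
      IntegrableOn (fun t => Real.exp (-t) * φ t) (Ioi a) := by
  have hderiv : ∀ t ∈ Ioi a, HasDerivWithinAt (fun t => Real.exp (-t / 2))
      (Real.exp (-t / 2) * (-1 / 2)) (Ioi a) t := fun t _ =>
    ((hasDerivWithinAt_id t _).neg.div_const 2).exp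
  have hinj : InjOn (fun t => Real.exp (-t / 2)) (Ioi a) := fun s _ t _ hst => by
    have := Real.exp_injective hst
    linarith
  simp only [logRad_eq]
  rw [integrableOn_fun_norm_addHaar volume (f := fun y => φ (-2 * Real.log y)),
    ← image_exp_neg_half_Ioi,
    integrableOn_image_iff_integrableOn_abs_deriv_smul measurableSet_Ioi hderiv hinj,
    IntegrableOn, IntegrableOn, ← integrable_const_mul_iff (c := (2 : ℝ)) (by norm_num)]
  refine iff_of_eq (congrArg (Integrable · _) (funext fun t => ?_))
  rw [finrank_euclideanSpace_fin, Real.log_exp, abs_mul, Real.abs_exp,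
    show -t = -t / 2 + -t / 2 by ring, Real.exp_add]
  norm_num
  ring_nf

theorem locallyIntegrableOn_comp_logRad
    (hφ : ∀ a, τ < a → IntegrableOn (fun t => Real.exp (-t) * φ t) (Ioi a)) :
    LocallyIntegrableOn (fun x => φ (logRad x))
      (Metric.ball (0 : Plane) (Real.exp (-τ / 2))) := by
  intro x hx
  rw [mem_ball_zero_iff] at hx
  obtain ⟨r, hr, hrτ⟩ := exists_between hx
  have hr0 : 0 < r := (norm_nonneg x).trans_lt hr
  have hexp : Real.exp (-(-2 * Real.log r) / 2) = r := by
    rw [show -(-2 * Real.log r) / 2 = Real.log r by ring, Real.exp_log hr0]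
  have hint := integrableOn_comp_logRad_iff.2 (hφ (-2 * Real.log r) (by
    linarith [(Real.log_lt_iff_lt_exp hr0).2 hrτ]))
  rw [hexp] at hint
  exact ⟨_, mem_nhdsWithin_of_mem_nhds
    (Metric.isOpen_ball.mem_nhds (mem_ball_zero_iff.2 hr)), hint⟩

end LogRadialIntegral

section Profile

variable {f V V' : ℝ → ℝ} {τ : ℝ}

theorem IsProfile.continuousOn (h : IsProfile f τ V V') : ContinuousOn V (Ioi τ) := fun t ht =>
  (h.hasDerivAt t ht).continuousAt.continuousWithinAt

theorem IsProfile.continuousOn_deriv (h : IsProfile f τ V V') : ContinuousOn V' (Ioi τ) :=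
  fun t ht => (h.hasDerivAt' t ht).continuousAt.continuousWithinAt

theorem IsProfile.continuousOn_comp (h : IsProfile f τ V V') (hf : Admissible f) :
    ContinuousOn (fun t => f (V t)) (Ioi τ) := fun t ht =>
  (ContinuousAt.comp (g := f) (hf.continuousAt (h.pos t ht))
    (h.hasDerivAt t ht).continuousAt).continuousWithinAt

theorem IsProfile.contDiffOn (h : IsProfile f τ V V') (hf : Admissible f) :
    ContDiffOn ℝ 2 V (Ioi τ) :=
  contDiffOn_two_of_hasDerivAt isOpen_Ioi h.hasDerivAt h.hasDerivAt'
    (ContinuousOn.mul (by fun_prop) (h.continuousOn_comp hf)).neg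

theorem IsProfile.isClassicalRadialSolution (h : IsProfile f τ V V') (hf : Admissible f)
    (hc : ContinuousOn V (Ici τ)) (h0 : V τ = 0) :
    IsClassicalRadialSolution f (Real.exp (-τ / 2)) fun x => V (logRad x) := by
  have hV : ∀ x ∈ Metric.ball (0 : Plane) (Real.exp (-τ / 2)) \ {0},
      ContDiffAt ℝ 2 V (logRad x) := fun x hx =>
    (h.contDiffOn hf).contDiffAt (Ioi_mem_nhds ((lt_logRad_iff_mem_ball hx.2).2 hx.1))
  refine ⟨fun x hx => ((hV x hx).comp x (contDiffAt_logRad hx.2)).contDiffWithinAt,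
    hc.comp (fun x hx => (contDiffAt_logRad hx.2).continuousAt.continuousWithinAt)
      fun x hx => (le_logRad_iff_mem_closedBall hx.2).2 hx.1,
    fun x y _ hxy => by simp only [logRad_eq, hxy],
    fun x hx => h.pos _ ((lt_logRad_iff_mem_ball hx.2).2 hx.1), fun x hx => ?_, fun x hx => ?_⟩
  · have hxτ := (lt_logRad_iff_mem_ball hx.2).2 hx.1
    have hx0 : ‖x‖ ≠ 0 := norm_ne_zero_iff.2 hx.2
    rw [laplacian_comp_logRad hx.2 (hV x hx),
      deriv_deriv_eq_of_hasDerivAt isOpen_Ioi hxτ h.hasDerivAt (h.hasDerivAt' _ hxτ),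
      exp_neg_logRad hx.2]
    field_simp
  · rw [logRad_of_norm_eq (mem_sphere_zero_iff_norm.1 hx), h0]

theorem IsProfile.le_add_mul_sub (h : IsProfile f τ V V') (hf : Admissible f) {a t : ℝ}
    (ha : τ < a) (hat : a ≤ t) : V t ≤ V a + V' a * (t - a) := by
  have := mul_sub_le_sub_of_hasDerivWithinAt (w := -V' a)
    (fun s hs => (h.hasDerivAt s (ha.trans_le hs.1)).neg.hasDerivWithinAt)
    (fun s hs => neg_le_neg (h.antitoneOn_deriv hf ha self_mem_Ici hs.1 hs.1))
    (left_mem_Icc.2 hat) (right_mem_Icc.2 hat) hat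
  simp only [Pi.neg_apply] at this
  linarith

theorem IsProfile.integrableOn_exp_mul (h : IsProfile f τ V V') (hf : Admissible f) {a : ℝ}
    (ha : τ < a) : IntegrableOn (fun t => Real.exp (-t) * V t) (Ioi a) := by
  have hpow : ∀ k : ℕ, (fun t : ℝ => t ^ k) =O[atTop] fun t => Real.exp (2⁻¹ * t) := fun k =>
    (isLittleO_pow_exp_pos_mul_atTop k (by norm_num)).isBigO
  have hlin : (fun t => (V a - V' a * a) * t ^ 0 + V' a * t ^ 1) =O[atTop]
      fun t => Real.exp (2⁻¹ * t) := ((hpow 0).const_mul_left _).add ((hpow 1).const_mul_left _)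
  have hV : V =O[atTop] fun t => Real.exp (2⁻¹ * t) := by
    refine (Asymptotics.IsBigO.of_bound' ?_).trans hlin
    filter_upwards [eventually_ge_atTop a] with t ht
    rw [Real.norm_of_nonneg (h.pos t (ha.trans_le ht)).le]
    refine le_trans ?_ (le_abs_self _)
    linarith [h.le_add_mul_sub hf ha ht]
  refine integrable_of_isBigO_exp_neg (b := 2⁻¹) (by norm_num)
    (ContinuousOn.mul (by fun_prop) (h.continuousOn.mono (Ici_subset_Ioi.2 ha))) ?_
  refine ((Asymptotics.isBigO_refl (fun t : ℝ => Real.exp (-t)) atTop).mul hV).congr_right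
    fun t => ?_
  rw [← Real.exp_add]
  congr 1
  ring

theorem IsProfile.integrableOn_exp_mul_comp (h : IsProfile f τ V V') (hf : Admissible f) {a : ℝ}
    (ha : τ < a) : IntegrableOn (fun t => Real.exp (-t) * f (V t)) (Ioi a) := by
  have hV'' : IntegrableOn (fun t => -(Real.exp (-t) / 4 * f (V t))) (Ioi a) :=
    integrableOn_Ioi_deriv_of_nonpos' (fun t ht => h.hasDerivAt' t (ha.trans_le ht))
      (fun t ht => by
        have := hf.pos _ (h.pos t (ha.trans ht))
        exact neg_nonpos.2 (by positivity)) h.tendsto'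
  exact IntegrableOn.congr_fun (hV''.const_mul (-4)) (fun t _ => by ring) measurableSet_Ioi

end Profile

section Cutoff

variable {k t : ℝ}

/-- A smooth cutoff, equal to `1` on `(-∞, k]` and to `0` on `[k + 1, ∞)`. -/
noncomputable def cutoff (k t : ℝ) : ℝ := Real.smoothTransition (k + 1 - t)

theorem contDiff_cutoff : ContDiff ℝ 1 (cutoff k) :=
  Real.smoothTransition.contDiff.comp (contDiff_const.sub contDiff_id)

theorem cutoff_mem_Icc : cutoff k t ∈ Icc 0 1 :=
  ⟨Real.smoothTransition.nonneg _, Real.smoothTransition.le_one _⟩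

theorem cutoff_eq_one (ht : t ≤ k) : cutoff k t = 1 :=
  Real.smoothTransition.one_of_one_le (by linarith)

theorem cutoff_eq_zero (ht : k + 1 ≤ t) : cutoff k t = 0 :=
  Real.smoothTransition.zero_of_nonpos (by linarith)

theorem deriv_cutoff_eq_zero (ht : t ∉ Icc k (k + 1)) : deriv (cutoff k) t = 0 := by
  rw [mem_Icc, not_and_or, not_le, not_le] at ht
  rcases ht with ht | ht
  · have hone : cutoff k =ᶠ[𝓝 t] fun _ => 1 := by
      filter_upwards [gt_mem_nhds ht] with s hs using cutoff_eq_one hs.le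
    rw [hone.deriv_eq, deriv_const]
  · have hzero : cutoff k =ᶠ[𝓝 t] fun _ => 0 := by
      filter_upwards [lt_mem_nhds ht] with s hs using cutoff_eq_zero hs.le
    rw [hzero.deriv_eq, deriv_const]

theorem exists_abs_deriv_cutoff_le : ∃ C, ∀ k t, |deriv (cutoff k) t| ≤ C := by
  obtain ⟨C, hC⟩ := (contDiff_cutoff (k := 0)).continuous_deriv_one.bounded_above_of_compact_support
    (HasCompactSupport.intro isCompact_Icc fun _ ht => deriv_cutoff_eq_zero ht)
  refine ⟨C, fun k t => ?_⟩
  have hshift : cutoff k = fun s => cutoff 0 (s - k) := funext fun s => by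
    rw [cutoff, cutoff, zero_add, sub_sub_eq_add_sub, add_comm k]
  rw [hshift, deriv_comp_sub_const]
  exact hC (t - k)

end Cutoff

section Truncation

variable {f V V' : ℝ → ℝ} {τ k t : ℝ}

/-- The truncation of the profile `V` with derivative `V'` times the cutoff: equal to `V` up to `k`
and constant beyond `k + 1`. -/
noncomputable def truncProfile (V V' : ℝ → ℝ) (k t : ℝ) : ℝ := V k + ∫ s in k..t, V' s * cutoff k s

theorem IsProfile.hasDerivAt_truncProfile (h : IsProfile f τ V V') (hk : τ < k) (ht : τ < t) :
    HasDerivAt (truncProfile V V' k) (V' t * cutoff k t) t := by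
  have hc : ContinuousOn (fun s => V' s * cutoff k s) (Ioi τ) :=
    h.continuousOn_deriv.mul contDiff_cutoff.continuous.continuousOn
  exact (intervalIntegral.integral_hasDerivAt_right
    (hc.mono (ordConnected_Ioi.uIcc_subset hk ht)).intervalIntegrable
    (hc.stronglyMeasurableAtFilter isOpen_Ioi t ht)
    (hc.continuousAt (Ioi_mem_nhds ht))).const_add (V k)

theorem IsProfile.truncProfile_eq (h : IsProfile f τ V V') (ht : τ < t) (htk : t ≤ k) :
    truncProfile V V' k t = V t := by
  have hsub : uIcc k t ⊆ Ioi τ := ordConnected_Ioi.uIcc_subset (ht.trans_le htk) ht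
  have hcut : EqOn (fun s => V' s * cutoff k s) V' (uIcc k t) := fun s hs => by
    rw [uIcc_of_ge htk] at hs
    simp only [cutoff_eq_one hs.2, mul_one]
  rw [truncProfile, intervalIntegral.integral_congr hcut,
    intervalIntegral.integral_eq_sub_of_hasDerivAt (fun s hs => h.hasDerivAt s (hsub hs))
      (h.continuousOn_deriv.mono hsub).intervalIntegrable, add_sub_cancel]

theorem IsProfile.truncProfile_const (h : IsProfile f τ V V') (hk : τ < k) (ht : k + 1 ≤ t) :
    truncProfile V V' k t = truncProfile V V' k (k + 1) := by
  have hderiv : ∀ s ∈ Icc (k + 1) t, HasDerivAt (truncProfile V V' k) 0 s := fun s hs => by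
    simpa only [cutoff_eq_zero hs.1, mul_zero] using
      h.hasDerivAt_truncProfile hk (by linarith [hs.1] : τ < s)
  exact constant_of_has_deriv_right_zero
    (fun s hs => (hderiv s hs).continuousAt.continuousWithinAt)
    (fun s hs => (hderiv s (Ico_subset_Icc_self hs)).hasDerivWithinAt) t (right_mem_Icc.2 ht)

theorem IsProfile.truncProfile_mem_Icc (h : IsProfile f τ V V') (hf : Admissible f) (hk : τ < k)
    (ht : τ < t) : truncProfile V V' k t ∈ Icc 0 (V t) := by
  rcases le_total t k with htk | hkt
  · rw [h.truncProfile_eq ht htk]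
    exact ⟨(h.pos t ht).le, le_rfl⟩
  · have hτ : ∀ s ∈ Icc k t, τ < s := fun s hs => hk.trans_le hs.1
    have hW := fun s hs => h.hasDerivAt_truncProfile hk (hτ s hs)
    have hlower := mul_sub_le_sub_of_hasDerivWithinAt (w := 0)
      (fun s hs => (hW s hs).hasDerivWithinAt)
      (fun s hs => mul_nonneg (h.deriv_pos hf (hτ s hs)).le cutoff_mem_Icc.1)
      (left_mem_Icc.2 hkt) (right_mem_Icc.2 hkt) hkt
    have hupper := mul_sub_le_sub_of_hasDerivWithinAt (w := 0)
      (fun s hs => ((h.hasDerivAt s (hτ s hs)).sub (hW s hs)).hasDerivWithinAt)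
      (fun s hs => sub_nonneg.2
        (mul_le_of_le_one_right (h.deriv_pos hf (hτ s hs)).le cutoff_mem_Icc.2))
      (left_mem_Icc.2 hkt) (right_mem_Icc.2 hkt) hkt
    simp only [h.truncProfile_eq hk le_rfl, Pi.sub_apply] at hlower hupper
    have := h.pos k hk
    constructor <;> linarith

theorem IsProfile.contDiffOn_truncProfile (h : IsProfile f τ V V') (hf : Admissible f)
    (hk : τ < k) : ContDiffOn ℝ 2 (truncProfile V V' k) (Ioi τ) := by
  refine contDiffOn_two_of_hasDerivAt isOpen_Ioi
    (fun t ht => h.hasDerivAt_truncProfile hk ht)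
    (fun t ht => (h.hasDerivAt' t ht).mul
      (contDiff_cutoff.differentiable one_ne_zero t).hasDerivAt) ?_
  exact ((ContinuousOn.mul (by fun_prop) (h.continuousOn_comp hf)).neg.mul
    contDiff_cutoff.continuous.continuousOn).add
      (h.continuousOn_deriv.mul contDiff_cutoff.continuous_deriv_one.continuousOn)

/-- The truncated radial function on the plane; near the origin, where `logRad` takes the junk
value `0`, it is the constant final value of the truncated profile. -/
noncomputable def truncRadial (V V' : ℝ → ℝ) (k : ℝ) (x : Plane) : ℝ :=
  if x = 0 then truncProfile V V' k (k + 1) else truncProfile V V' k (logRad x)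

variable {x : Plane}

theorem truncRadial_of_ne_zero (hx : x ≠ 0) :
    truncRadial V V' k x = truncProfile V V' k (logRad x) := if_neg hx

theorem truncRadial_eventuallyEq (hx : x ≠ 0) :
    truncRadial V V' k =ᶠ[𝓝 x] fun y => truncProfile V V' k (logRad y) := by
  filter_upwards [isOpen_ne.mem_nhds hx] with y hy using truncRadial_of_ne_zero hy

theorem IsProfile.truncRadial_eventuallyEq_const (h : IsProfile f τ V V') (hk : τ < k) :
    truncRadial V V' k =ᶠ[𝓝 0] fun _ => truncProfile V V' k (k + 1) := by
  filter_upwards [Metric.ball_mem_nhds (0 : Plane) (Real.exp_pos (-(k + 1) / 2))] with x hx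
  by_cases hx0 : x = 0
  · exact if_pos hx0
  · rw [truncRadial_of_ne_zero hx0]
    exact h.truncProfile_const hk ((lt_logRad_iff_mem_ball hx0).2 hx).le

theorem IsProfile.contDiffOn_truncRadial (h : IsProfile f τ V V') (hf : Admissible f)
    (hk : τ < k) :
    ContDiffOn ℝ 2 (truncRadial V V' k) (Metric.ball 0 (Real.exp (-τ / 2))) := by
  intro x hx
  refine ContDiffAt.contDiffWithinAt ?_
  rcases eq_or_ne x 0 with rfl | hx0
  · exact contDiffAt_const.congr_of_eventuallyEq (h.truncRadial_eventuallyEq_const hk)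
  · exact (((h.contDiffOn_truncProfile hf hk).contDiffAt
      (Ioi_mem_nhds ((lt_logRad_iff_mem_ball hx0).2 hx))).comp x
        (contDiffAt_logRad hx0)).congr_of_eventuallyEq (truncRadial_eventuallyEq hx0)

theorem IsProfile.laplacian_truncRadial (h : IsProfile f τ V V') (hf : Admissible f)
    (hk : τ < k) (hx : x ≠ 0) (hxτ : τ < logRad x) :
    (Δ (truncRadial V V' k)) x + f (V (logRad x)) * cutoff k (logRad x) =
      4 / ‖x‖ ^ 2 * (V' (logRad x) * deriv (cutoff k) (logRad x)) := by
  have hx0 : ‖x‖ ≠ 0 := norm_ne_zero_iff.2 hx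
  rw [(InnerProductSpace.laplacian_congr_nhds (truncRadial_eventuallyEq hx)).eq_of_nhds,
    laplacian_comp_logRad hx ((h.contDiffOn_truncProfile hf hk).contDiffAt (Ioi_mem_nhds hxτ)),
    deriv_deriv_eq_of_hasDerivAt isOpen_Ioi hxτ (fun t ht => h.hasDerivAt_truncProfile hk ht)
      ((h.hasDerivAt' _ hxτ).mul (contDiff_cutoff.differentiable one_ne_zero _).hasDerivAt),
    exp_neg_logRad hx]
  field_simp
  ring

theorem IsProfile.abs_truncation_error_le (h : IsProfile f τ V V') (hf : Admissible f)
    (hk : τ < k) {C : ℝ} (hC : ∀ t, |deriv (cutoff k) t| ≤ C) (hx : x ≠ 0) (hxτ : τ < logRad x) :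
    |4 / ‖x‖ ^ 2 * (V' (logRad x) * deriv (cutoff k) (logRad x))| ≤
      (Metric.closedBall (0 : Plane) (Real.exp (-k / 2))).indicator
        (fun _ => 4 * Real.exp (k + 1) * (V' k * C)) x := by
  have hC0 : 0 ≤ C := (abs_nonneg _).trans (hC 0)
  have hVk := h.deriv_pos hf hk
  have hVx := h.deriv_pos hf hxτ
  by_cases hin : logRad x ∈ Icc k (k + 1)
  · have hweight : 4 / ‖x‖ ^ 2 ≤ 4 * Real.exp (k + 1) := by
      rw [← exp_neg_logRad hx, div_eq_mul_inv, ← Real.exp_neg, neg_neg]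
      gcongr
      exact hin.2
    rw [indicator_of_mem ((le_logRad_iff_mem_closedBall hx).1 hin.1), abs_mul, abs_mul,
      abs_of_pos (by positivity : 0 < 4 / ‖x‖ ^ 2), abs_of_pos hVx]
    gcongr
    · exact h.antitoneOn_deriv hf hk self_mem_Ici hin.1 hin.1
    · exact hC _
  · rw [deriv_cutoff_eq_zero hin, mul_zero, mul_zero, abs_zero]
    exact indicator_nonneg (fun _ _ => by positivity) x

end Truncation

theorem tendsto_setIntegral_mul_of_dominated {X ι : Type*} [TopologicalSpace X] [T2Space X]
    [MeasurableSpace X] [OpensMeasurableSpace X] {μ : Measure X} {l : Filter ι}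
    [l.IsCountablyGenerated] {Ω : Set X} {w : ι → X → ℝ} {g ψ : X → ℝ}
    (hg : LocallyIntegrableOn g Ω μ) (hψ : Continuous ψ) (hc : HasCompactSupport ψ)
    (hs : tsupport ψ ⊆ Ω) (hw : ∀ᶠ k in l, AEStronglyMeasurable (w k) (μ.restrict Ω))
    (hle : ∀ᶠ k in l, ∀ᵐ x ∂μ.restrict Ω, ‖w k x‖ ≤ ‖g x‖)
    (hlim : ∀ᵐ x ∂μ.restrict Ω, Tendsto (fun k => w k x) l (𝓝 (g x))) :
    Tendsto (fun k => ∫ x in Ω, w k x * ψ x ∂μ) l (𝓝 (∫ x in Ω, g x * ψ x ∂μ)) := by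
  have hint : Integrable (fun x => g x * ψ x) (μ.restrict Ω) :=
    (integrable_mul_of_tsupport_subset hg hψ hc hs).restrict
  refine tendsto_integral_filter_of_dominated_convergence (fun x => ‖g x * ψ x‖) ?_ ?_ hint.norm ?_
  · filter_upwards [hw] with k hk using hk.mul hψ.aestronglyMeasurable
  · filter_upwards [hle] with k hk
    filter_upwards [hk] with x hx
    rw [norm_mul, norm_mul]
    gcongr
  · filter_upwards [hlim] with x hx using hx.mul_const (ψ x)

section Distribution

variable {f V V' : ℝ → ℝ} {τ k : ℝ} {φ : Plane → ℝ}

theorem IsProfile.locallyIntegrableOn (h : IsProfile f τ V V') (hf : Admissible f) :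
    LocallyIntegrableOn (fun x => V (logRad x)) (Metric.ball 0 (Real.exp (-τ / 2))) :=
  locallyIntegrableOn_comp_logRad fun _ ha => h.integrableOn_exp_mul hf ha

theorem IsProfile.locallyIntegrableOn_comp (h : IsProfile f τ V V') (hf : Admissible f) :
    LocallyIntegrableOn (fun x => f (V (logRad x))) (Metric.ball 0 (Real.exp (-τ / 2))) :=
  locallyIntegrableOn_comp_logRad fun _ ha => h.integrableOn_exp_mul_comp hf ha

theorem ae_restrict_ball_lt_logRad :
    ∀ᵐ x ∂volume.restrict (Metric.ball (0 : Plane) (Real.exp (-τ / 2))),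
      x ≠ 0 ∧ τ < logRad x := by
  filter_upwards [ae_restrict_mem measurableSet_ball,
    ae_restrict_of_ae (Measure.ae_ne volume (0 : Plane))] with x hx hx0
  exact ⟨hx0, (lt_logRad_iff_mem_ball hx0).2 hx⟩

theorem IsProfile.locallyIntegrableOn_comp_mul_cutoff (h : IsProfile f τ V V')
    (hf : Admissible f) :
    LocallyIntegrableOn (fun x => f (V (logRad x)) * cutoff k (logRad x))
      (Metric.ball 0 (Real.exp (-τ / 2))) :=
  locallyIntegrableOn_comp_logRad (φ := fun t => f (V t) * cutoff k t) fun a ha => by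
    simp only [← mul_assoc]
    exact (h.integrableOn_exp_mul_comp hf ha).mul_bdd (c := 1)
      contDiff_cutoff.continuous.aestronglyMeasurable
      (Eventually.of_forall fun t => by
        rw [Real.norm_of_nonneg cutoff_mem_Icc.1]
        exact cutoff_mem_Icc.2)

theorem IsProfile.tendsto_integral_truncRadial (h : IsProfile f τ V V') (hf : Admissible f)
    (hφ : Continuous φ) (hc : HasCompactSupport φ)
    (hs : tsupport φ ⊆ Metric.ball (0 : Plane) (Real.exp (-τ / 2))) :
    Tendsto (fun k => ∫ x in Metric.ball 0 (Real.exp (-τ / 2)), truncRadial V V' k x * φ x) atTop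
      (𝓝 (∫ x in Metric.ball 0 (Real.exp (-τ / 2)), V (logRad x) * φ x)) := by
  refine tendsto_setIntegral_mul_of_dominated (h.locallyIntegrableOn hf) hφ hc hs ?_ ?_ ?_
  · filter_upwards [eventually_gt_atTop τ] with k hk
    exact (h.contDiffOn_truncRadial hf hk).continuousOn.aestronglyMeasurable measurableSet_ball
  · filter_upwards [eventually_gt_atTop τ] with k hk
    filter_upwards [ae_restrict_ball_lt_logRad] with x ⟨hx, hxτ⟩
    have hW := h.truncProfile_mem_Icc hf hk hxτ
    rw [truncRadial_of_ne_zero hx, Real.norm_of_nonneg hW.1,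
      Real.norm_of_nonneg (hW.1.trans hW.2)]
    exact hW.2
  · filter_upwards [ae_restrict_ball_lt_logRad] with x ⟨hx, hxτ⟩
    refine tendsto_const_nhds.congr' ?_
    filter_upwards [eventually_ge_atTop (logRad x)] with k hk
    rw [truncRadial_of_ne_zero hx, h.truncProfile_eq hxτ hk]

theorem IsProfile.tendsto_integral_comp_mul_cutoff (h : IsProfile f τ V V') (hf : Admissible f)
    (hφ : Continuous φ) (hc : HasCompactSupport φ)
    (hs : tsupport φ ⊆ Metric.ball (0 : Plane) (Real.exp (-τ / 2))) :
    Tendsto (fun k => ∫ x in Metric.ball 0 (Real.exp (-τ / 2)),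
        f (V (logRad x)) * cutoff k (logRad x) * φ x) atTop
      (𝓝 (∫ x in Metric.ball 0 (Real.exp (-τ / 2)), f (V (logRad x)) * φ x)) := by
  refine tendsto_setIntegral_mul_of_dominated (h.locallyIntegrableOn_comp hf) hφ hc hs ?_ ?_ ?_
  · exact Eventually.of_forall fun k =>
      (h.locallyIntegrableOn_comp_mul_cutoff hf).aestronglyMeasurable
  · refine Eventually.of_forall fun k => Eventually.of_forall fun x => ?_
    rw [norm_mul, Real.norm_of_nonneg (cutoff_mem_Icc (k := k)).1]
    exact mul_le_of_le_one_right (norm_nonneg _) cutoff_mem_Icc.2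
  · refine Eventually.of_forall fun x => tendsto_const_nhds.congr' ?_
    filter_upwards [eventually_ge_atTop (logRad x)] with k hk
    rw [cutoff_eq_one hk, mul_one]

theorem setIntegral_mul_eq_integral {Ω : Set Plane} {g : Plane → ℝ} (hs : tsupport φ ⊆ Ω) :
    ∫ x in Ω, g x * φ x = ∫ x, g x * φ x :=
  setIntegral_eq_integral_of_forall_compl_eq_zero fun x hx => by
    rw [image_eq_zero_of_notMem_tsupport (fun hx' => hx (hs hx')), mul_zero]

theorem IsProfile.integral_truncRadial_add (h : IsProfile f τ V V') (hf : Admissible f)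
    (hk : τ < k) (hφ : ContDiff ℝ 2 φ) (hc : HasCompactSupport φ)
    (hs : tsupport φ ⊆ Metric.ball (0 : Plane) (Real.exp (-τ / 2))) :
    (∫ x in Metric.ball 0 (Real.exp (-τ / 2)), truncRadial V V' k x * (Δ φ) x) +
        ∫ x in Metric.ball 0 (Real.exp (-τ / 2)), f (V (logRad x)) * cutoff k (logRad x) * φ x =
      ∫ x in Metric.ball 0 (Real.exp (-τ / 2)),
        4 / ‖x‖ ^ 2 * (V' (logRad x) * deriv (cutoff k) (logRad x)) * φ x := by
  have hW := h.contDiffOn_truncRadial hf hk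
  rw [setIntegral_mul_eq_integral ((tsupport_laplacian_subset φ).trans hs),
    integral_mul_laplacian Metric.isOpen_ball hW hφ hc hs, ← setIntegral_mul_eq_integral hs,
    ← integral_add
      (integrable_mul_of_tsupport_subset
        ((continuousOn_laplacian Metric.isOpen_ball hW).locallyIntegrableOn measurableSet_ball)
        hφ.continuous hc hs).restrict
      (integrable_mul_of_tsupport_subset (h.locallyIntegrableOn_comp_mul_cutoff hf)
        hφ.continuous hc hs).restrict]
  refine integral_congr_ae ?_
  filter_upwards [ae_restrict_ball_lt_logRad] with x ⟨hx, hxτ⟩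
  rw [← add_mul, h.laplacian_truncRadial hf hk hx hxτ]

theorem IsProfile.abs_integral_truncation_error_le (h : IsProfile f τ V V') (hf : Admissible f)
    (hk : τ < k) {C M : ℝ} (hC : ∀ t, |deriv (cutoff k) t| ≤ C) (hM : ∀ x, |φ x| ≤ M) :
    |∫ x in Metric.ball 0 (Real.exp (-τ / 2)),
        4 / ‖x‖ ^ 2 * (V' (logRad x) * deriv (cutoff k) (logRad x)) * φ x| ≤
      4 * Real.exp 1 * C * M * Real.pi * V' k := by
  have hint : Integrable ((Metric.closedBall (0 : Plane) (Real.exp (-k / 2))).indicator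
      fun _ => 4 * Real.exp (k + 1) * (V' k * C)) :=
    (integrable_indicator_iff measurableSet_closedBall).2
      (integrableOn_const measure_closedBall_lt_top.ne enorm_ne_top)
  have hC0 : 0 ≤ C := (abs_nonneg _).trans (hC 0)
  have hM0 : 0 ≤ M := (abs_nonneg _).trans (hM 0)
  have hV' : 0 ≤ V' k := (h.deriv_pos hf hk).le
  have hexp : Real.exp (-k / 2) ^ 2 * Real.exp (k + 1) = Real.exp 1 := by
    rw [← Real.exp_nat_mul, ← Real.exp_add]
    congr 1
    push_cast
    ring
  calc |∫ x in Metric.ball 0 (Real.exp (-τ / 2)),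
          4 / ‖x‖ ^ 2 * (V' (logRad x) * deriv (cutoff k) (logRad x)) * φ x|
      ≤ ∫ x in Metric.ball 0 (Real.exp (-τ / 2)), (Metric.closedBall 0
          (Real.exp (-k / 2))).indicator (fun _ => 4 * Real.exp (k + 1) * (V' k * C)) x * M := by
        rw [← Real.norm_eq_abs]
        refine norm_integral_le_of_norm_le (hint.restrict.mul_const M) ?_
        filter_upwards [ae_restrict_ball_lt_logRad] with x ⟨hx, hxτ⟩
        rw [norm_mul]
        exact mul_le_mul (h.abs_truncation_error_le hf hk hC hx hxτ) (hM x) (norm_nonneg _)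
          (indicator_nonneg (fun _ _ => by positivity) x)
    _ ≤ ∫ x : Plane, (Metric.closedBall 0 (Real.exp (-k / 2))).indicator
          (fun _ => 4 * Real.exp (k + 1) * (V' k * C)) x * M :=
        setIntegral_le_integral (hint.mul_const M) (Eventually.of_forall fun x =>
          mul_nonneg (indicator_nonneg (fun _ _ => by positivity) x) hM0)
    _ = 4 * (Real.exp (-k / 2) ^ 2 * Real.exp (k + 1)) * C * M * Real.pi * V' k := by
        rw [integral_mul_const, integral_indicator measurableSet_closedBall, setIntegral_const,
          Measure.real, EuclideanSpace.volume_closedBall_fin_two, ENNReal.toReal_mul,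
          ENNReal.toReal_pow, ENNReal.toReal_ofReal (Real.exp_pos _).le,
          ENNReal.toReal_ofReal Real.pi_pos.le, smul_eq_mul]
        ring
    _ = 4 * Real.exp 1 * C * M * Real.pi * V' k := by rw [hexp]

theorem IsProfile.isDistributionalSolution (h : IsProfile f τ V V') (hf : Admissible f) :
    IsDistributionalSolution f (Metric.ball 0 (Real.exp (-τ / 2))) fun x => V (logRad x) := by
  refine ⟨h.locallyIntegrableOn hf, h.locallyIntegrableOn_comp hf, fun φ hφ hc hs => ?_⟩
  have hφ2 : ContDiff ℝ 2 φ := contDiff_infty.1 hφ 2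
  obtain ⟨C, hC⟩ := exists_abs_deriv_cutoff_le
  obtain ⟨M, hM⟩ := hφ.continuous.bounded_above_of_compact_support hc
  have hleft := h.tendsto_integral_truncRadial hf
    (continuousOn_univ.1 (continuousOn_laplacian isOpen_univ hφ2.contDiffOn))
    (hc.mono' ((subset_tsupport _).trans (tsupport_laplacian_subset φ)))
    ((tsupport_laplacian_subset φ).trans hs)
  have hright := h.tendsto_integral_comp_mul_cutoff hf hφ.continuous hc hs
  have herror : Tendsto (fun k => 4 * Real.exp 1 * C * M * Real.pi * V' k) atTop (𝓝 0) := by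
    simpa only [mul_zero] using h.tendsto'.const_mul (4 * Real.exp 1 * C * M * Real.pi)
  refine neg_eq_of_add_eq_zero_right
    (tendsto_nhds_unique (hleft.add hright) (squeeze_zero_norm' ?_ herror))
  filter_upwards [eventually_gt_atTop τ] with k hk
  rw [h.integral_truncRadial_add hf hk hφ2 hc hs]
  exact h.abs_integral_truncation_error_le hf hk (hC k) hM

end Distribution

theorem supRem_logRad (f : ℝ → ℝ) (B : ℝ) {x : Plane} (hx : x ≠ 0) :
    supRem f B (logRad x) =
      sSup ((fun y => R₁ f B y + R₂ f B y) '' {y : Plane | 0 < ‖y‖ ∧ ‖y‖ ≤ ‖x‖}) := by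
  rw [supRem, remValues, ← norm_eq_exp_logRad (norm_pos_iff.2 hx)]

theorem hasSingularAsymptotics_of_eventually_le {f : ℝ → ℝ} {B C : ℝ} {u : Plane → ℝ}
    (hu : ∀ᶠ x in 𝓝[≠] 0, |u x - uTilde f B x| ≤
      C * (f (uTilde f B x) * tailInt f (uTilde f B x) * supRem f B (logRad x))) :
    HasSingularAsymptotics f B u := by
  refine Asymptotics.IsBigO.of_bound |C| ?_
  filter_upwards [hu, self_mem_nhdsWithin] with x hux hx
  rw [← supRem_logRad f B hx, Real.norm_eq_abs, Real.norm_eq_abs, ← abs_mul]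
  exact hux.trans (le_abs_self _)

end SingularSol

theorem theorem2p2 (f : ℝ → ℝ) (B : ℝ)
    (hf1 : SingularSol.CondF1 f) (hf2 : SingularSol.CondF2 f B) (hR : SingularSol.CondR f B)
    (hC1 : ContDiffOn ℝ 1 f (Set.Ici 0))
    (hpos : ∀ s, 0 < s → 0 < f s)
    (hF : ∀ s, 0 < s → MeasureTheory.IntegrableOn (fun τ => (f τ)⁻¹) (Set.Ioi s))
    (hderiv : ∀ s, 0 < s → 0 < deriv f s) :
    ∃ R : ℝ, 0 < R ∧ ∃ u : SingularSol.Plane → ℝ,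
      SingularSol.IsClassicalRadialSolution f R u ∧
      Filter.Tendsto u (nhdsWithin 0 {0}ᶜ) Filter.atTop ∧
      SingularSol.HasSingularAsymptotics f B u ∧
      SingularSol.IsDistributionalSolution f (Metric.ball 0 R) u := by
  have hf : SingularSol.Admissible f := ⟨hC1, hpos, hF, hderiv⟩
  obtain ⟨C, t₁, U, U', hU, hbound⟩ := hf.exists_isProfile_near_uTilde hf1 hf2 hR
  obtain ⟨τ, t₂, V, V', hV, hVU, hVc, hV0⟩ := hU.exists_extension hf
  have hlog := SingularSol.tendsto_logRad
  refine ⟨Real.exp (-τ / 2), Real.exp_pos _, fun x => V (SingularSol.logRad x),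
    hV.isClassicalRadialSolution hf hVc hV0, hV.tendsto.comp hlog, ?_,
    hV.isDistributionalSolution hf⟩
  apply SingularSol.hasSingularAsymptotics_of_eventually_le (C := C)
  filter_upwards [hlog.eventually_gt_atTop t₁, hlog.eventually_gt_atTop t₂,
    self_mem_nhdsWithin] with x ht₁ ht₂ hx
  rw [hVU _ ht₂]
  exact hbound x (norm_pos_iff.2 hx) ht₁
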